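/- A randomized adaptive algorithm in the vector-matrix-vector query model has access to an unknown matrix $A\in\mathbb{R}^{d\times d}$ only through queries: it chooses vectors $v,w\in\mathbb{R}^d$, which may depend on its random coins and on the answers to its earlier queries, and receives $v^TAw$; finally it outputs True or False. Let $\|A\|_p$ denote the Schatten $p$-norm of $A$, i.e. the $\ell_p$ norm of the vector of its singular values. Such an algorithm is a (two-sided) $(\epsilon,\ell_p)$-tester if for every real symmetric $A\in\mathbb{R}^{d\times d}$ it outputs True with probability at least $2/3$ if $A$ is positive semidefinite, and outputs False with probability at least $2/3$ if $A\ne 0$ and $\lambda_{\min}(A)\le-\epsilon\|A\|_p$. (i) There are absolute constants $C,K$ such that for every $d\ge 1$ and every $\epsilon\in(0,1)$ there is a two-sided adaptive $(\epsilon,\ell_2)$-tester for $d\times d$ matrices in the vector-matrix-vector model that makes at most $\widetilde O(1/\epsilon^2)$ queries, precisely at most $C f(1+\log f)^K$ queries with $f=1/\epsilon^2$ (in particular a number independent of $d$). (ii) There are absolute constants $C,K$ such that for every $p\in[2,\infty]$, every $d\ge1$ and every $\epsilon\in(0,1)$ there is a two-sided adaptive $(\epsilon,\ell_p)$-tester for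 $d\times d$ matrices in the vector-matrix-vector model that makes at most $\widetilde O(\epsilon^{-2}d^{1-2/p})$ queries, precisely at most $C f(1+\log f)^K$ queries with $f=\epsilon^{-2}d^{1-2/p}$ (where $2/\infty=0$). -/

import Mathlib

open MeasureTheory
open scoped ENNReal Matrix

/-- The Schatten `p`-norm of a real square matrix: the `ℓ_p` norm of the vector of its `d` singular
values (the largest singular value if `p = ∞`). -/
noncomputable def schattenNorm {d : ℕ} (p : ℝ≥0∞) (A : Matrix (Fin d) (Fin d) ℝ) : ℝ :=
  ‖WithLp.toLp p (fun i : Fin d => (Matrix.toEuclideanLin A).singularValues i)‖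

/-- A nonzero matrix `A` is `ε‖A‖_p`-far from the PSD cone: it has an eigenvalue, equivalently
its smallest eigenvalue `λ_min(A)` satisfies, `λ ≤ -ε‖A‖_p`.  (The zero matrix is PSD and satisfies
the inequality trivially, so it has to be excluded.) -/
def IsFarFromPSD {d : ℕ} (ε : ℝ) (p : ℝ≥0∞) (A : Matrix (Fin d) (Fin d) ℝ) : Prop :=
  A ≠ 0 ∧ ∃ l : ℝ, Module.End.HasEigenvalue (Matrix.toLin' A) l ∧ l ≤ -ε * schattenNorm p A

/-- A randomized adaptive algorithm in the vector-matrix-vector query model for `d × d` matrices.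
It has random coins `ω` from a probability space `(Ω, μ)` and makes `numQueries` queries;
the pair of vectors `(v, w)` of the `k`-th query is a measurable function of the coins
and of the answers to the previous `k` queries, and the output (`true` / `false`) is a measurable
function of the coins and of all the answers. -/
structure VMVAlgorithm (d : ℕ) where
  /-- the space of random coins -/
  Ω : Type
  [measurableSpace : MeasurableSpace Ω]
  /-- the law of the random coins -/
  μ : Measure Ω
  [isProbabilityMeasure : IsProbabilityMeasure μ]
  /-- the number of queries that the algorithm makes (on every input, for all coins) -/
  numQueries : ℕ
  /-- the next query, given the coins and the answers so far -/
  query : (k : ℕ) → Ω → (Fin k → ℝ) → (Fin d → ℝ) × (Fin d → ℝ)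
  measurable_query : ∀ k, Measurable fun x : Ω × (Fin k → ℝ) => query k x.1 x.2
  /-- the answer of the algorithm, given the coins and the answers to all queries -/
  output : Ω → (Fin numQueries → ℝ) → Bool
  measurable_output : Measurable fun x : Ω × (Fin numQueries → ℝ) => output x.1 x.2

namespace VMVAlgorithm

attribute [instance] VMVAlgorithm.measurableSpace VMVAlgorithm.isProbabilityMeasure

variable {d : ℕ} (T : VMVAlgorithm d)

/-- The answers to the first `k` queries on input `A`, with coins `ω`: the answer to the query
`(v, w)` is `vᵀ A w`. -/
def answers (A : Matrix (Fin d) (Fin d) ℝ) (ω : T.Ω) : (k : ℕ) → (Fin k → ℝ)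
  | 0 => Fin.elim0
  | k + 1 =>
    let a := answers A ω k
    let q := T.query k ω a
    Fin.snoc (α := fun _ => ℝ) a (q.1 ⬝ᵥ (A *ᵥ q.2))

/-- The output of the algorithm on input `A`, with coins `ω`. -/
def run (A : Matrix (Fin d) (Fin d) ℝ) (ω : T.Ω) : Bool :=
  T.output ω (T.answers A ω T.numQueries)

/-- The algorithm is a (two-sided) `(ε, ℓ_p)`-tester: on every symmetric `A`, it outputs `true` with
probability at least `2/3` if `A` is PSD, and `false` with probability at least `2/3` if
`A` is `ε‖A‖_p`-far from the PSD cone. -/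
def IsTester (ε : ℝ) (p : ℝ≥0∞) : Prop :=
  ∀ A : Matrix (Fin d) (Fin d) ℝ, A.IsSymm →
    (A.PosSemidef → 2 / 3 ≤ T.μ.real {ω | T.run A ω = true}) ∧
    (IsFarFromPSD ε p A → 2 / 3 ≤ T.μ.real {ω | T.run A ω = false})

end VMVAlgorithm

/-- `C · f · (1 + log f)^K`; a quantity is `Õ(f)`, for `f ≥ 1`, if it is at most this for some
constants `C` and `K`. -/
noncomputable def softBound (C : ℝ) (K : ℕ) (f : ℝ) : ℝ :=
  C * f * (1 + Real.log f) ^ K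

open ProbabilityTheory
open scoped BigOperators

/-!
Compress the input to a sketch `M = Gᵀ A G` with a Gaussian `d × k` matrix `G`, where `k` is of
the order `ε⁻²` up to logarithms; a query to `M` is a query to `A`. The centred sketch
`M - tr A • 1` has Frobenius norm of the order `k ‖A‖_F`. Estimating `‖A‖_F` from a few
Gaussian bilinear forms and querying the diagonal of `M` allows one to replace the trace of `M` by
`k s`, where `s` is of the order `ε k ‖A‖_F`. The resulting symmetric matrix `N` has a nonnegative
form if `A` is PSD, because the lower tails of each `xᵀ M x` are sub-Gaussian and a fine grid of
directions suffices; if `A` has an eigenvalue below `-ε ‖A‖_F`, then `N` has one below `-2 s`, as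
`G` roughly multiplies the negative direction by `k`.

To find a negative direction of `N` with `k` queries up to logarithms, replace the exact gradient
in `x ← x - η N x` by its unbiased estimate `(gᵀ N x) g` with random signs `g`, which costs one
query. A step with `η gᵀ N g ≤ 1` does not increase the form of `N`, and with high probability
every step is of this kind. Meanwhile the component along the bottom eigenvector is multiplied by
`1 + 2 η s` or more in mean and its variance stays controlled, so that a last, exact gradient
step, which costs `k` queries, makes the form negative. The output is the sign of the form at this
point, so an error on a PSD input can only come from the sketch.

For `p > 2`, Hölder's inequality gives `‖A‖_2 ≤ d^(1/2 - 1/p) ‖A‖_p`, so an `ℓ_2`-tester with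
distance `ε d^(1/p - 1/2)` is an `ℓ_p`-tester with distance `ε`.
-/

/-- The vector of signs encoded by a Boolean vector; a uniformly random Boolean vector gives a
Rademacher vector. -/
def signVec {ι : Type*} (s : ι → Bool) : ι → ℝ := fun a => if s a then 1 else -1

section Signs

variable {ι : Type*}

lemma signVec_mul_self (s : ι → Bool) (a : ι) : signVec s a * signVec s a = 1 := by
  simp only [signVec]; split_ifs <;> norm_num

variable [DecidableEq ι]

/-- The Boolean vector with the coordinate `a` negated; this involution preserves the uniform law,
which is how odd moments of the signs are seen to vanish. -/
def flipAt (a : ι) (s : ι → Bool) : ι → Bool := Function.update s a (!(s a))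

lemma flipAt_involutive (a : ι) : Function.Involutive (flipAt a) := by
  intro s
  ext b
  by_cases h : b = a
  · subst h; simp [flipAt]
  · simp [flipAt, h]

lemma signVec_flipAt_self (a : ι) (s : ι → Bool) : signVec (flipAt a s) a = -signVec s a := by
  simp only [signVec, flipAt, Function.update_self]
  cases s a <;> simp

lemma signVec_flipAt_of_ne {a b : ι} (h : b ≠ a) (s : ι → Bool) :
    signVec (flipAt a s) b = signVec s b := by
  simp [signVec, flipAt, h]

variable [Fintype ι]

lemma expect_eq_zero_of_flipAt (a : ι) (f : (ι → Bool) → ℝ) (hf : ∀ s, f (flipAt a s) = -f s) :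
    𝔼 s, f s = 0 := by
  have hflip : 𝔼 s, f (flipAt a s) = 𝔼 s, f s :=
    Fintype.expect_equiv (flipAt_involutive a).toPerm _ _ (fun _ => rfl)
  simp only [hf, Finset.expect_neg_distrib] at hflip
  linarith

lemma expect_signVec_mul (a b : ι) :
    𝔼 s : ι → Bool, signVec s a * signVec s b = if a = b then 1 else 0 := by
  split_ifs with h
  · subst h; simp [signVec_mul_self]
  · apply expect_eq_zero_of_flipAt a
    intro s
    rw [signVec_flipAt_self, signVec_flipAt_of_ne (Ne.symm h)]
    ring

lemma expect_signVec_mul_four_of_ne {a b c d : ι} (hb : b ≠ a) (hc : c ≠ a) (hd : d ≠ a) :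
    𝔼 s : ι → Bool, signVec s a * signVec s b * (signVec s c * signVec s d) = 0 := by
  apply expect_eq_zero_of_flipAt a
  intro s
  rw [signVec_flipAt_self, signVec_flipAt_of_ne hb, signVec_flipAt_of_ne hc,
    signVec_flipAt_of_ne hd]
  ring

lemma expect_signVec_mul_four (a b c d : ι) :
    𝔼 s : ι → Bool, signVec s a * signVec s b * (signVec s c * signVec s d) =
      (if a = b then 1 else 0) * (if c = d then 1 else 0) +
      (if a = c then 1 else 0) * (if b = d then 1 else 0) +
      (if a = d then 1 else 0) * (if b = c then 1 else 0) -
      2 * ((if a = b then 1 else 0) * (if c = d then 1 else 0) * (if a = c then 1 else 0)) := by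
  by_cases hab : a = b
  · subst hab
    simp only [signVec_mul_self, one_mul, expect_signVec_mul, if_true]
    by_cases hcd : c = d
    · subst hcd; simp only [if_true]; split_ifs <;> norm_num
    · by_cases hac : a = c
      · subst hac; simp [hcd]
      · simp [hac, hcd]
  by_cases hac : a = c
  · subst hac
    have hmul (s : ι → Bool) : signVec s a * signVec s b * (signVec s a * signVec s d) =
        signVec s b * signVec s d := by
      linear_combination (signVec s b * signVec s d) * signVec_mul_self s a
    simp only [hmul, expect_signVec_mul, hab, if_true, if_false]
    simp [Ne.symm hab]
  by_cases had : a = d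
  · subst had
    have hmul (s : ι → Bool) : signVec s a * signVec s b * (signVec s c * signVec s a) =
        signVec s b * signVec s c := by
      linear_combination (signVec s b * signVec s c) * signVec_mul_self s a
    simp only [hmul, expect_signVec_mul, hab, hac, if_true, if_false]
    simp
  rw [expect_signVec_mul_four_of_ne (Ne.symm hab) (Ne.symm hac) (Ne.symm had)]
  simp [hab, hac, had]

omit [DecidableEq ι] in
lemma signVec_dotProduct_mulVec (P : Matrix ι ι ℝ) (s : ι → Bool) :
    signVec s ⬝ᵥ (P *ᵥ signVec s) = ∑ a, ∑ b, P a b * (signVec s a * signVec s b) := by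
  simp only [dotProduct, Matrix.mulVec, Finset.mul_sum]
  exact Finset.sum_congr rfl fun a _ => Finset.sum_congr rfl fun b _ => by ring

lemma expect_signVec_quadratic (P : Matrix ι ι ℝ) :
    𝔼 s : ι → Bool, signVec s ⬝ᵥ (P *ᵥ signVec s) = P.trace := by
  simp only [signVec_dotProduct_mulVec, Finset.expect_sum_comm, ← Finset.mul_expect,
    expect_signVec_mul]
  simp [Matrix.trace]

lemma expect_signVec_quadratic_mul (P Q : Matrix ι ι ℝ) (hQ : Q.IsSymm) :
    𝔼 s : ι → Bool, (signVec s ⬝ᵥ (P *ᵥ signVec s)) * (signVec s ⬝ᵥ (Q *ᵥ signVec s)) =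
      P.trace * Q.trace + 2 * ∑ a, ∑ b, P a b * Q a b - 2 * ∑ a, P a a * Q a a := by
  have hexpand (s : ι → Bool) :
      (signVec s ⬝ᵥ (P *ᵥ signVec s)) * (signVec s ⬝ᵥ (Q *ᵥ signVec s)) =
      ∑ a, ∑ b, ∑ c, ∑ d, P a b * Q c d *
        (signVec s a * signVec s b * (signVec s c * signVec s d)) := by
    rw [signVec_dotProduct_mulVec, signVec_dotProduct_mulVec]
    simp only [Finset.sum_mul]
    simp only [Finset.mul_sum]
    refine Finset.sum_congr rfl fun a _ => Finset.sum_congr rfl fun b _ =>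
      Finset.sum_congr rfl fun c _ => Finset.sum_congr rfl fun d _ => by ring
  simp only [hexpand, Finset.expect_sum_comm, ← Finset.mul_expect, expect_signVec_mul_four,
    mul_sub, mul_add, Finset.sum_sub_distrib, Finset.sum_add_distrib, mul_ite,
    mul_one, mul_zero, Finset.sum_ite_eq, Finset.mem_univ, if_true, Finset.sum_ite_irrel,
    Finset.sum_const_zero]
  have htrace : P.trace * Q.trace = ∑ a, ∑ b, P a a * Q b b := by
    simp [Matrix.trace, Finset.sum_mul_sum]
  have hsymm : ∑ a, ∑ b, P a b * Q b a = ∑ a, ∑ b, P a b * Q a b :=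
    Finset.sum_congr rfl fun a _ => Finset.sum_congr rfl fun b _ => by rw [hQ.apply a b]
  rw [htrace, hsymm]
  simp only [← Finset.sum_mul]
  ring

end Signs

section Frobenius

variable {m n : Type*} [Fintype m] [Fintype n]

/-- The square of the Frobenius norm of a real matrix, as an explicit polynomial in its entries
(in Mathlib the Frobenius norm is not a global instance). -/
def frobeniusSq (N : Matrix m n ℝ) : ℝ := ∑ a, ∑ b, N a b ^ 2

lemma frobeniusSq_nonneg (N : Matrix m n ℝ) : 0 ≤ frobeniusSq N :=
  Finset.sum_nonneg fun _ _ => Finset.sum_nonneg fun _ _ => sq_nonneg _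

lemma eq_zero_of_frobeniusSq_eq_zero {N : Matrix m n ℝ} (h : frobeniusSq N = 0) : N = 0 := by
  ext a b
  have hrow := (Finset.sum_eq_zero_iff_of_nonneg
    fun _ _ => Finset.sum_nonneg fun _ _ => sq_nonneg _).mp h a (Finset.mem_univ a)
  have hentry := (Finset.sum_eq_zero_iff_of_nonneg fun _ _ => sq_nonneg _).mp hrow b
    (Finset.mem_univ b)
  simpa using hentry

lemma frobeniusSq_eq_trace_transpose_mul (N : Matrix m n ℝ) : frobeniusSq N = (Nᵀ * N).trace := by
  simp only [frobeniusSq, Matrix.trace, Matrix.diag, Matrix.mul_apply, Matrix.transpose_apply, sq]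
  exact Finset.sum_comm

lemma trace_mul_self_eq_frobeniusSq {N : Matrix n n ℝ} (hN : N.IsSymm) :
    (N * N).trace = frobeniusSq N := by
  rw [frobeniusSq_eq_trace_transpose_mul, hN.eq]

lemma dotProduct_self_nonneg (x : n → ℝ) : 0 ≤ x ⬝ᵥ x :=
  Finset.sum_nonneg fun _ _ => mul_self_nonneg _

lemma dotProduct_sq_le (x y : n → ℝ) : (x ⬝ᵥ y) ^ 2 ≤ (x ⬝ᵥ x) * (y ⬝ᵥ y) := by
  simpa [dotProduct, sq] using Finset.sum_mul_sq_le_sq_mul_sq Finset.univ x y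

lemma mulVec_dotProduct_self_le (N : Matrix m n ℝ) (v : n → ℝ) :
    (N *ᵥ v) ⬝ᵥ (N *ᵥ v) ≤ frobeniusSq N * (v ⬝ᵥ v) := by
  rw [frobeniusSq, Finset.sum_mul]
  refine Finset.sum_le_sum fun a _ => ?_
  simpa [Matrix.mulVec, dotProduct, sq] using dotProduct_sq_le (N a) v

lemma bilinear_sq_le (N : Matrix m n ℝ) (x : m → ℝ) (y : n → ℝ) :
    (x ⬝ᵥ (N *ᵥ y)) ^ 2 ≤ frobeniusSq N * (x ⬝ᵥ x) * (y ⬝ᵥ y) := by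
  have hcauchy := dotProduct_sq_le x (N *ᵥ y)
  have hmul := mul_le_mul_of_nonneg_left (mulVec_dotProduct_self_le N y) (dotProduct_self_nonneg x)
  linarith

lemma abs_quadratic_le (N : Matrix n n ℝ) (x : n → ℝ) :
    |x ⬝ᵥ (N *ᵥ x)| ≤ √(frobeniusSq N) * (x ⬝ᵥ x) := by
  apply abs_le_of_sq_le_sq
  · rw [mul_pow, Real.sq_sqrt (frobeniusSq_nonneg N)]
    linarith [bilinear_sq_le N x x]
  · exact mul_nonneg (Real.sqrt_nonneg _) (dotProduct_self_nonneg x)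

lemma dotProduct_mulVec_of_isSymm {N : Matrix n n ℝ} (hN : N.IsSymm) (x y : n → ℝ) :
    x ⬝ᵥ (N *ᵥ y) = (N *ᵥ x) ⬝ᵥ y := by
  rw [Matrix.dotProduct_mulVec, ← Matrix.mulVec_transpose, hN.eq]

end Frobenius

section GradientStep

variable {ι : Type*} [Fintype ι] {N : Matrix ι ι ℝ} {η l : ℝ} {u : ι → ℝ}

/-- One step of the stochastic gradient iteration for the quadratic form of `N` with step size `η`:
for a random `g` with `𝔼 g gᵀ = 1` it is `x - η N x` on average, and it only uses the number
`gᵀ N x`, which is one query. -/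
def gradStep (N : Matrix ι ι ℝ) (η : ℝ) (x g : ι → ℝ) : ι → ℝ :=
  x - (η * (g ⬝ᵥ (N *ᵥ x))) • g

lemma quadratic_gradStep_le (hN : N.IsSymm) (hη : 0 ≤ η) (x g : ι → ℝ)
    (hg : η * (g ⬝ᵥ (N *ᵥ g)) ≤ 1) :
    gradStep N η x g ⬝ᵥ (N *ᵥ gradStep N η x g) ≤ x ⬝ᵥ (N *ᵥ x) := by
  have hcross : x ⬝ᵥ (N *ᵥ g) = g ⬝ᵥ (N *ᵥ x) := by
    rw [dotProduct_mulVec_of_isSymm hN, dotProduct_comm]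
  simp only [gradStep, Matrix.mulVec_sub, Matrix.mulVec_smul, dotProduct_sub, sub_dotProduct,
    dotProduct_smul, smul_dotProduct, smul_eq_mul, hcross]
  have hdecrease : 0 ≤ η * (g ⬝ᵥ (N *ᵥ x)) ^ 2 := by positivity
  nlinarith [mul_le_mul_of_nonneg_left hg hdecrease]

lemma quadratic_vecMulVec_self (v x : ι → ℝ) :
    x ⬝ᵥ (Matrix.vecMulVec v v *ᵥ x) = (x ⬝ᵥ v) ^ 2 := by
  rw [Matrix.vecMulVec_mulVec, dotProduct_smul, dotProduct_comm v]
  simp [sq]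

variable [DecidableEq ι]

lemma expect_signVec_dot_mul_dot (u v : ι → ℝ) :
    𝔼 s : ι → Bool, (signVec s ⬝ᵥ u) * (signVec s ⬝ᵥ v) = u ⬝ᵥ v := by
  rw [← Matrix.trace_vecMulVec, ← expect_signVec_quadratic]
  refine Finset.expect_congr rfl fun s _ => ?_
  rw [Matrix.vecMulVec_mulVec, dotProduct_smul, dotProduct_comm v]
  simp

lemma expect_signVec_dot_sq_mul_quadratic_le (v : ι → ℝ) {Q : Matrix ι ι ℝ} (hQ : Q.IsSymm)
    (hdiag : ∀ a, 0 ≤ Q a a) :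
    𝔼 s : ι → Bool, (signVec s ⬝ᵥ v) ^ 2 * (signVec s ⬝ᵥ (Q *ᵥ signVec s)) ≤
      (v ⬝ᵥ v) * Q.trace + 2 * (v ⬝ᵥ (Q *ᵥ v)) := by
  have hmoment := expect_signVec_quadratic_mul (Matrix.vecMulVec v v) Q hQ
  simp only [quadratic_vecMulVec_self, Matrix.trace_vecMulVec] at hmoment
  have hform : ∑ a, ∑ b, Matrix.vecMulVec v v a b * Q a b = v ⬝ᵥ (Q *ᵥ v) := by
    simp only [dotProduct, Matrix.mulVec, Finset.mul_sum, Matrix.vecMulVec_apply]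
    exact Finset.sum_congr rfl fun a _ => Finset.sum_congr rfl fun b _ => by ring
  have hcorrection : 0 ≤ ∑ a, Matrix.vecMulVec v v a a * Q a a :=
    Finset.sum_nonneg fun a _ => mul_nonneg (by
      rw [Matrix.vecMulVec_apply]; exact mul_self_nonneg _) (hdiag a)
  linarith

lemma expect_sq_quadratic_sub_trace_le (hN : N.IsSymm) :
    𝔼 s : ι → Bool, (signVec s ⬝ᵥ (N *ᵥ signVec s) - N.trace) ^ 2 ≤ 2 * frobeniusSq N := by
  have hexpand (s : ι → Bool) : (signVec s ⬝ᵥ (N *ᵥ signVec s) - N.trace) ^ 2 =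
      (signVec s ⬝ᵥ (N *ᵥ signVec s)) * (signVec s ⬝ᵥ (N *ᵥ signVec s)) -
      2 * N.trace * (signVec s ⬝ᵥ (N *ᵥ signVec s)) + N.trace ^ 2 := by ring
  simp only [hexpand, Finset.expect_add_distrib, Finset.expect_sub_distrib, ← Finset.mul_expect,
    expect_signVec_quadratic_mul N N hN, expect_signVec_quadratic,
    Finset.expect_const Finset.univ_nonempty]
  have hdiag : 0 ≤ ∑ a, N a a * N a a := Finset.sum_nonneg fun a _ => mul_self_nonneg _
  have hfrob : ∑ a, ∑ b, N a b * N a b = frobeniusSq N := by simp [frobeniusSq, sq]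
  rw [hfrob]
  linarith

lemma expect_mulVec_gradStep_le (hN : N.IsSymm) (hη : 0 ≤ η)
    (hl : ∀ x : ι → ℝ, -l * (x ⬝ᵥ x) ≤ x ⬝ᵥ (N *ᵥ x)) (x : ι → ℝ) :
    𝔼 s : ι → Bool, (N *ᵥ gradStep N η x (signVec s)) ⬝ᵥ (N *ᵥ gradStep N η x (signVec s)) ≤
      (1 + 2 * η * l + 3 * η ^ 2 * frobeniusSq N) * ((N *ᵥ x) ⬝ᵥ (N *ᵥ x)) := by
  set v := N *ᵥ x with hv
  have hform (y : ι → ℝ) : y ⬝ᵥ ((N * N) *ᵥ y) = (N *ᵥ y) ⬝ᵥ (N *ᵥ y) := by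
    rw [← Matrix.mulVec_mulVec, dotProduct_mulVec_of_isSymm hN]
  have hexpand (s : ι → Bool) :
      (N *ᵥ gradStep N η x (signVec s)) ⬝ᵥ (N *ᵥ gradStep N η x (signVec s)) =
      v ⬝ᵥ v - 2 * η * ((signVec s ⬝ᵥ v) * (signVec s ⬝ᵥ (N *ᵥ v))) +
      η ^ 2 * ((signVec s ⬝ᵥ v) ^ 2 * (signVec s ⬝ᵥ ((N * N) *ᵥ signVec s))) := by
    have hcross : v ⬝ᵥ (N *ᵥ signVec s) = signVec s ⬝ᵥ (N *ᵥ v) := by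
      rw [dotProduct_mulVec_of_isSymm hN, dotProduct_comm]
    have hcross' : (N *ᵥ signVec s) ⬝ᵥ v = signVec s ⬝ᵥ (N *ᵥ v) := by
      rw [dotProduct_comm, hcross]
    rw [hform]
    simp only [gradStep, ← hv, Matrix.mulVec_sub, Matrix.mulVec_smul, dotProduct_sub,
      sub_dotProduct, dotProduct_smul, smul_dotProduct, smul_eq_mul, hcross, hcross']
    ring
  simp only [hexpand, Finset.expect_add_distrib, Finset.expect_sub_distrib, ← Finset.mul_expect,
    expect_signVec_dot_mul_dot, Finset.expect_const Finset.univ_nonempty]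
  have hsecond := expect_signVec_dot_sq_mul_quadratic_le v (Q := N * N)
    (by rw [Matrix.IsSymm, Matrix.transpose_mul, hN.eq]) fun a => by
      rw [Matrix.mul_apply]
      exact Finset.sum_nonneg fun b _ => by rw [hN.apply a b]; exact mul_self_nonneg _
  rw [hform, trace_mul_self_eq_frobeniusSq hN] at hsecond
  have hfirst := mul_le_mul_of_nonneg_left (hl v) (by positivity : 0 ≤ 2 * η)
  have hsecond' : 𝔼 s : ι → Bool,
      (signVec s ⬝ᵥ v) ^ 2 * (signVec s ⬝ᵥ ((N * N) *ᵥ signVec s)) ≤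
      3 * frobeniusSq N * (v ⬝ᵥ v) := by
    linarith [mulVec_dotProduct_self_le N v]
  linarith [mul_le_mul_of_nonneg_left hsecond' (sq_nonneg η)]

lemma expect_dot_gradStep (hN : N.IsSymm) (hu : N *ᵥ u = -l • u) (x : ι → ℝ) :
    𝔼 s : ι → Bool, u ⬝ᵥ gradStep N η x (signVec s) = (1 + η * l) * (u ⬝ᵥ x) := by
  have hexpand (s : ι → Bool) : u ⬝ᵥ gradStep N η x (signVec s) =
      u ⬝ᵥ x - η * ((signVec s ⬝ᵥ (N *ᵥ x)) * (signVec s ⬝ᵥ u)) := by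
    rw [gradStep, dotProduct_sub, dotProduct_smul, smul_eq_mul, dotProduct_comm u (signVec s)]
    ring
  simp only [hexpand, Finset.expect_sub_distrib, ← Finset.mul_expect, expect_signVec_dot_mul_dot,
    Finset.expect_const Finset.univ_nonempty]
  rw [← dotProduct_mulVec_of_isSymm hN, hu, dotProduct_smul, smul_eq_mul, dotProduct_comm x]
  ring

lemma expect_sq_dot_gradStep_le (hN : N.IsSymm) (hu : N *ᵥ u = -l • u) (hu1 : u ⬝ᵥ u = 1)
    (x : ι → ℝ) :
    𝔼 s : ι → Bool, (u ⬝ᵥ gradStep N η x (signVec s)) ^ 2 ≤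
      (1 + η * l) ^ 2 * (u ⬝ᵥ x) ^ 2 + 2 * η ^ 2 * ((N *ᵥ x) ⬝ᵥ (N *ᵥ x)) := by
  set v := N *ᵥ x with hv
  have hvu : v ⬝ᵥ u = -l * (u ⬝ᵥ x) := by
    rw [hv, ← dotProduct_mulVec_of_isSymm hN, hu, dotProduct_smul, smul_eq_mul, dotProduct_comm x]
  have hexpand (s : ι → Bool) : (u ⬝ᵥ gradStep N η x (signVec s)) ^ 2 =
      (u ⬝ᵥ x) ^ 2 - 2 * η * (u ⬝ᵥ x) * ((signVec s ⬝ᵥ v) * (signVec s ⬝ᵥ u)) +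
      η ^ 2 * ((signVec s ⬝ᵥ v) ^ 2 *
        (signVec s ⬝ᵥ (Matrix.vecMulVec u u *ᵥ signVec s))) := by
    rw [quadratic_vecMulVec_self, gradStep, ← hv, dotProduct_sub, dotProduct_smul, smul_eq_mul,
      dotProduct_comm u (signVec s)]
    ring
  simp only [hexpand, Finset.expect_add_distrib, Finset.expect_sub_distrib, ← Finset.mul_expect,
    expect_signVec_dot_mul_dot, Finset.expect_const Finset.univ_nonempty, hvu]
  have hsecond := expect_signVec_dot_sq_mul_quadratic_le v (Q := Matrix.vecMulVec u u)
    (by rw [Matrix.IsSymm, Matrix.transpose_vecMulVec])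
    (fun a => by rw [Matrix.vecMulVec_apply]; exact mul_self_nonneg _)
  rw [quadratic_vecMulVec_self, Matrix.trace_vecMulVec, hu1, hvu] at hsecond
  have hcauchy := dotProduct_sq_le v u
  rw [hu1, hvu] at hcauchy
  nlinarith [mul_le_mul_of_nonneg_left hsecond (sq_nonneg η),
    mul_le_mul_of_nonneg_left hcauchy (sq_nonneg η)]

end GradientStep

section UniformLaw

variable {α : Type*}

/-- The uniform probability measure on a finite type. -/
noncomputable abbrev uniformLaw (α : Type*) [MeasurableSpace α] : Measure α :=
  uniformOn Set.univ

lemma uniformLaw_real_le_expect [Fintype α] [MeasurableSpace α] [MeasurableSingletonClass α]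
    {S : Set α} {f : α → ℝ} (hf : ∀ x, 0 ≤ f x) (hS : ∀ x ∈ S, 1 ≤ f x) :
    (uniformLaw α).real S ≤ 𝔼 x, f x := by
  classical
  have hexpect : (uniformLaw α).real S = 𝔼 x, (if x ∈ S then (1 : ℝ) else 0) := by
    rw [Measure.real, uniformOn_univ, ENNReal.toReal_div, Measure.count_apply_finite _
      (Set.toFinite _), Fintype.expect_eq_sum_div_card, Finset.sum_boole]
    simp only [ENNReal.toReal_natCast]
    congr 3
    ext x; simp
  rw [hexpect]
  refine Finset.expect_le_expect fun x _ => ?_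
  split_ifs with hx
  exacts [hS x hx, hf x]

lemma expect_pi_apply {ι : Type*} [Fintype ι] [DecidableEq ι] [Fintype α] [Nonempty α] (i : ι)
    (f : α → ℝ) : 𝔼 s : ι → α, f (s i) = 𝔼 a, f a := by
  rw [Fintype.expect_equiv (Equiv.funSplitAt i α) (fun s => f (s i)) (fun p => f p.1)
    fun _ => rfl, ← Finset.univ_product_univ, Finset.expect_product]
  simp only [Finset.expect_const Finset.univ_nonempty]

lemma expect_fin_succ [Fintype α] (n : ℕ) (f : (Fin (n + 1) → α) → ℝ) :
    𝔼 s, f s = 𝔼 a : α, 𝔼 s : Fin n → α, f (Fin.cons a s) := by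
  rw [← Finset.expect_product' Finset.univ Finset.univ (fun a s => f (Fin.cons a s))]
  exact (Fintype.expect_equiv (Fin.consEquiv (fun _ => α)) _ _ (fun _ => rfl)).symm

end UniformLaw

section GradientIteration

variable {ι : Type*} [Fintype ι] {N : Matrix ι ι ℝ} {η l : ℝ} {u : ι → ℝ}

/-- The stochastic gradient iteration started at the given vector, with the sequence `s` of random
sign directions. -/
def gradIter (N : Matrix ι ι ℝ) (η : ℝ) : (n : ℕ) → (Fin n → ι → Bool) → (ι → ℝ) → ι → ℝ
  | 0, _, x => x
  | n + 1, s, x => gradIter N η n (Fin.tail s) (gradStep N η x (signVec (s 0)))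

lemma gradIter_cons (n : ℕ) (a : ι → Bool) (s : Fin n → ι → Bool) (x : ι → ℝ) :
    gradIter N η (n + 1) (Fin.cons a s) x = gradIter N η n s (gradStep N η x (signVec a)) := by
  simp [gradIter]

lemma quadratic_gradIter_le (hN : N.IsSymm) (hη : 0 ≤ η) (n : ℕ) (s : Fin n → ι → Bool)
    (x : ι → ℝ) (hs : ∀ t, η * (signVec (s t) ⬝ᵥ (N *ᵥ signVec (s t))) ≤ 1) :
    gradIter N η n s x ⬝ᵥ (N *ᵥ gradIter N η n s x) ≤ x ⬝ᵥ (N *ᵥ x) := by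
  induction n generalizing x with
  | zero => exact le_rfl
  | succ n ih =>
    exact (ih (Fin.tail s) _ fun t => hs t.succ).trans (quadratic_gradStep_le hN hη x _ (hs 0))

section Moments

variable [DecidableEq ι]

lemma expect_dot_gradIter (hN : N.IsSymm) (hu : N *ᵥ u = -l • u) (n : ℕ) (x : ι → ℝ) :
    𝔼 s, u ⬝ᵥ gradIter N η n s x = (1 + η * l) ^ n * (u ⬝ᵥ x) := by
  induction n generalizing x with
  | zero => simp [gradIter]
  | succ n ih =>
    simp only [expect_fin_succ, gradIter_cons, ih, ← Finset.mul_expect, expect_dot_gradStep hN hu]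
    ring

lemma expect_sq_dot_gradIter_le (hN : N.IsSymm) (hη : 0 ≤ η) (hl0 : 0 ≤ l)
    (hl : ∀ x : ι → ℝ, -l * (x ⬝ᵥ x) ≤ x ⬝ᵥ (N *ᵥ x))
    (hu : N *ᵥ u = -l • u) (hu1 : u ⬝ᵥ u = 1) (n : ℕ) (x : ι → ℝ) :
    𝔼 s, (u ⬝ᵥ gradIter N η n s x) ^ 2 ≤ (1 + η * l) ^ (2 * n) * ((u ⬝ᵥ x) ^ 2 +
      2 * η ^ 2 * n * (1 + 3 * η ^ 2 * frobeniusSq N) ^ n * ((N *ᵥ x) ⬝ᵥ (N *ᵥ x))) := by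
  have hF := frobeniusSq_nonneg N
  set q := 1 + 3 * η ^ 2 * frobeniusSq N with hq
  have hq1 : 1 ≤ q := by rw [hq]; nlinarith [mul_nonneg (sq_nonneg η) hF]
  set r := 1 + η * l with hr
  have hr1 : 1 ≤ r := by rw [hr]; nlinarith [mul_nonneg hη hl0]
  induction n generalizing x with
  | zero => simp [gradIter]
  | succ n ih =>
    simp only [expect_fin_succ, gradIter_cons]
    refine (Finset.expect_le_expect fun s _ => ih _).trans ?_
    simp only [← Finset.mul_expect, Finset.expect_add_distrib]
    have hdot := expect_sq_dot_gradStep_le (η := η) hN hu hu1 x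
    have hmulVec := expect_mulVec_gradStep_le hN hη hl x
    set W := (N *ᵥ x) ⬝ᵥ (N *ᵥ x)
    have hW : 0 ≤ W := dotProduct_self_nonneg _
    have hfactor : 1 + 2 * η * l + 3 * η ^ 2 * frobeniusSq N ≤ r ^ 2 * q := by
      have : 0 ≤ (r ^ 2 - 1) * (q - 1) := mul_nonneg (by nlinarith) (by linarith)
      nlinarith [sq_nonneg (η * l)]
    have hmulVec' := mul_le_mul_of_nonneg_left
      (hmulVec.trans (mul_le_mul_of_nonneg_right hfactor hW))
      (by positivity : 0 ≤ 2 * η ^ 2 * n * q ^ n)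
    have hlast : 2 * η ^ 2 * W ≤ r ^ 2 * (2 * η ^ 2 * q ^ (n + 1) * W) := by
      have hone := one_le_mul_of_one_le_of_one_le (one_le_pow₀ hr1 : 1 ≤ r ^ 2)
        (one_le_pow₀ hq1 : 1 ≤ q ^ (n + 1))
      linarith [mul_le_mul_of_nonneg_left hone (by positivity : 0 ≤ 2 * η ^ 2 * W)]
    rw [show r ^ (2 * (n + 1)) = r ^ (2 * n) * r ^ 2 by ring, mul_assoc (r ^ (2 * n)) (r ^ 2)]
    refine mul_le_mul_of_nonneg_left ?_ (by positivity : 0 ≤ r ^ (2 * n))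
    push_cast
    rw [pow_succ q] at hlast ⊢
    linarith

lemma expect_sq_dot_gradIter_sub_le (hN : N.IsSymm) (hη : 0 ≤ η) (hl0 : 0 ≤ l)
    (hl : ∀ x : ι → ℝ, -l * (x ⬝ᵥ x) ≤ x ⬝ᵥ (N *ᵥ x))
    (hu : N *ᵥ u = -l • u) (hu1 : u ⬝ᵥ u = 1) (n : ℕ) (x : ι → ℝ) :
    𝔼 s, (u ⬝ᵥ gradIter N η n s x - (1 + η * l) ^ n * (u ⬝ᵥ x)) ^ 2 ≤
      ((1 + η * l) ^ n) ^ 2 *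
      (2 * η ^ 2 * n * (1 + 3 * η ^ 2 * frobeniusSq N) ^ n * ((N *ᵥ x) ⬝ᵥ (N *ᵥ x))) := by
  have hexpand (s : Fin n → ι → Bool) :
      (u ⬝ᵥ gradIter N η n s x - (1 + η * l) ^ n * (u ⬝ᵥ x)) ^ 2 =
      (u ⬝ᵥ gradIter N η n s x) ^ 2 -
      2 * ((1 + η * l) ^ n * (u ⬝ᵥ x)) * (u ⬝ᵥ gradIter N η n s x) +
      ((1 + η * l) ^ n * (u ⬝ᵥ x)) ^ 2 := by ring
  simp only [hexpand, Finset.expect_add_distrib, Finset.expect_sub_distrib, ← Finset.mul_expect,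
    expect_dot_gradIter hN hu, Finset.expect_const Finset.univ_nonempty]
  have hsecond := expect_sq_dot_gradIter_le hN hη hl0 hl hu hu1 n x
  rw [mul_add, pow_mul'] at hsecond
  linarith

end Moments

/-- The endpoint of the stochastic gradient iteration, followed by one exact gradient step of size
`α`. The last step turns the growth of the component along a negative eigenvector into a negative
value of the quadratic form. -/
def descentPoint {n : ℕ} (N : Matrix ι ι ℝ) (η α : ℝ) (x : ι → ℝ) (s : Fin n → ι → Bool) : ι → ℝ :=
  gradIter N η n s x - α • (N *ᵥ gradIter N η n s x)

lemma quadratic_sub_smul_mulVec_le (hN : N.IsSymm) {α : ℝ} (hα0 : 0 ≤ α)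
    (hα : α * √(frobeniusSq N) ≤ 1) (x : ι → ℝ) :
    (x - α • (N *ᵥ x)) ⬝ᵥ (N *ᵥ (x - α • (N *ᵥ x))) ≤
      x ⬝ᵥ (N *ᵥ x) - α * ((N *ᵥ x) ⬝ᵥ (N *ᵥ x)) := by
  set v := N *ᵥ x with hv
  have hcross : x ⬝ᵥ (N *ᵥ v) = v ⬝ᵥ v := dotProduct_mulVec_of_isSymm hN _ _
  have hform := mul_le_mul_of_nonneg_left ((le_abs_self _).trans (abs_quadratic_le N v)) hα0
  have hone := mul_le_mul_of_nonneg_right hα (dotProduct_self_nonneg v)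
  have hsecond : α * (α * (v ⬝ᵥ (N *ᵥ v))) ≤ α * (v ⬝ᵥ v) :=
    mul_le_mul_of_nonneg_left (by linarith) hα0
  simp only [Matrix.mulVec_sub, Matrix.mulVec_smul, dotProduct_sub, sub_dotProduct,
    dotProduct_smul, smul_dotProduct, smul_eq_mul, ← hv, hcross]
  linarith

lemma sq_mul_sq_dot_le_mulVec_dotProduct_self (hN : N.IsSymm) (hu : N *ᵥ u = -l • u)
    (hu1 : u ⬝ᵥ u = 1) (z : ι → ℝ) : l ^ 2 * (u ⬝ᵥ z) ^ 2 ≤ (N *ᵥ z) ⬝ᵥ (N *ᵥ z) := by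
  have hcauchy := dotProduct_sq_le (N *ᵥ z) u
  rw [← dotProduct_mulVec_of_isSymm hN, hu, dotProduct_smul, hu1, smul_eq_mul,
    dotProduct_comm z] at hcauchy
  linarith

lemma quadratic_descentPoint_neg (hN : N.IsSymm) (hη : 0 ≤ η) (hu : N *ᵥ u = -l • u)
    (hu1 : u ⬝ᵥ u = 1) {n : ℕ} {x : ι → ℝ} {α : ℝ} (hα0 : 0 ≤ α)
    (hα : α * √(frobeniusSq N) ≤ 1) {s : Fin n → ι → Bool}
    (hs : ∀ t, η * (signVec (s t) ⬝ᵥ (N *ᵥ signVec (s t))) ≤ 1)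
    (hgrowth : x ⬝ᵥ (N *ᵥ x) < α * (l ^ 2 * (u ⬝ᵥ gradIter N η n s x) ^ 2)) :
    descentPoint N η α x s ⬝ᵥ (N *ᵥ descentPoint N η α x s) < 0 := by
  have hiter := quadratic_gradIter_le hN hη n s x hs
  have hlast := quadratic_sub_smul_mulVec_le hN hα0 hα (gradIter N η n s x)
  have hgrad := mul_le_mul_of_nonneg_left
    (sq_mul_sq_dot_le_mulVec_dotProduct_self hN hu hu1 (gradIter N η n s x)) hα0
  rw [descentPoint]
  linarith

lemma uniformLaw_exists_quadratic_gt_le (hN : N.IsSymm) (n : ℕ) {Δ : ℝ} (hΔ : 0 < Δ) :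
    (uniformLaw (Fin n → ι → Bool)).real
      {s | ∃ t, N.trace + Δ < signVec (s t) ⬝ᵥ (N *ᵥ signVec (s t))} ≤
      n * (2 * frobeniusSq N / Δ ^ 2) := by
  classical
  refine (uniformLaw_real_le_expect
    (f := fun s => ∑ t, 1 / Δ ^ 2 * (signVec (s t) ⬝ᵥ (N *ᵥ signVec (s t)) - N.trace) ^ 2)
    (fun s => by positivity) ?_).trans ?_
  · rintro s ⟨t, ht⟩
    refine le_trans ?_ (Finset.single_le_sum (fun t _ => by positivity) (Finset.mem_univ t))
    rw [one_div_mul_eq_div, one_le_div (by positivity)]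
    exact pow_le_pow_left₀ hΔ.le (by linarith) 2
  · rw [Finset.expect_sum_comm]
    refine (Finset.sum_le_card_nsmul _ _ (2 * frobeniusSq N / Δ ^ 2) fun t _ => ?_).trans
      (by simp)
    rw [expect_pi_apply t
      (fun s : ι → Bool => 1 / Δ ^ 2 * (signVec s ⬝ᵥ (N *ᵥ signVec s) - N.trace) ^ 2),
      ← Finset.mul_expect, one_div_mul_eq_div]
    gcongr
    exact expect_sq_quadratic_sub_trace_le hN

lemma four_mul_sq_sub_ge_of_four_mul_sq_le {y P : ℝ} (h : 4 * y ^ 2 ≤ P ^ 2) :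
    P ^ 2 ≤ 4 * (y - P) ^ 2 := by
  have hy : |2 * y| ≤ |P| := by
    apply sq_le_sq.mp; linarith
  have hP : |P| ≤ |2 * (y - P)| := by
    have htri : |2 * P| ≤ |2 * y| + |2 * (y - P)| := by
      simpa [mul_sub] using abs_sub (2 * y) (2 * (y - P))
    rw [abs_mul 2 P, abs_two] at htri
    linarith
  linarith [sq_le_sq.mpr hP]

lemma uniformLaw_sq_dot_gradIter_le (hN : N.IsSymm) (hη : 0 ≤ η) (hl0 : 0 ≤ l)
    (hl : ∀ x : ι → ℝ, -l * (x ⬝ᵥ x) ≤ x ⬝ᵥ (N *ᵥ x))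
    (hu : N *ᵥ u = -l • u) (hu1 : u ⬝ᵥ u = 1) (n : ℕ) {x : ι → ℝ} (hux : u ⬝ᵥ x ≠ 0) :
    (uniformLaw (Fin n → ι → Bool)).real
      {s | 4 * (u ⬝ᵥ gradIter N η n s x) ^ 2 ≤ ((1 + η * l) ^ n * (u ⬝ᵥ x)) ^ 2} ≤
      4 * (2 * η ^ 2 * n * (1 + 3 * η ^ 2 * frobeniusSq N) ^ n * ((N *ᵥ x) ⬝ᵥ (N *ᵥ x))) /
        (u ⬝ᵥ x) ^ 2 := by
  classical
  set P := (1 + η * l) ^ n * (u ⬝ᵥ x) with hP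
  have hP0 : 0 < P ^ 2 := by rw [hP]; positivity
  refine (uniformLaw_real_le_expect
    (f := fun s => 4 / P ^ 2 * (u ⬝ᵥ gradIter N η n s x - P) ^ 2)
    (fun s => by positivity) fun s hs => ?_).trans ?_
  · rw [div_mul_eq_mul_div, one_le_div hP0]
    exact four_mul_sq_sub_ge_of_four_mul_sq_le hs
  · rw [← Finset.mul_expect]
    refine (mul_le_mul_of_nonneg_left (expect_sq_dot_gradIter_sub_le hN hη hl0 hl hu hu1 n x)
      (by positivity)).trans (le_of_eq ?_)
    rw [hP]
    field_simp

lemma uniformLaw_quadratic_descentPoint_nonneg_le (hN : N.IsSymm) (hη : 0 ≤ η) (hl0 : 0 ≤ l)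
    (hl : ∀ x : ι → ℝ, -l * (x ⬝ᵥ x) ≤ x ⬝ᵥ (N *ᵥ x))
    (hu : N *ᵥ u = -l • u) (hu1 : u ⬝ᵥ u = 1) (n : ℕ) {x : ι → ℝ} {Δ α : ℝ} (hΔ : 0 < Δ)
    (hstep : η * (N.trace + Δ) ≤ 1) (hα0 : 0 ≤ α) (hα : α * √(frobeniusSq N) ≤ 1)
    (hux : u ⬝ᵥ x ≠ 0)
    (hgrowth : x ⬝ᵥ (N *ᵥ x) < α * (l ^ 2 * (((1 + η * l) ^ n * (u ⬝ᵥ x)) ^ 2 / 4))) :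
    (uniformLaw (Fin n → ι → Bool)).real
      {s | 0 ≤ descentPoint N η α x s ⬝ᵥ (N *ᵥ descentPoint N η α x s)} ≤
      4 * (2 * η ^ 2 * n * (1 + 3 * η ^ 2 * frobeniusSq N) ^ n * ((N *ᵥ x) ⬝ᵥ (N *ᵥ x))) /
        (u ⬝ᵥ x) ^ 2 + n * (2 * frobeniusSq N / Δ ^ 2) := by
  refine (measureReal_mono ?_).trans ((measureReal_union_le _ _).trans
    (add_le_add (uniformLaw_sq_dot_gradIter_le hN hη hl0 hl hu hu1 n hux)
      (uniformLaw_exists_quadratic_gt_le hN n hΔ)))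
  intro s hs
  by_contra hgood
  simp only [Set.mem_union, Set.mem_ofPred_eq, not_or, not_le, not_exists, not_lt] at hgood hs
  obtain ⟨hdot, hadmissible⟩ := hgood
  refine hs.not_gt (quadratic_descentPoint_neg hN hη hu hu1 hα0 hα (fun t =>
    (mul_le_mul_of_nonneg_left (hadmissible t) hη).trans hstep) (hgrowth.trans_le ?_))
  gcongr
  linarith

end GradientIteration

section Probability

lemma measureReal_ge_le_integral_div {α : Type*} [MeasurableSpace α] {μ : Measure α}
    {f : α → ℝ} (hf : Integrable f μ) (hf0 : ∀ x, 0 ≤ f x) {t : ℝ} (ht : 0 < t) :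
    μ.real {x | t ≤ f x} ≤ (∫ x, f x ∂μ) / t := by
  rw [le_div_iff₀' ht]
  exact mul_meas_ge_le_integral_of_nonneg (Filter.Eventually.of_forall hf0) hf t

lemma measureReal_prod_le {α β : Type*} [MeasurableSpace α] [MeasurableSpace β] {μ : Measure α}
    {ν : Measure β} [IsProbabilityMeasure μ] [IsProbabilityMeasure ν] {S : Set (α × β)}
    (hS : MeasurableSet S) {B : Set α} {a b : ℝ} (hb0 : 0 ≤ b) (hB : μ.real B ≤ a)
    (hb : ∀ x ∉ B, ν.real {y | (x, y) ∈ S} ≤ b) : (μ.prod ν).real S ≤ a + b := by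
  have hsection (x : α) : ν (Prod.mk x ⁻¹' S) ≤
      (toMeasurable μ B).indicator (fun _ => 1) x + ENNReal.ofReal b := by
    by_cases hx : x ∈ toMeasurable μ B
    · rw [Set.indicator_of_mem hx]
      exact le_add_right prob_le_one
    · rw [Set.indicator_of_notMem hx, zero_add, ← ofReal_measureReal]
      exact ENNReal.ofReal_le_ofReal (hb x fun h => hx (subset_toMeasurable μ B h))
  have hprod : (μ.prod ν) S ≤ μ B + ENNReal.ofReal b :=
    calc (μ.prod ν) S = ∫⁻ x, ν (Prod.mk x ⁻¹' S) ∂μ := Measure.prod_apply hS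
      _ ≤ ∫⁻ x, ((toMeasurable μ B).indicator (fun _ => 1) x + ENNReal.ofReal b) ∂μ :=
          lintegral_mono hsection
      _ = μ B + ENNReal.ofReal b := by
          rw [lintegral_add_right _ measurable_const,
            lintegral_indicator (measurableSet_toMeasurable μ B)]
          simp
  calc (μ.prod ν).real S ≤ (μ B + ENNReal.ofReal b).toReal :=
        ENNReal.toReal_mono (by finiteness) hprod
    _ = μ.real B + b := by
        rw [ENNReal.toReal_add (by finiteness) (by finiteness), ENNReal.toReal_ofReal hb0]
        rfl
    _ ≤ a + b := by gcongr

variable {E κ : Type*} [MeasurableSpace E] [Fintype κ] {ν : Measure E} [IsProbabilityMeasure ν]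

lemma memLp_sum_mul_eval {f : E → ℝ} (hf : MemLp f 2 ν) (c : κ → ℝ) :
    MemLp (fun x : κ → E => ∑ i, c i * f (x i)) 2 (Measure.pi fun _ => ν) :=
  memLp_finsetSum _ fun i _ =>
    (hf.comp_measurePreserving (measurePreserving_eval (fun _ => ν) i)).const_mul (c i)

lemma integral_sum_mul_eval {f : E → ℝ} (hf : MemLp f 2 ν) (h0 : ∫ x, f x ∂ν = 0)
    (c : κ → ℝ) : ∫ x : κ → E, ∑ i, c i * f (x i) ∂(Measure.pi fun _ => ν) = 0 := by
  have hint (i : κ) : Integrable (fun x : κ → E => f (x i)) (Measure.pi fun _ => ν) :=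
    (hf.comp_measurePreserving (measurePreserving_eval (fun _ => ν) i)).integrable (by norm_num)
  rw [integral_finsetSum _ fun i _ => (hint i).const_mul (c i)]
  refine Finset.sum_eq_zero fun i _ => ?_
  rw [integral_const_mul, integral_comp_eval (μ := fun _ => ν) (i := i) hf.aestronglyMeasurable,
    h0, mul_zero]

lemma integral_sq_sum_mul_eval {f : E → ℝ} (hf : MemLp f 2 ν) (h0 : ∫ x, f x ∂ν = 0)
    (c : κ → ℝ) :
    ∫ x : κ → E, (∑ i, c i * f (x i)) ^ 2 ∂(Measure.pi fun _ => ν) =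
      (∑ i, c i ^ 2) * ∫ x, f x ^ 2 ∂ν := by
  have hvar := variance_sum_pi (μ := fun _ : κ => ν) (X := fun i x => c i * f x)
    fun i => hf.const_mul (c i)
  rw [show (∑ i, fun ω : κ → E => c i * f (ω i)) = fun ω => ∑ i, c i * f (ω i) by
      ext ω; simp only [Finset.sum_apply],
    variance_eq_integral (memLp_sum_mul_eval hf c).aemeasurable,
    integral_sum_mul_eval hf h0 c] at hvar
  simp only [sub_zero] at hvar
  rw [hvar, Finset.sum_mul]
  refine Finset.sum_congr rfl fun i _ => ?_
  rw [variance_const_mul, variance_eq_integral hf.aemeasurable, h0]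
  simp only [sub_zero]

lemma measureReal_abs_sum_mul_eval_ge_le {f : E → ℝ} (hf : MemLp f 2 ν)
    (h0 : ∫ x, f x ∂ν = 0) (c : κ → ℝ) {v t : ℝ} (hv : ∫ x, f x ^ 2 ∂ν ≤ v) (ht : 0 < t) :
    (Measure.pi fun _ : κ => ν).real {x | t ≤ |∑ i, c i * f (x i)|} ≤
      v * (∑ i, c i ^ 2) / t ^ 2 := by
  have habs (y : ℝ) : t ≤ |y| ↔ t ^ 2 ≤ y ^ 2 := by rw [sq_le_sq, abs_of_pos ht]
  simp only [habs]
  refine (measureReal_ge_le_integral_div (memLp_sum_mul_eval hf c).integrable_sq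
    (fun x => sq_nonneg _) (by positivity)).trans ?_
  rw [integral_sq_sum_mul_eval hf h0 c, mul_comm]
  gcongr

lemma measurePreserving_update_pi [DecidableEq κ] (i : κ) :
    MeasurePreserving (fun p : E × (κ → E) => Function.update p.2 i p.1)
      (ν.prod (Measure.pi fun _ => ν)) (Measure.pi fun _ => ν) := by
  have hm : Measurable (fun p : E × (κ → E) => Function.update p.2 i p.1) := by
    refine measurable_pi_lambda _ fun j => ?_
    by_cases h : j = i
    · subst h; simpa using measurable_fst
    · simp only [Function.update_of_ne h]
      exact (measurable_pi_apply j).comp measurable_snd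
  refine ⟨hm, (Measure.pi_eq fun s hs => ?_).symm⟩
  have hbox : (fun p : E × (κ → E) => Function.update p.2 i p.1) ⁻¹' (Set.univ.pi s) =
      s i ×ˢ Set.univ.pi (Function.update s i Set.univ) := by
    ext p
    simp only [Set.mem_preimage, Set.mem_univ_pi, Set.mem_prod]
    grind [Function.update_apply]
  rw [Measure.map_apply hm (MeasurableSet.univ_pi hs), hbox, Measure.prod_prod, Measure.pi_pi,
    ← Finset.mul_prod_erase _ _ (Finset.mem_univ i),
    ← Finset.mul_prod_erase (a := i) (s := Finset.univ) _ (Finset.mem_univ i)]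
  simp only [Function.update_self, measure_univ, one_mul]
  congr 1
  refine Finset.prod_congr rfl fun j hj => ?_
  rw [Function.update_of_ne (Finset.ne_of_mem_erase hj)]

end Probability

section GaussianReal

lemma integrable_pow_gaussianReal (m : ℝ) (v : NNReal) (n : ℕ) :
    Integrable (fun z : ℝ => z ^ n) (gaussianReal m v) := by
  have h := (memLp_id_gaussianReal (μ := m) (v := v) n).integrable_norm_pow'
  refine (integrable_norm_iff (by fun_prop)).1 ?_
  simpa only [id_eq, norm_pow] using h

lemma integral_sq_gaussianReal : ∫ z, z ^ 2 ∂(gaussianReal 0 1) = 1 := by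
  have h := variance_fun_id_gaussianReal (μ := 0) (v := 1)
  rw [variance_eq_integral measurable_id'.aemeasurable] at h
  simpa only [integral_id_gaussianReal, sub_zero, NNReal.coe_one] using h

lemma integral_pow_four_gaussianReal : ∫ z, z ^ 4 ∂(gaussianReal 0 1) = 3 := by
  have hpdf (x : ℝ) : gaussianPDFReal 0 1 x • x ^ 4 = (√(2 * Real.pi))⁻¹ *
      (fun y : ℝ => y ^ (4 : ℝ) * Real.exp (-(1 / 2) * y ^ (2 : ℝ))) |x| := by
    have habs : |x| ^ (4 : ℝ) = x ^ 4 := by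
      rw [show (4 : ℝ) = ((4 : ℕ) : ℝ) by norm_num, Real.rpow_natCast]
      exact (even_two_mul 2).pow_abs x
    simp only [gaussianPDFReal, smul_eq_mul, NNReal.coe_one, mul_one, sub_zero, habs,
      Real.rpow_two, sq_abs]
    rw [show -x ^ 2 / 2 = -(1 / 2) * x ^ 2 by ring]
    ring
  have hGamma : Real.Gamma ((4 + 1) / 2) = 3 / 4 * √Real.pi := by
    rw [show ((4 : ℝ) + 1) / 2 = 1 / 2 + 1 + 1 by norm_num, Real.Gamma_add_one (by norm_num),
      Real.Gamma_add_one (by norm_num), Real.Gamma_one_half_eq]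
    ring
  have hscale : ((1 : ℝ) / 2) ^ (-((4 : ℝ) + 1) / 2) = 4 * √2 := by
    rw [show -((4 : ℝ) + 1) / 2 = -(2 + 1 / 2) by norm_num, one_div, Real.inv_rpow (by norm_num),
      ← Real.rpow_neg (by norm_num), neg_neg, Real.rpow_add (by norm_num), Real.sqrt_eq_rpow]
    norm_num
  rw [integral_gaussianReal_eq_integral_smul (by norm_num)]
  simp only [hpdf]
  rw [integral_const_mul,
    integral_comp_abs (f := fun y : ℝ => y ^ (4 : ℝ) * Real.exp (-(1 / 2) * y ^ (2 : ℝ))),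
    integral_rpow_mul_exp_neg_mul_rpow (by norm_num) (by norm_num) (by norm_num), hGamma, hscale,
    Real.sqrt_mul (by norm_num)]
  have := Real.pi_pos
  field_simp

lemma memLp_sq_sub_one_gaussianReal : MemLp (fun z : ℝ => z ^ 2 - 1) 2 (gaussianReal 0 1) := by
  refine MemLp.sub ?_ (memLp_const 1)
  rw [memLp_two_iff_integrable_sq (by fun_prop)]
  simpa only [← pow_mul] using integrable_pow_gaussianReal 0 1 4

lemma integral_sq_sub_one_gaussianReal : ∫ z, (z ^ 2 - 1) ∂(gaussianReal 0 1) = 0 := by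
  rw [integral_sub (integrable_pow_gaussianReal 0 1 2) (integrable_const 1),
    integral_sq_gaussianReal]
  simp

lemma integral_sq_sub_one_sq_gaussianReal :
    ∫ z, (z ^ 2 - 1) ^ 2 ∂(gaussianReal 0 1) = 2 := by
  have hexpand (z : ℝ) : (z ^ 2 - 1) ^ 2 = z ^ 4 - 2 * z ^ 2 + 1 := by ring
  have h4 := integrable_pow_gaussianReal 0 1 4
  have h2 := (integrable_pow_gaussianReal 0 1 2).const_mul 2
  simp only [hexpand]
  have h42 : Integrable (fun z : ℝ => z ^ 4 - 2 * z ^ 2) (gaussianReal 0 1) := h4.sub h2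
  rw [integral_add h42 (integrable_const 1), integral_sub h4 h2, integral_const_mul,
    integral_sq_gaussianReal, integral_pow_four_gaussianReal]
  norm_num

lemma gaussianPDFReal_le_half (x : ℝ) : gaussianPDFReal 0 1 x ≤ 1 / 2 := by
  simp only [gaussianPDFReal, NNReal.coe_one, mul_one, sub_zero]
  have hexp : Real.exp (-x ^ 2 / 2) ≤ 1 := Real.exp_le_one_iff.2 (by nlinarith [sq_nonneg x])
  have hsqrt : (√(2 * Real.pi))⁻¹ ≤ 1 / 2 := by
    rw [one_div]
    refine inv_anti₀ (by norm_num) (Real.le_sqrt_of_sq_le ?_)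
    nlinarith [Real.pi_gt_three]
  calc (√(2 * Real.pi))⁻¹ * Real.exp (-x ^ 2 / 2) ≤ 1 / 2 * 1 := by gcongr
    _ = 1 / 2 := mul_one _

lemma gaussianReal_real_Icc_le {s : ℝ} (hs : 0 ≤ s) :
    (gaussianReal 0 1).real (Set.Icc (-s) s) ≤ s := by
  rw [Measure.real, gaussianReal_apply_eq_integral 0 (by norm_num),
    ENNReal.toReal_ofReal (integral_nonneg fun _ => gaussianPDFReal_nonneg _ _ _)]
  calc ∫ x in Set.Icc (-s) s, gaussianPDFReal 0 1 x ≤ ∫ x in Set.Icc (-s) s, (1 / 2 : ℝ) :=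
        setIntegral_mono (integrable_gaussianPDFReal 0 1).integrableOn (by simp)
          gaussianPDFReal_le_half
    _ = s := by
        rw [setIntegral_const, Real.volume_real_Icc_of_le (by linarith), smul_eq_mul]
        ring

end GaussianReal

section GaussianVector
variable {ι : Type*} [Fintype ι]

/-- The law of a vector of independent standard Gaussians. -/
noncomputable def gaussVec (ι : Type*) [Fintype ι] : Measure (ι → ℝ) :=
  Measure.pi fun _ => gaussianReal 0 1

instance (ι : Type*) [Fintype ι] : IsProbabilityMeasure (gaussVec ι) := by
  unfold gaussVec; infer_instance

@[fun_prop]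
lemma measurable_dotProduct {X : Type*} [MeasurableSpace X] {x y : X → ι → ℝ}
    (hx : Measurable x) (hy : Measurable y) : Measurable fun ω => x ω ⬝ᵥ y ω := by
  unfold dotProduct; fun_prop

lemma gaussVec_map_dotProduct (u : ι → ℝ) :
    (gaussVec ι).map (fun x => u ⬝ᵥ x) = gaussianReal 0 (u ⬝ᵥ u).toNNReal := by
  set L : StrongDual ℝ (EuclideanSpace ℝ ι) := innerSL ℝ (WithLp.toLp 2 u) with hL
  have hnorm : ‖L‖ ^ 2 = u ⬝ᵥ u := by
    rw [hL, innerSL_apply_norm, EuclideanSpace.real_norm_sq_eq]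
    simp only [dotProduct, sq]
  have hmap := IsGaussian.map_eq_gaussianReal (μ := stdGaussian (EuclideanSpace ℝ ι)) L
  rw [integral_strongDual_stdGaussian, variance_dual_stdGaussian, ← map_pi_eq_stdGaussian,
    Measure.map_map (by fun_prop) (by fun_prop), hnorm] at hmap
  rw [← hmap, gaussVec]
  congr 1
  ext x
  simp [hL, PiLp.inner_apply, dotProduct, mul_comm]

lemma gaussVec_map_dotProduct_eq_map_mul (u : ι → ℝ) :
    (gaussVec ι).map (fun x => u ⬝ᵥ x) = (gaussianReal 0 1).map (fun z => √(u ⬝ᵥ u) * z) := by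
  rw [gaussVec_map_dotProduct, gaussianReal_map_const_mul, mul_zero]
  congr 1
  ext
  have h := dotProduct_self_nonneg u
  simp [Real.coe_toNNReal _ h, Real.sq_sqrt h]

lemma integrable_dotProduct_pow (u : ι → ℝ) (n : ℕ) :
    Integrable (fun x => (u ⬝ᵥ x) ^ n) (gaussVec ι) := by
  have h : Integrable (fun z : ℝ => z ^ n) ((gaussVec ι).map (fun x => u ⬝ᵥ x)) := by
    rw [gaussVec_map_dotProduct]
    exact integrable_pow_gaussianReal _ _ n
  exact h.comp_measurable (by fun_prop)

lemma integral_dotProduct_pow (u : ι → ℝ) (n : ℕ) :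
    ∫ x, (u ⬝ᵥ x) ^ n ∂(gaussVec ι) = √(u ⬝ᵥ u) ^ n * ∫ z, z ^ n ∂(gaussianReal 0 1) := by
  rw [← integral_map (μ := gaussVec ι) (φ := fun x => u ⬝ᵥ x) (f := fun z => z ^ n)
    (by fun_prop) (by fun_prop),
    gaussVec_map_dotProduct_eq_map_mul, integral_map (by fun_prop) (by fun_prop),
    ← integral_const_mul]
  simp only [mul_pow]

lemma integral_dotProduct_sq (u : ι → ℝ) : ∫ x, (u ⬝ᵥ x) ^ 2 ∂(gaussVec ι) = u ⬝ᵥ u := by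
  rw [integral_dotProduct_pow, integral_sq_gaussianReal, mul_one,
    Real.sq_sqrt (dotProduct_self_nonneg u)]

lemma integral_dotProduct_pow_four (u : ι → ℝ) :
    ∫ x, (u ⬝ᵥ x) ^ 4 ∂(gaussVec ι) = 3 * (u ⬝ᵥ u) ^ 2 := by
  rw [integral_dotProduct_pow, integral_pow_four_gaussianReal, pow_mul _ 2 2,
    Real.sq_sqrt (dotProduct_self_nonneg u), mul_comm]

lemma gaussVec_real_dotProduct_sq_le {u : ι → ℝ} (hu : u ⬝ᵥ u = 1) {s : ℝ} (hs : 0 ≤ s) :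
    (gaussVec ι).real {x | (u ⬝ᵥ x) ^ 2 ≤ s ^ 2} ≤ s := by
  have hIcc : {x : ι → ℝ | (u ⬝ᵥ x) ^ 2 ≤ s ^ 2} = (fun x => u ⬝ᵥ x) ⁻¹' Set.Icc (-s) s := by
    ext x
    rw [Set.mem_ofPred_eq, Set.mem_preimage, Set.mem_Icc, sq_le_sq, abs_of_nonneg hs, abs_le]
  rw [hIcc, ← map_measureReal_apply (by fun_prop) measurableSet_Icc,
    gaussVec_map_dotProduct, hu, Real.toNNReal_one]
  exact gaussianReal_real_Icc_le hs

lemma dotProduct_mul_dotProduct_polarization (u v x : ι → ℝ) :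
    (u ⬝ᵥ x) * (v ⬝ᵥ x) = (((u + v) ⬝ᵥ x) ^ 2 - ((u - v) ⬝ᵥ x) ^ 2) / 4 := by
  simp only [add_dotProduct, sub_dotProduct]; ring

lemma integrable_dotProduct_mul_dotProduct (u v : ι → ℝ) :
    Integrable (fun x => (u ⬝ᵥ x) * (v ⬝ᵥ x)) (gaussVec ι) := by
  simp only [dotProduct_mul_dotProduct_polarization u v]
  exact ((integrable_dotProduct_pow _ 2).sub (integrable_dotProduct_pow _ 2)).div_const _

lemma integral_dotProduct_mul_dotProduct (u v : ι → ℝ) :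
    ∫ x, (u ⬝ᵥ x) * (v ⬝ᵥ x) ∂(gaussVec ι) = u ⬝ᵥ v := by
  simp only [dotProduct_mul_dotProduct_polarization u v]
  rw [integral_div, integral_sub (integrable_dotProduct_pow _ 2) (integrable_dotProduct_pow _ 2),
    integral_dotProduct_sq, integral_dotProduct_sq]
  simp only [add_dotProduct, sub_dotProduct, dotProduct_add, dotProduct_sub, dotProduct_comm v u]
  ring

lemma integrable_dotProduct_sq_mul_dotProduct_sq (u v : ι → ℝ) :
    Integrable (fun x => (u ⬝ᵥ x) ^ 2 * (v ⬝ᵥ x) ^ 2) (gaussVec ι) := by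
  refine (((integrable_dotProduct_pow u 4).add (integrable_dotProduct_pow v 4)).div_const 2).mono'
    (Measurable.aestronglyMeasurable (by fun_prop))
    (Filter.Eventually.of_forall fun x => ?_)
  rw [Real.norm_of_nonneg (by positivity), Pi.add_apply]
  nlinarith [sq_nonneg ((u ⬝ᵥ x) ^ 2 - (v ⬝ᵥ x) ^ 2)]

lemma integral_dotProduct_sq_mul_dotProduct_sq_le (u v : ι → ℝ) :
    ∫ x, (u ⬝ᵥ x) ^ 2 * (v ⬝ᵥ x) ^ 2 ∂(gaussVec ι) ≤ 3 * ((u ⬝ᵥ u) * (v ⬝ᵥ v)) := by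
  rcases (dotProduct_self_nonneg u).eq_or_lt with h0 | ha
  · obtain rfl : u = 0 := dotProduct_self_eq_zero.1 h0.symm
    simp
  rcases (dotProduct_self_nonneg v).eq_or_lt with h0 | hb
  · obtain rfl : v = 0 := dotProduct_self_eq_zero.1 h0.symm
    simp
  set a := u ⬝ᵥ u
  set b := v ⬝ᵥ v
  have ham_gm (x : ι → ℝ) : (u ⬝ᵥ x) ^ 2 * (v ⬝ᵥ x) ^ 2 ≤
      (b / a * (u ⬝ᵥ x) ^ 4 + a / b * (v ⬝ᵥ x) ^ 4) / 2 := by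
    rw [← sub_nonneg]
    calc 0 ≤ (b * (u ⬝ᵥ x) ^ 2 - a * (v ⬝ᵥ x) ^ 2) ^ 2 / (2 * a * b) := by positivity
      _ = _ := by field_simp; ring
  have hiu := (integrable_dotProduct_pow u 4).const_mul (b / a)
  have hiv := (integrable_dotProduct_pow v 4).const_mul (a / b)
  calc ∫ x, (u ⬝ᵥ x) ^ 2 * (v ⬝ᵥ x) ^ 2 ∂(gaussVec ι)
      ≤ ∫ x, (b / a * (u ⬝ᵥ x) ^ 4 + a / b * (v ⬝ᵥ x) ^ 4) / 2 ∂(gaussVec ι) :=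
        integral_mono (integrable_dotProduct_sq_mul_dotProduct_sq u v)
          ((hiu.add hiv).div_const 2) ham_gm
    _ = (b / a * (3 * a ^ 2) + a / b * (3 * b ^ 2)) / 2 := by
        rw [integral_div, integral_add hiu hiv, integral_const_mul, integral_const_mul,
          integral_dotProduct_pow_four, integral_dotProduct_pow_four]
    _ = 3 * (a * b) := by field_simp; ring

lemma memLp_dotProduct_mul_dotProduct_sub (u v : ι → ℝ) :
    MemLp (fun x => (u ⬝ᵥ x) * (v ⬝ᵥ x) - u ⬝ᵥ v) 2 (gaussVec ι) := by
  refine MemLp.sub ?_ (memLp_const _)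
  rw [memLp_two_iff_integrable_sq
    (integrable_dotProduct_mul_dotProduct u v).aestronglyMeasurable]
  simpa only [mul_pow] using integrable_dotProduct_sq_mul_dotProduct_sq u v

lemma integral_dotProduct_mul_dotProduct_sub (u v : ι → ℝ) :
    ∫ x, ((u ⬝ᵥ x) * (v ⬝ᵥ x) - u ⬝ᵥ v) ∂(gaussVec ι) = 0 := by
  rw [integral_sub (integrable_dotProduct_mul_dotProduct u v) (integrable_const _),
    integral_dotProduct_mul_dotProduct]
  simp

lemma integral_sq_dotProduct_mul_dotProduct_sub_le (u v : ι → ℝ) :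
    ∫ x, ((u ⬝ᵥ x) * (v ⬝ᵥ x) - u ⬝ᵥ v) ^ 2 ∂(gaussVec ι) ≤ 3 * ((u ⬝ᵥ u) * (v ⬝ᵥ v)) := by
  have hmean := integral_dotProduct_mul_dotProduct u v
  have hmeas := (integrable_dotProduct_mul_dotProduct u v).aemeasurable
  have hvar : ∫ x, ((u ⬝ᵥ x) * (v ⬝ᵥ x) - u ⬝ᵥ v) ^ 2 ∂(gaussVec ι) =
      Var[fun x => (u ⬝ᵥ x) * (v ⬝ᵥ x); gaussVec ι] := by
    rw [variance_eq_integral hmeas, hmean]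
  rw [hvar]
  refine (variance_le_expectation_sq hmeas.aestronglyMeasurable).trans ?_
  simpa only [Pi.pow_apply, mul_pow] using integral_dotProduct_sq_mul_dotProduct_sq_le u v

end GaussianVector

section Sketch
variable {ι κ : Type*} [Fintype κ]

/-- The bilinear sketch `Gᵀ A G` of `A`, where `G` is given by its rows. -/
def sketch (A : Matrix κ κ ℝ) (G : κ → ι → ℝ) : Matrix ι ι ℝ :=
  (Matrix.of G)ᵀ * A * Matrix.of G

lemma sketch_isSymm {A : Matrix κ κ ℝ} (hA : A.IsSymm) (G : κ → ι → ℝ) : (sketch A G).IsSymm := by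
  rw [Matrix.IsSymm, sketch, Matrix.transpose_mul, Matrix.transpose_mul, Matrix.transpose_transpose,
    hA.eq, Matrix.mul_assoc]

lemma dotProduct_sketch_mulVec [Fintype ι] (A : Matrix κ κ ℝ) (G : κ → ι → ℝ) (u v : ι → ℝ) :
    u ⬝ᵥ (sketch A G *ᵥ v) = (Matrix.of G *ᵥ u) ⬝ᵥ (A *ᵥ (Matrix.of G *ᵥ v)) := by
  rw [sketch, ← Matrix.mulVec_mulVec, ← Matrix.mulVec_mulVec, Matrix.dotProduct_mulVec,
    Matrix.vecMul_transpose]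

/-- The sketch `Gᵀ A G`, minus its mean `tr A • 1` for Gaussian `G`. -/
def centredSketch [DecidableEq ι] (A : Matrix κ κ ℝ) (G : κ → ι → ℝ) : Matrix ι ι ℝ :=
  sketch A G - A.trace • 1

lemma centredSketch_isSymm [DecidableEq ι] {A : Matrix κ κ ℝ} (hA : A.IsSymm) (G : κ → ι → ℝ) :
    (centredSketch A G).IsSymm :=
  (sketch_isSymm hA G).sub (Matrix.isSymm_one.smul _)

end Sketch

section GaussianSketch
variable {ι κ : Type*} [Fintype ι] [Fintype κ]

/-- The law of a matrix of independent standard Gaussians, as the family of its rows. -/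
noncomputable def gaussRows (κ ι : Type*) [Fintype κ] [Fintype ι] : Measure (κ → ι → ℝ) :=
  Measure.pi fun _ => gaussVec ι

instance (κ ι : Type*) [Fintype κ] [Fintype ι] : IsProbabilityMeasure (gaussRows κ ι) := by
  unfold gaussRows; infer_instance

lemma gaussVec_map_curry : (gaussVec (κ × ι)).map Function.curry = gaussRows κ ι := by
  have huncurry : (gaussRows κ ι).map Function.uncurry = gaussVec (κ × ι) := by
    refine (Measure.pi_eq fun s hs => ?_).symm
    have hbox : Function.uncurry ⁻¹' (Set.univ.pi s) =
        Set.univ.pi fun i : κ => Set.univ.pi fun a : ι => s (i, a) := by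
      ext x
      simp only [Set.mem_preimage, Set.mem_univ_pi, Function.uncurry, Prod.forall]
    rw [Measure.map_apply measurable_uncurry (MeasurableSet.univ_pi hs), hbox, gaussRows,
      Measure.pi_pi, Fintype.prod_prod_type]
    simp only [gaussVec, Measure.pi_pi]
  rw [← huncurry, Measure.map_map measurable_curry measurable_uncurry]
  exact Measure.map_id

lemma gaussVec_map_of_dotProduct_self_eq {f : (ι → ℝ) →ₗ[ℝ] (ι → ℝ)}
    (hf : ∀ x, f x ⬝ᵥ f x = x ⬝ᵥ x) : (gaussVec ι).map f = gaussVec ι := by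
  let g : EuclideanSpace ℝ ι →ₗᵢ[ℝ] EuclideanSpace ℝ ι :=
    { toLinearMap := (WithLp.linearEquiv 2 ℝ (ι → ℝ)).symm.toLinearMap ∘ₗ f ∘ₗ
        (WithLp.linearEquiv 2 ℝ (ι → ℝ)).toLinearMap
      norm_map' := fun x => by
        have hnorm (y : EuclideanSpace ℝ ι) : ‖y‖ = √(WithLp.ofLp y ⬝ᵥ WithLp.ofLp y) := by
          simp only [EuclideanSpace.norm_eq, dotProduct, ← sq, Real.norm_eq_abs, sq_abs]
        rw [hnorm, hnorm]
        exact congrArg Real.sqrt (hf (WithLp.ofLp x)) }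
  have hg := stdGaussian_map (g.toLinearIsometryEquiv rfl)
  rw [← map_pi_eq_stdGaussian, Measure.map_map (by fun_prop) (by fun_prop)] at hg
  have hofLp := congrArg (Measure.map (WithLp.ofLp (p := 2) (V := ι → ℝ))) hg
  rw [Measure.map_map (by fun_prop) (by fun_prop),
    Measure.map_map (by fun_prop) (by fun_prop)] at hofLp
  exact hofLp.trans Measure.map_id

variable [DecidableEq κ]

lemma measurePreserving_gaussRows_mul {O : Matrix κ κ ℝ} (hO : Oᵀ * O = 1) :
    MeasurePreserving (fun (G : κ → ι → ℝ) i a => ∑ j, O i j * G j a)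
      (gaussRows κ ι) (gaussRows κ ι) := by
  have hm : Measurable (fun (G : κ → ι → ℝ) (i : κ) (a : ι) => ∑ j, O i j * G j a) := by fun_prop
  refine ⟨hm, ?_⟩
  let f : (κ × ι → ℝ) →ₗ[ℝ] (κ × ι → ℝ) :=
    { toFun := fun x p => ∑ j, O p.1 j * x (j, p.2)
      map_add' := fun x y => by
        ext p; simp only [Pi.add_apply, mul_add, Finset.sum_add_distrib]
      map_smul' := fun c x => by
        ext p; simp only [Pi.smul_apply, smul_eq_mul, mul_left_comm, Finset.mul_sum,
          RingHom.id_apply] }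
  have hf (x : κ × ι → ℝ) : f x ⬝ᵥ f x = x ⬝ᵥ x := by
    have hcolumns (y : κ × ι → ℝ) :
        y ⬝ᵥ y = ∑ a, (fun i => y (i, a)) ⬝ᵥ (fun i => y (i, a)) := by
      simp only [dotProduct]
      rw [Fintype.sum_prod_type, Finset.sum_comm]
    rw [hcolumns, hcolumns]
    refine Finset.sum_congr rfl fun a _ => ?_
    change (O *ᵥ fun i => x (i, a)) ⬝ᵥ (O *ᵥ fun i => x (i, a)) = _
    rw [Matrix.dotProduct_mulVec, ← Matrix.mulVec_transpose, Matrix.mulVec_mulVec, hO,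
      Matrix.one_mulVec]
  have hfm : Measurable f := f.continuous_of_finiteDimensional.measurable
  rw [← gaussVec_map_curry, Measure.map_map hm measurable_curry]
  conv_rhs => rw [← gaussVec_map_of_dotProduct_self_eq hf, Measure.map_map measurable_curry hfm]
  rfl

lemma gaussRows_real_sketch_conj {O : Matrix κ κ ℝ} (hO : Oᵀ * O = 1) (A : Matrix κ κ ℝ)
    (P : Matrix ι ι ℝ → Prop) :
    (gaussRows κ ι).real {G | P (sketch (Oᵀ * A * O) G)} =
      (gaussRows κ ι).real {G | P (sketch A G)} := by
  set f : (κ → ι → ℝ) → κ → ι → ℝ := fun G i a => ∑ j, O i j * G j a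
  have hf : MeasurePreserving f (gaussRows κ ι) (gaussRows κ ι) :=
    measurePreserving_gaussRows_mul hO
  have hinj : Function.Injective f := by
    refine Function.LeftInverse.injective (g := fun G i a => ∑ j, Oᵀ i j * G j a) fun G => ?_
    have hmul : Oᵀ * (O * Matrix.of G) = Matrix.of G := by
      rw [← Matrix.mul_assoc, hO, Matrix.one_mul]
    exact congrArg Matrix.of.symm hmul
  have hsketch (G : κ → ι → ℝ) : sketch (Oᵀ * A * O) G = sketch A (f G) := by
    change _ = (O * Matrix.of G)ᵀ * A * (O * Matrix.of G)
    simp only [sketch, Matrix.transpose_mul, Matrix.mul_assoc]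
  simp only [hsketch, Measure.real]
  congr 1
  exact hf.measure_preimage_emb (hf.measurable.measurableEmbedding hinj) {G | P (sketch A G)}

end GaussianSketch

section CentredSketch
variable {ι κ : Type*} [Fintype ι] [DecidableEq ι] [Fintype κ]

section Diagonal
variable [DecidableEq κ]

lemma dotProduct_centredSketch_diagonal_mulVec (lam : κ → ℝ) (G : κ → ι → ℝ) (u v : ι → ℝ) :
    u ⬝ᵥ (centredSketch (Matrix.diagonal lam) G *ᵥ v) =
      ∑ i, lam i * ((u ⬝ᵥ G i) * (v ⬝ᵥ G i) - u ⬝ᵥ v) := by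
  rw [centredSketch, Matrix.sub_mulVec, dotProduct_sub, dotProduct_sketch_mulVec,
    Matrix.smul_mulVec, Matrix.one_mulVec, dotProduct_smul, Matrix.trace_diagonal, smul_eq_mul]
  simp only [mul_sub, Finset.sum_sub_distrib, ← Finset.sum_mul]
  congr 1
  refine Finset.sum_congr rfl fun i _ => ?_
  rw [Matrix.mulVec_diagonal]
  change (G i ⬝ᵥ u) * (lam i * (G i ⬝ᵥ v)) = _
  rw [dotProduct_comm u, dotProduct_comm v]
  ring

lemma quadratic_centredSketch_diagonal (lam : κ → ℝ) (G : κ → ι → ℝ) (x : ι → ℝ) :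
    x ⬝ᵥ (centredSketch (Matrix.diagonal lam) G *ᵥ x) =
      ∑ i, lam i * ((x ⬝ᵥ G i) ^ 2 - x ⬝ᵥ x) := by
  simp only [dotProduct_centredSketch_diagonal_mulVec, sq]

lemma exists_eq_conj_diagonal_eigenvalues {A : Matrix κ κ ℝ} (hA : A.IsHermitian) :
    ∃ O : Matrix κ κ ℝ, Oᵀ * O = 1 ∧ A = Oᵀ * Matrix.diagonal hA.eigenvalues * O := by
  set U : Matrix κ κ ℝ := (hA.eigenvectorUnitary : Matrix κ κ ℝ) with hU
  have horth : U * Uᵀ = 1 := by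
    have h := (Matrix.mem_unitaryGroup_iff (A := U)).1 hA.eigenvectorUnitary.2
    rwa [Matrix.star_eq_conjTranspose, Matrix.conjTranspose_eq_transpose_of_trivial] at h
  refine ⟨Uᵀ, by rwa [Matrix.transpose_transpose], ?_⟩
  have hspec := hA.spectral_theorem
  rwa [Unitary.conjStarAlgAut_apply, ← hU, Matrix.star_eq_conjTranspose,
    Matrix.conjTranspose_eq_transpose_of_trivial, ← Matrix.transpose_transpose U] at hspec

lemma frobeniusSq_eq_sum_sq_eigenvalues {A : Matrix κ κ ℝ} (hA : A.IsHermitian) :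
    frobeniusSq A = ∑ i, hA.eigenvalues i ^ 2 := by
  obtain ⟨O, hO, hdec⟩ := exists_eq_conj_diagonal_eigenvalues hA
  set D := Matrix.diagonal hA.eigenvalues
  calc frobeniusSq A = (A * A).trace :=
        (trace_mul_self_eq_frobeniusSq (Matrix.isHermitian_iff_isSymm.1 hA)).symm
    _ = (Oᵀ * (D * (O * Oᵀ) * D * O)).trace := by
        rw [hdec]; simp only [Matrix.mul_assoc]
    _ = (D * D).trace := by
        rw [Matrix.trace_mul_comm, mul_eq_one_comm.1 hO, Matrix.mul_one, Matrix.mul_assoc,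
          mul_eq_one_comm.1 hO, Matrix.mul_one]
    _ = ∑ i, hA.eigenvalues i ^ 2 := by
        simp only [D, Matrix.diagonal_mul_diagonal, Matrix.trace_diagonal, sq]

lemma gaussRows_real_centredSketch_eq_diagonal {A : Matrix κ κ ℝ} (hA : A.IsHermitian)
    (P : Matrix ι ι ℝ → Prop) :
    (gaussRows κ ι).real {G | P (centredSketch A G)} =
      (gaussRows κ ι).real {G | P (centredSketch (Matrix.diagonal hA.eigenvalues) G)} := by
  obtain ⟨O, hO, hdec⟩ := exists_eq_conj_diagonal_eigenvalues hA
  have htrace : A.trace = (Matrix.diagonal hA.eigenvalues).trace := by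
    simpa only [Matrix.trace_diagonal, RCLike.ofReal_real_eq_id, id_eq] using
      hA.trace_eq_sum_eigenvalues
  have h := gaussRows_real_sketch_conj hO (Matrix.diagonal hA.eigenvalues)
    fun M : Matrix ι ι ℝ => P (M - A.trace • 1)
  rw [← hdec] at h
  simpa only [centredSketch, ← htrace] using h

lemma centredSketch_diagonal_apply (lam : κ → ℝ) (G : κ → ι → ℝ) (a b : ι) :
    centredSketch (Matrix.diagonal lam) G a b =
      ∑ i, lam i * ((Pi.single a 1 ⬝ᵥ G i) * (Pi.single b 1 ⬝ᵥ G i) -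
        Pi.single a (1 : ℝ) ⬝ᵥ Pi.single b 1) := by
  rw [← dotProduct_centredSketch_diagonal_mulVec, Matrix.mulVec_single_one,
    single_one_dotProduct, Matrix.col_apply]

lemma integrable_sq_centredSketch_diagonal_apply (lam : κ → ℝ) (a b : ι) :
    Integrable (fun G => centredSketch (Matrix.diagonal lam) G a b ^ 2) (gaussRows κ ι) := by
  simp only [centredSketch_diagonal_apply]
  exact (memLp_sum_mul_eval (memLp_dotProduct_mul_dotProduct_sub _ _) lam).integrable_sq

lemma integral_sq_centredSketch_diagonal_apply_le (lam : κ → ℝ) (a b : ι) :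
    ∫ G, centredSketch (Matrix.diagonal lam) G a b ^ 2 ∂(gaussRows κ ι) ≤ 3 * ∑ i, lam i ^ 2 := by
  have hfactor := integral_sq_dotProduct_mul_dotProduct_sub_le
    (Pi.single a (1 : ℝ)) (Pi.single b (1 : ℝ) : ι → ℝ)
  simp only [single_one_dotProduct, Pi.single_eq_same, mul_one] at hfactor
  simp only [centredSketch_diagonal_apply]
  rw [gaussRows, integral_sq_sum_mul_eval (memLp_dotProduct_mul_dotProduct_sub _ _)
    (integral_dotProduct_mul_dotProduct_sub _ _), mul_comm]
  simp only [single_one_dotProduct]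
  gcongr

end Diagonal

lemma gaussRows_real_frobeniusSq_centredSketch_ge_le {A : Matrix κ κ ℝ} (hA : A.IsHermitian)
    {t : ℝ} (ht : 0 < t) :
    (gaussRows κ ι).real {G | t ≤ frobeniusSq (centredSketch A G)} ≤
      3 * (Fintype.card ι : ℝ) ^ 2 * frobeniusSq A / t := by
  classical
  rw [gaussRows_real_centredSketch_eq_diagonal hA fun M => t ≤ frobeniusSq M]
  set lam := hA.eigenvalues
  have hint (a b : ι) := integrable_sq_centredSketch_diagonal_apply lam a b
  refine (measureReal_ge_le_integral_div
    (integrable_finsetSum _ fun a _ => integrable_finsetSum _ fun b _ => hint a b)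
    (fun G => frobeniusSq_nonneg _) ht).trans ?_
  gcongr
  calc ∫ G, frobeniusSq (centredSketch (Matrix.diagonal lam) G) ∂(gaussRows κ ι)
      = ∑ a, ∑ b, ∫ G, centredSketch (Matrix.diagonal lam) G a b ^ 2 ∂(gaussRows κ ι) := by
        simp only [frobeniusSq]
        rw [integral_finsetSum _ fun a _ => integrable_finsetSum _ fun b _ => hint a b]
        exact Finset.sum_congr rfl fun a _ => integral_finsetSum _ fun b _ => hint a b
    _ ≤ ∑ _a : ι, ∑ _b : ι, 3 * ∑ i, lam i ^ 2 := by
        gcongr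
        exact integral_sq_centredSketch_diagonal_apply_le _ _ _
    _ = 3 * (Fintype.card ι : ℝ) ^ 2 * frobeniusSq A := by
        rw [frobeniusSq_eq_sum_sq_eigenvalues hA]
        simp only [Finset.sum_const, Finset.card_univ, nsmul_eq_mul, lam]
        ring

end CentredSketch

lemma exp_neg_le_quadratic {y : ℝ} (hy : 0 ≤ y) : Real.exp (-y) ≤ 1 - y + y ^ 2 / 2 := by
  have hquad := Real.quadratic_le_exp_of_nonneg hy
  have hpos : 0 < 1 + y + y ^ 2 / 2 := by positivity
  rw [Real.exp_neg]
  refine (inv_anti₀ hpos hquad).trans ?_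
  rw [inv_le_iff_one_le_mul₀ hpos]
  nlinarith [sq_nonneg (y ^ 2)]

section LowerTail
variable {ι κ : Type*} [Fintype ι] [Fintype κ]

lemma integral_exp_neg_mul_dotProduct_sq_le (u : ι → ℝ) {c : ℝ} (hc : 0 ≤ c) :
    ∫ x, Real.exp (-(c * (u ⬝ᵥ x) ^ 2)) ∂(gaussVec ι) ≤
      Real.exp (-(c * (u ⬝ᵥ u)) + 3 / 2 * (c * (u ⬝ᵥ u)) ^ 2) := by
  have hint₂ := (integrable_dotProduct_pow u 2).const_mul c
  have hint₄ := (integrable_dotProduct_pow u 4).const_mul (c ^ 2 / 2)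
  have hint : Integrable (fun x => 1 - c * (u ⬝ᵥ x) ^ 2) (gaussVec ι) :=
    (integrable_const _).sub hint₂
  calc ∫ x, Real.exp (-(c * (u ⬝ᵥ x) ^ 2)) ∂(gaussVec ι)
      ≤ ∫ x, (1 - c * (u ⬝ᵥ x) ^ 2 + c ^ 2 / 2 * (u ⬝ᵥ x) ^ 4) ∂(gaussVec ι) := by
        refine integral_mono_of_nonneg (Filter.Eventually.of_forall fun x => (Real.exp_pos _).le)
          (hint.add hint₄) (Filter.Eventually.of_forall fun x => ?_)
        refine (exp_neg_le_quadratic (by positivity)).trans (le_of_eq ?_)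
        ring
    _ = 1 - c * (u ⬝ᵥ u) + c ^ 2 / 2 * (3 * (u ⬝ᵥ u) ^ 2) := by
        rw [integral_add hint hint₄, integral_sub (integrable_const _) hint₂,
          integral_const_mul, integral_const_mul, integral_dotProduct_sq,
          integral_dotProduct_pow_four, integral_const, probReal_univ, one_smul]
    _ ≤ Real.exp (-(c * (u ⬝ᵥ u)) + 3 / 2 * (c * (u ⬝ᵥ u)) ^ 2) := by
        have := Real.add_one_le_exp (-(c * (u ⬝ᵥ u)) + 3 / 2 * (c * (u ⬝ᵥ u)) ^ 2)
        linarith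

lemma integrable_exp_neg_mul_dotProduct_sq (u : ι → ℝ) {c : ℝ} (hc : 0 ≤ c) :
    Integrable (fun x => Real.exp (-(c * (u ⬝ᵥ x) ^ 2))) (gaussVec ι) := by
  refine Integrable.of_bound (C := 1) ?_ (Filter.Eventually.of_forall fun x => ?_)
  · exact Measurable.aestronglyMeasurable (by fun_prop)
  · rw [Real.norm_of_nonneg (Real.exp_pos _).le, Real.exp_le_one_iff, neg_nonpos]
    positivity

section Diagonal
variable [DecidableEq ι] [DecidableEq κ] {lam : κ → ℝ} {s : ℝ}

lemma exp_neg_mul_quadratic_centredSketch_diagonal (lam : κ → ℝ) (s : ℝ) (x : ι → ℝ)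
    (G : κ → ι → ℝ) :
    Real.exp (-(s * (x ⬝ᵥ (centredSketch (Matrix.diagonal lam) G *ᵥ x)))) =
      ∏ i, Real.exp (s * lam i * (x ⬝ᵥ x)) * Real.exp (-(s * lam i * (x ⬝ᵥ G i) ^ 2)) := by
  simp only [quadratic_centredSketch_diagonal, ← Real.exp_add, ← Real.exp_sum]
  rw [Finset.mul_sum, ← Finset.sum_neg_distrib]
  congr 1
  exact Finset.sum_congr rfl fun i _ => by ring

lemma integrable_exp_neg_mul_quadratic_centredSketch_diagonal (hlam : ∀ i, 0 ≤ lam i) (hs : 0 ≤ s)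
    (x : ι → ℝ) :
    Integrable (fun G => Real.exp (-(s * (x ⬝ᵥ (centredSketch (Matrix.diagonal lam) G *ᵥ x)))))
      (gaussRows κ ι) := by
  simp only [exp_neg_mul_quadratic_centredSketch_diagonal]
  exact Integrable.fintype_prod fun i =>
    (integrable_exp_neg_mul_dotProduct_sq x (mul_nonneg hs (hlam i))).const_mul _

lemma integral_exp_neg_mul_quadratic_centredSketch_diagonal_le (hlam : ∀ i, 0 ≤ lam i)
    (hs : 0 ≤ s) (x : ι → ℝ) :
    ∫ G, Real.exp (-(s * (x ⬝ᵥ (centredSketch (Matrix.diagonal lam) G *ᵥ x)))) ∂(gaussRows κ ι) ≤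
      Real.exp (3 / 2 * (s * (x ⬝ᵥ x)) ^ 2 * ∑ i, lam i ^ 2) := by
  simp only [exp_neg_mul_quadratic_centredSketch_diagonal]
  rw [gaussRows, integral_fintype_prod_eq_prod (f := fun i (r : ι → ℝ) =>
    Real.exp (s * lam i * (x ⬝ᵥ x)) * Real.exp (-(s * lam i * (x ⬝ᵥ r) ^ 2)))]
  simp only [integral_const_mul]
  calc ∏ i, Real.exp (s * lam i * (x ⬝ᵥ x)) *
        ∫ r, Real.exp (-(s * lam i * (x ⬝ᵥ r) ^ 2)) ∂(gaussVec ι)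
      ≤ ∏ i, Real.exp (s * lam i * (x ⬝ᵥ x)) *
          Real.exp (-(s * lam i * (x ⬝ᵥ x)) + 3 / 2 * (s * lam i * (x ⬝ᵥ x)) ^ 2) := by
        gcongr with i
        exact integral_exp_neg_mul_dotProduct_sq_le x (mul_nonneg hs (hlam i))
    _ = Real.exp (3 / 2 * (s * (x ⬝ᵥ x)) ^ 2 * ∑ i, lam i ^ 2) := by
        simp only [← Real.exp_add, ← Real.exp_sum]
        rw [Finset.mul_sum]
        congr 1
        exact Finset.sum_congr rfl fun i _ => by ring

end Diagonal

lemma quadratic_centredSketch_eq_zero [DecidableEq ι] {A : Matrix κ κ ℝ} {x : ι → ℝ}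
    (h : frobeniusSq A * (x ⬝ᵥ x) = 0) (G : κ → ι → ℝ) :
    x ⬝ᵥ (centredSketch A G *ᵥ x) = 0 := by
  rcases mul_eq_zero.1 h with hA | hx
  · simp only [eq_zero_of_frobeniusSq_eq_zero hA, centredSketch, sketch, Matrix.mul_zero,
      Matrix.zero_mul, Matrix.trace_zero, zero_smul, sub_zero, Matrix.zero_mulVec,
      dotProduct_zero]
  · rw [dotProduct_self_eq_zero.1 hx, zero_dotProduct]

lemma gaussRows_real_quadratic_centredSketch_lt_le [DecidableEq ι] {A : Matrix κ κ ℝ}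
    (hA : A.PosSemidef) (x : ι → ℝ) {F t : ℝ} (hF0 : 0 ≤ F) (hF : F ^ 2 = frobeniusSq A)
    (ht : 0 ≤ t) :
    (gaussRows κ ι).real {G | x ⬝ᵥ (centredSketch A G *ᵥ x) < -(t * F * (x ⬝ᵥ x))} ≤
      Real.exp (-(t ^ 2 / 6)) := by
  classical
  set X := x ⬝ᵥ x
  have hX0 : 0 ≤ X := dotProduct_self_nonneg x
  rcases (mul_nonneg hF0 hX0).eq_or_lt with hFX | hFX
  · have hzero : frobeniusSq A * X = 0 := by rw [← hF, sq, mul_assoc, ← hFX, mul_zero]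
    simp only [quadratic_centredSketch_eq_zero hzero, mul_assoc, ← hFX, mul_zero, neg_zero,
      lt_irrefl, Set.ofPred_false,
      measureReal_empty, Real.exp_nonneg]
  rw [gaussRows_real_centredSketch_eq_diagonal hA.1 fun M => x ⬝ᵥ (M *ᵥ x) < -(t * F * X)]
  set lam := hA.1.eigenvalues
  set s := t / (3 * (F * X)) with hs
  have hs0 : 0 ≤ s := by positivity
  have hsFX : s * (F * X) = t / 3 := by rw [hs, ← div_div, div_mul_cancel₀ _ hFX.ne']
  have hsub : {G : κ → ι → ℝ |
        x ⬝ᵥ (centredSketch (Matrix.diagonal lam) G *ᵥ x) < -(t * F * X)} ⊆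
      {G | Real.exp (t ^ 2 / 3) ≤
        Real.exp (-(s * (x ⬝ᵥ (centredSketch (Matrix.diagonal lam) G *ᵥ x))))} := by
    intro G hG
    simp only [Set.mem_ofPred_eq, Real.exp_le_exp] at hG ⊢
    nlinarith [mul_le_mul_of_nonneg_left hG.le hs0]
  calc (gaussRows κ ι).real
        {G | x ⬝ᵥ (centredSketch (Matrix.diagonal lam) G *ᵥ x) < -(t * F * X)}
      ≤ Real.exp (3 / 2 * (s * X) ^ 2 * ∑ i, lam i ^ 2) / Real.exp (t ^ 2 / 3) := by
        refine (measureReal_mono hsub).trans ((measureReal_ge_le_integral_div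
          (integrable_exp_neg_mul_quadratic_centredSketch_diagonal hA.eigenvalues_nonneg hs0 x)
          (fun G => (Real.exp_pos _).le) (Real.exp_pos _)).trans ?_)
        gcongr
        exact integral_exp_neg_mul_quadratic_centredSketch_diagonal_le hA.eigenvalues_nonneg hs0 x
    _ = Real.exp (-(t ^ 2 / 6)) := by
        rw [← frobeniusSq_eq_sum_sq_eigenvalues hA.1, ← hF, ← Real.exp_sub]
        congr 1
        linear_combination 3 / 2 * (s * (F * X) + t / 3) * hsFX

end LowerTail

section Grid
variable {ι : Type*} [Fintype ι]

/-- The points of the cubic grid of mesh `1 / k` in `[-1, 1]^k`, where `k` is the dimension; they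
serve as a net for bounding a quadratic form below on the unit sphere. -/
noncomputable def gridPoint (j : ι → Fin (2 * Fintype.card ι + 1)) : ι → ℝ :=
  fun a => ((j a : ℕ) - (Fintype.card ι : ℝ)) / Fintype.card ι

lemma exists_fin_abs_sub_div_le {k : ℕ} (hk : 0 < k) {y : ℝ} (hy : |y| ≤ 1) :
    ∃ j : Fin (2 * k + 1), |y - ((j : ℕ) - (k : ℝ)) / k| ≤ 1 / k := by
  have hk' : (0 : ℝ) < k := by exact_mod_cast hk
  obtain ⟨hy₁, hy₂⟩ := abs_le.1 hy
  have hlow : -(k : ℤ) ≤ ⌊k * y⌋ := by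
    rw [Int.le_floor]
    push_cast
    nlinarith
  have hhigh : ⌊k * y⌋ ≤ k := by
    have h : (⌊k * y⌋ : ℝ) ≤ k := (Int.floor_le _).trans (by nlinarith)
    exact_mod_cast h
  refine ⟨⟨(⌊k * y⌋ + k).toNat, by omega⟩, ?_⟩
  have hcast : (((⌊k * y⌋ + k).toNat : ℕ) : ℝ) = ⌊k * y⌋ + k := by
    rw [← Int.cast_natCast, Int.toNat_of_nonneg (by omega)]
    push_cast
    rfl
  rw [hcast, add_sub_cancel_right, sub_div' hk'.ne', abs_div, abs_of_pos hk']
  gcongr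
  have h₁ := Int.floor_le (k * y)
  have h₂ := Int.lt_floor_add_one (k * y)
  rw [abs_le]
  constructor <;> linarith

lemma exists_gridPoint_near (hk : 0 < Fintype.card ι) {x : ι → ℝ} (hx : x ⬝ᵥ x = 1) :
    ∃ j : ι → Fin (2 * Fintype.card ι + 1),
      (x - gridPoint j) ⬝ᵥ (x - gridPoint j) ≤ 1 / Fintype.card ι := by
  have habs (a : ι) : |x a| ≤ 1 := by
    rw [← sq_le_one_iff_abs_le_one, ← hx, sq]
    exact Finset.single_le_sum (f := fun b => x b * x b) (fun b _ => mul_self_nonneg _)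
      (Finset.mem_univ a)
  choose j hj using fun a => exists_fin_abs_sub_div_le hk (habs a)
  refine ⟨j, ?_⟩
  calc (x - gridPoint j) ⬝ᵥ (x - gridPoint j)
      ≤ ∑ _a : ι, (1 / (Fintype.card ι : ℝ)) ^ 2 := by
        refine Finset.sum_le_sum fun a _ => ?_
        rw [← sq, ← sq_abs]
        exact pow_le_pow_left₀ (abs_nonneg _) (hj a) 2
    _ = 1 / Fintype.card ι := by
        rw [Finset.sum_const, Finset.card_univ, nsmul_eq_mul]
        field_simp

lemma quadratic_sub_quadratic_of_isSymm {M : Matrix ι ι ℝ} (hM : M.IsSymm) (x y : ι → ℝ) :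
    x ⬝ᵥ (M *ᵥ x) - y ⬝ᵥ (M *ᵥ y) = (x - y) ⬝ᵥ (M *ᵥ (x + y)) := by
  have hswap : x ⬝ᵥ (M *ᵥ y) = y ⬝ᵥ (M *ᵥ x) := by
    rw [dotProduct_mulVec_of_isSymm hM, dotProduct_comm]
  simp only [Matrix.mulVec_add, dotProduct_add, sub_dotProduct, hswap]
  ring

lemma dotProduct_self_le_of_near_unit {x p : ι → ℝ} (hx : x ⬝ᵥ x = 1)
    (hp : (x - p) ⬝ᵥ (x - p) ≤ 1) : p ⬝ᵥ p ≤ 4 ∧ (x + p) ⬝ᵥ (x + p) ≤ 9 := by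
  have hcs := dotProduct_sq_le x p
  simp only [dotProduct_sub, sub_dotProduct, dotProduct_add, add_dotProduct, hx,
    dotProduct_comm p x, one_mul] at hp hcs ⊢
  constructor <;> nlinarith [sq_nonneg (x ⬝ᵥ p - 2)]

variable {M : Matrix ι ι ℝ} {R b : ℝ}

lemma quadratic_ge_of_gridPoint_of_unit (hk : 0 < Fintype.card ι) (hM : M.IsSymm) (hR0 : 0 ≤ R)
    (hR : frobeniusSq M ≤ R ^ 2) (hb : 0 ≤ b)
    (hgrid : ∀ j, -(b * (gridPoint j ⬝ᵥ gridPoint j)) ≤ gridPoint j ⬝ᵥ (M *ᵥ gridPoint j))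
    {x : ι → ℝ} (hx : x ⬝ᵥ x = 1) :
    -(4 * b + 3 * R / √(Fintype.card ι)) ≤ x ⬝ᵥ (M *ᵥ x) := by
  have hk' : (1 : ℝ) ≤ Fintype.card ι := by exact_mod_cast hk
  obtain ⟨j, hj⟩ := exists_gridPoint_near hk hx
  obtain ⟨hp, hxp⟩ := dotProduct_self_le_of_near_unit hx
    (hj.trans ((div_le_one (by linarith)).2 hk'))
  have hdiff : |(x - gridPoint j) ⬝ᵥ (M *ᵥ (x + gridPoint j))| ≤ 3 * R / √(Fintype.card ι) := by
    refine abs_le_of_sq_le_sq ?_ (by positivity)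
    calc ((x - gridPoint j) ⬝ᵥ (M *ᵥ (x + gridPoint j))) ^ 2
        ≤ frobeniusSq M * ((x - gridPoint j) ⬝ᵥ (x - gridPoint j)) *
            ((x + gridPoint j) ⬝ᵥ (x + gridPoint j)) := bilinear_sq_le M _ _
      _ ≤ R ^ 2 * (1 / Fintype.card ι) * 9 := by
          gcongr
          · exact dotProduct_self_nonneg _
          · exact dotProduct_self_nonneg _
      _ = (3 * R / √(Fintype.card ι)) ^ 2 := by
          rw [div_pow, Real.sq_sqrt (by linarith)]
          ring
  have hform := quadratic_sub_quadratic_of_isSymm hM x (gridPoint j)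
  nlinarith [hgrid j, neg_le_of_abs_le hdiff]

lemma quadratic_ge_of_gridPoint (hk : 0 < Fintype.card ι) (hM : M.IsSymm) (hR0 : 0 ≤ R)
    (hR : frobeniusSq M ≤ R ^ 2) (hb : 0 ≤ b)
    (hgrid : ∀ j, -(b * (gridPoint j ⬝ᵥ gridPoint j)) ≤ gridPoint j ⬝ᵥ (M *ᵥ gridPoint j))
    (x : ι → ℝ) :
    -((4 * b + 3 * R / √(Fintype.card ι)) * (x ⬝ᵥ x)) ≤ x ⬝ᵥ (M *ᵥ x) := by
  rcases (dotProduct_self_nonneg x).eq_or_lt with h0 | hx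
  · rw [dotProduct_self_eq_zero.1 h0.symm]
    simp only [zero_dotProduct, mul_zero, neg_zero, le_refl]
  have hinv : (√(x ⬝ᵥ x))⁻¹ * (√(x ⬝ᵥ x))⁻¹ = (x ⬝ᵥ x)⁻¹ := by
    rw [← mul_inv, Real.mul_self_sqrt hx.le]
  have hunit := quadratic_ge_of_gridPoint_of_unit hk hM hR0 hR hb hgrid
    (x := (√(x ⬝ᵥ x))⁻¹ • x) (by
      simp only [smul_dotProduct, dotProduct_smul, smul_eq_mul]
      rw [← mul_assoc, hinv, inv_mul_cancel₀ hx.ne'])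
  simp only [Matrix.mulVec_smul, smul_dotProduct, dotProduct_smul, smul_eq_mul] at hunit
  rw [← mul_assoc, hinv, inv_mul_eq_div, le_div_iff₀ hx] at hunit
  linarith

lemma gaussRows_real_not_quadratic_centredSketch_ge_le {κ : Type*} [Fintype κ] [DecidableEq ι]
    (hk : 0 < Fintype.card ι) {A : Matrix κ κ ℝ} (hA : A.PosSemidef) {t : ℝ} (ht : 0 ≤ t)
    (hR : 0 ≤ R) :
    (gaussRows κ ι).real {G | frobeniusSq (centredSketch A G) ≤ R ^ 2 ∧
      ¬ ∀ x, -((4 * (t * √(frobeniusSq A)) + 3 * R / √(Fintype.card ι)) * (x ⬝ᵥ x)) ≤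
        x ⬝ᵥ (centredSketch A G *ᵥ x)} ≤
      (2 * Fintype.card ι + 1 : ℝ) ^ (Fintype.card ι) * Real.exp (-(t ^ 2 / 6)) := by
  have hsub : {G : κ → ι → ℝ | frobeniusSq (centredSketch A G) ≤ R ^ 2 ∧
      ¬ ∀ x, -((4 * (t * √(frobeniusSq A)) + 3 * R / √(Fintype.card ι)) * (x ⬝ᵥ x)) ≤
        x ⬝ᵥ (centredSketch A G *ᵥ x)} ⊆
      ⋃ j, {G | gridPoint j ⬝ᵥ (centredSketch A G *ᵥ gridPoint j) <
        -(t * √(frobeniusSq A) * (gridPoint j ⬝ᵥ gridPoint j))} := by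
    rintro G ⟨hfrob, hneg⟩
    by_contra hG
    simp only [Set.mem_iUnion, Set.mem_ofPred_eq, not_exists, not_lt] at hG
    exact hneg (quadratic_ge_of_gridPoint hk
      (centredSketch_isSymm (Matrix.isHermitian_iff_isSymm.1 hA.1) G) hR hfrob (by positivity) hG)
  refine (measureReal_mono hsub).trans ((measureReal_iUnion_fintype_le _).trans ?_)
  refine (Finset.sum_le_sum fun j _ => gaussRows_real_quadratic_centredSketch_lt_le hA
    (gridPoint j) (Real.sqrt_nonneg _) (Real.sq_sqrt (frobeniusSq_nonneg A)) ht).trans (le_of_eq ?_)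
  rw [Finset.sum_const, Finset.card_univ, Fintype.card_fun, Fintype.card_fin, nsmul_eq_mul]
  push_cast
  rfl

end Grid

section NegativeDirection
variable {ι κ : Type*} [Fintype ι]

lemma gaussVec_real_dotProduct_self_le_half (hk : 0 < Fintype.card ι) :
    (gaussVec ι).real {x | x ⬝ᵥ x ≤ Fintype.card ι / 2} ≤ 8 / Fintype.card ι := by
  have htail := measureReal_abs_sum_mul_eval_ge_le (κ := ι) memLp_sq_sub_one_gaussianReal
    integral_sq_sub_one_gaussianReal (fun _ => 1) integral_sq_sub_one_sq_gaussianReal.le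
    (t := Fintype.card ι / 2) (by positivity)
  refine (measureReal_mono fun x hx => ?_).trans (htail.trans (le_of_eq ?_))
  · have hsum : ∑ i, 1 * (x i ^ 2 - 1) = x ⬝ᵥ x - Fintype.card ι := by
      simp only [dotProduct, one_mul, Finset.sum_sub_distrib, sq, Finset.sum_const,
        Finset.card_univ, nsmul_eq_mul, mul_one]
    rw [Set.mem_ofPred_eq] at hx ⊢
    rw [hsum, le_abs]
    right
    linarith
  · simp only [one_pow, Finset.sum_const, Finset.card_univ, nsmul_eq_mul, mul_one]
    field_simp
    norm_num

variable [Fintype κ]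

lemma quadratic_centredSketch_diagonal_row_le [DecidableEq ι] [DecidableEq κ] {lam : κ → ℝ}
    {i₀ : κ} {F ε k : ℝ} (hF : 0 ≤ F) (hε : 0 < ε) (hε1 : ε ≤ 1) (hi : lam i₀ ≤ -ε * F)
    (hk : 100 ≤ ε * k) {G : κ → ι → ℝ} (hnorm : k / 2 < G i₀ ⬝ᵥ G i₀)
    (hcross : |∑ i, Function.update lam i₀ 0 i * ((G i₀ ⬝ᵥ G i) ^ 2 - G i₀ ⬝ᵥ G i₀)| <
      20 * F * (G i₀ ⬝ᵥ G i₀)) :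
    G i₀ ⬝ᵥ (centredSketch (Matrix.diagonal lam) G *ᵥ G i₀) ≤
      -(ε * k / 4 * F * (G i₀ ⬝ᵥ G i₀)) := by
  rw [quadratic_centredSketch_diagonal]
  set X := G i₀ ⬝ᵥ G i₀
  have hX : 1 ≤ X := by nlinarith
  have hsplit : ∑ i, lam i * ((G i₀ ⬝ᵥ G i) ^ 2 - X) = lam i₀ * (X ^ 2 - X) +
      ∑ i, Function.update lam i₀ 0 i * ((G i₀ ⬝ᵥ G i) ^ 2 - X) := by
    rw [← Finset.add_sum_erase _ _ (Finset.mem_univ i₀), ← Finset.add_sum_erase Finset.univ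
      (fun i => Function.update lam i₀ 0 i * _) (Finset.mem_univ i₀), Function.update_self,
      zero_mul, zero_add]
    congr 1
    refine Finset.sum_congr rfl fun j hj => ?_
    rw [Function.update_of_ne (Finset.ne_of_mem_erase hj)]
  have hself : lam i₀ * (X ^ 2 - X) ≤ -ε * F * (X ^ 2 - X) :=
    mul_le_mul_of_nonneg_right hi (by nlinarith)
  have hcross' := (le_abs_self _).trans hcross.le
  have hlarge : (20 + ε) * (F * X) ≤ ε * (k / 4) * (F * X) :=
    mul_le_mul_of_nonneg_right (by linarith) (by positivity)
  have hquad : ε * F * X * (k / 2) ≤ ε * F * X * X :=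
    mul_le_mul_of_nonneg_left hnorm.le (by positivity)
  rw [hsplit]
  linarith

lemma measurableSet_small_or_cross_large (c : κ → ℝ) (F t : ℝ) :
    MeasurableSet {p : (ι → ℝ) × (κ → ι → ℝ) | p.1 ⬝ᵥ p.1 ≤ t ∨
      20 * F * (p.1 ⬝ᵥ p.1) ≤ |∑ i, c i * ((p.1 ⬝ᵥ p.2 i) ^ 2 - p.1 ⬝ᵥ p.1)|} := by
  have hmeas₁ : Measurable fun p : (ι → ℝ) × (κ → ι → ℝ) => p.1 ⬝ᵥ p.1 := by
    unfold dotProduct; fun_prop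
  have hmeas₂ : Measurable fun p : (ι → ℝ) × (κ → ι → ℝ) =>
      |∑ i, c i * ((p.1 ⬝ᵥ p.2 i) ^ 2 - p.1 ⬝ᵥ p.1)| := by
    unfold dotProduct; fun_prop
  exact (measurableSet_le hmeas₁ measurable_const).union
    (measurableSet_le (hmeas₁.const_mul _) hmeas₂)

lemma gaussVec_prod_gaussRows_real_small_or_cross_large_le (hk : 0 < Fintype.card ι) {c : κ → ℝ}
    {F : ℝ} (hF : 0 < F) (hc : ∑ i, c i ^ 2 ≤ F ^ 2) :
    ((gaussVec ι).prod (gaussRows κ ι)).real {p | p.1 ⬝ᵥ p.1 ≤ (Fintype.card ι : ℝ) / 2 ∨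
      20 * F * (p.1 ⬝ᵥ p.1) ≤ |∑ i, c i * ((p.1 ⬝ᵥ p.2 i) ^ 2 - p.1 ⬝ᵥ p.1)|} ≤
      8 / Fintype.card ι + 3 / 400 := by
  have hk' : (0 : ℝ) < Fintype.card ι := by exact_mod_cast hk
  refine measureReal_prod_le (measurableSet_small_or_cross_large c F _) (by norm_num)
    (gaussVec_real_dotProduct_self_le_half hk) fun x hx => ?_
  have hx' : (Fintype.card ι : ℝ) / 2 < x ⬝ᵥ x := not_le.1 hx
  have hx0 : 0 < x ⬝ᵥ x := by linarith
  have hvar := integral_sq_dotProduct_mul_dotProduct_sub_le x x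
  have hcheb := measureReal_abs_sum_mul_eval_ge_le (κ := κ)
    (memLp_dotProduct_mul_dotProduct_sub x x) (integral_dotProduct_mul_dotProduct_sub x x) c hvar
    (t := 20 * F * (x ⬝ᵥ x)) (by positivity)
  simp only [← sq] at hcheb
  refine (measureReal_mono ?_).trans (hcheb.trans ?_)
  · rintro G (hG | hG)
    · exact absurd hG hx
    · exact hG
  · rw [div_le_iff₀ (by positivity)]
    nlinarith [mul_le_mul_of_nonneg_left hc (by positivity : 0 ≤ 3 * (x ⬝ᵥ x) ^ 2)]

lemma gaussRows_real_row_mem_eq [DecidableEq κ] (i₀ : κ) {S : Set ((ι → ℝ) × (κ → ι → ℝ))}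
    (hS : MeasurableSet S) :
    (gaussRows κ ι).real {G | (G i₀, G) ∈ S} =
      ((gaussVec ι).prod (gaussRows κ ι)).real {p | (p.1, Function.update p.2 i₀ p.1) ∈ S} := by
  have hpre : MeasurableSet {G : κ → ι → ℝ | (G i₀, G) ∈ S} :=
    ((measurable_pi_apply i₀).prodMk measurable_id) hS
  rw [Measure.real, Measure.real, gaussRows,
    ← (measurePreserving_update_pi (ν := gaussVec ι) i₀).measure_preimage hpre.nullMeasurableSet]
  simp only [Set.preimage_ofPred_eq, Function.update_self]

lemma sum_sq_update_zero_le [DecidableEq κ] (lam : κ → ℝ) (i₀ : κ) :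
    ∑ i, Function.update lam i₀ 0 i ^ 2 ≤ ∑ i, lam i ^ 2 := by
  refine Finset.sum_le_sum fun i _ => ?_
  rcases eq_or_ne i i₀ with rfl | hne
  · simpa only [Function.update_self, sq, mul_zero] using mul_self_nonneg (lam i)
  · rw [Function.update_of_ne hne]

lemma gaussRows_real_not_exists_negative_direction_diagonal_le [DecidableEq ι] [DecidableEq κ]
    {lam : κ → ℝ} {i₀ : κ} {F ε : ℝ} (hF0 : 0 < F) (hF : F ^ 2 = ∑ i, lam i ^ 2) (hε : 0 < ε)
    (hε1 : ε ≤ 1) (hi : lam i₀ ≤ -ε * F) (hk : 100 ≤ ε * Fintype.card ι) :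
    (gaussRows κ ι).real {G | ¬ ∃ x : ι → ℝ, 0 < x ⬝ᵥ x ∧
      x ⬝ᵥ (centredSketch (Matrix.diagonal lam) G *ᵥ x) ≤
        -(ε * Fintype.card ι / 4 * F * (x ⬝ᵥ x))} ≤
      8 / Fintype.card ι + 3 / 400 := by
  have hk' : (0 : ℝ) < Fintype.card ι := by
    by_contra h
    nlinarith
  set c : κ → ℝ := Function.update lam i₀ 0
  have hc : ∑ i, c i ^ 2 ≤ F ^ 2 := hF ▸ sum_sq_update_zero_le lam i₀
  refine le_trans ?_ (gaussVec_prod_gaussRows_real_small_or_cross_large_le (ι := ι)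
    (by exact_mod_cast hk') hF0 hc)
  set S : Set ((ι → ℝ) × (κ → ι → ℝ)) := {p | p.1 ⬝ᵥ p.1 ≤ (Fintype.card ι : ℝ) / 2 ∨
    20 * F * (p.1 ⬝ᵥ p.1) ≤ |∑ i, c i * ((p.1 ⬝ᵥ p.2 i) ^ 2 - p.1 ⬝ᵥ p.1)|}
  -- `S` ignores the row `i₀` of the matrix, so the independent vector may be taken to be that row.
  have hinvariant (p : (ι → ℝ) × (κ → ι → ℝ)) :
      (p.1, Function.update p.2 i₀ p.1) ∈ S ↔ p ∈ S := by
    have hsum : ∑ i, c i * ((p.1 ⬝ᵥ Function.update p.2 i₀ p.1 i) ^ 2 - p.1 ⬝ᵥ p.1) =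
        ∑ i, c i * ((p.1 ⬝ᵥ p.2 i) ^ 2 - p.1 ⬝ᵥ p.1) := by
      refine Finset.sum_congr rfl fun j _ => ?_
      rcases eq_or_ne j i₀ with rfl | hne
      · simp only [c, Function.update_self, zero_mul]
      · rw [Function.update_of_ne hne]
    simp only [S, Set.mem_ofPred_eq, hsum]
  have htransfer := gaussRows_real_row_mem_eq (S := S) i₀
    (measurableSet_small_or_cross_large c F _)
  simp only [hinvariant, Set.ofPred_mem_eq] at htransfer
  rw [← htransfer]
  refine measureReal_mono fun G hG => ?_
  by_contra hGS
  obtain ⟨hnorm, hcross⟩ := not_or.1 hGS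
  have hnorm' : (Fintype.card ι : ℝ) / 2 < G i₀ ⬝ᵥ G i₀ := not_le.1 hnorm
  exact hG ⟨G i₀, by linarith, quadratic_centredSketch_diagonal_row_le hF0.le hε hε1 hi hk hnorm'
    (not_le.1 hcross)⟩

lemma gaussRows_real_not_exists_negative_direction_le [DecidableEq ι] [DecidableEq κ]
    {A : Matrix κ κ ℝ} (hA : A.IsHermitian) (hA0 : A ≠ 0) {ε l : ℝ} (hε : 0 < ε) (hε1 : ε ≤ 1)
    (hl : Module.End.HasEigenvalue (Matrix.toLin' A) l) (hfar : l ≤ -ε * √(frobeniusSq A))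
    (hk : 100 ≤ ε * Fintype.card ι) :
    (gaussRows κ ι).real {G | ¬ ∃ x : ι → ℝ, 0 < x ⬝ᵥ x ∧
      x ⬝ᵥ (centredSketch A G *ᵥ x) ≤
        -(ε * Fintype.card ι / 4 * √(frobeniusSq A) * (x ⬝ᵥ x))} ≤
      8 / Fintype.card ι + 3 / 400 := by
  rw [gaussRows_real_centredSketch_eq_diagonal hA fun M => ¬ ∃ x : ι → ℝ, 0 < x ⬝ᵥ x ∧
    x ⬝ᵥ (M *ᵥ x) ≤ -(ε * Fintype.card ι / 4 * √(frobeniusSq A) * (x ⬝ᵥ x))]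
  have hspec := hl.mem_spectrum
  rw [Matrix.spectrum_toLin', hA.spectrum_real_eq_range_eigenvalues] at hspec
  obtain ⟨i₀, hi₀⟩ := hspec
  have hpos : 0 < frobeniusSq A := (frobeniusSq_nonneg A).lt_of_ne fun h =>
    hA0 (eq_zero_of_frobeniusSq_eq_zero h.symm)
  refine gaussRows_real_not_exists_negative_direction_diagonal_le (Real.sqrt_pos.2 hpos) ?_ hε hε1
    (hi₀.trans_le hfar) hk
  rw [Real.sq_sqrt hpos.le, frobeniusSq_eq_sum_sq_eigenvalues hA]

end NegativeDirection

section NormEstimate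
variable {κ κ' : Type*} [Fintype κ] [Fintype κ']

lemma mulVec_dotProduct_self_eq_sum (A : Matrix κ' κ ℝ) (h : κ → ℝ) :
    (A *ᵥ h) ⬝ᵥ (A *ᵥ h) = ∑ i, (A.row i ⬝ᵥ h) ^ 2 := by
  simp only [dotProduct, Matrix.mulVec, Matrix.row_apply, sq]

lemma sum_row_dotProduct_self (A : Matrix κ' κ ℝ) : ∑ i, A.row i ⬝ᵥ A.row i = frobeniusSq A := by
  simp only [frobeniusSq, dotProduct, Matrix.row_apply, sq]

lemma integrable_mulVec_dotProduct_self (A : Matrix κ' κ ℝ) :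
    Integrable (fun h => (A *ᵥ h) ⬝ᵥ (A *ᵥ h)) (gaussVec κ) := by
  simp only [mulVec_dotProduct_self_eq_sum]
  exact integrable_finsetSum _ fun _ _ => integrable_dotProduct_pow _ 2

lemma integral_mulVec_dotProduct_self (A : Matrix κ' κ ℝ) :
    ∫ h, (A *ᵥ h) ⬝ᵥ (A *ᵥ h) ∂(gaussVec κ) = frobeniusSq A := by
  simp only [mulVec_dotProduct_self_eq_sum]
  rw [integral_finsetSum _ fun _ _ => integrable_dotProduct_pow _ 2]
  simp only [integral_dotProduct_sq, sum_row_dotProduct_self]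

lemma integrable_mulVec_dotProduct_self_sq (A : Matrix κ' κ ℝ) :
    Integrable (fun h => ((A *ᵥ h) ⬝ᵥ (A *ᵥ h)) ^ 2) (gaussVec κ) := by
  simp only [mulVec_dotProduct_self_eq_sum, sq (∑ _, _), Finset.sum_mul_sum]
  exact integrable_finsetSum _ fun _ _ => integrable_finsetSum _ fun _ _ =>
    integrable_dotProduct_sq_mul_dotProduct_sq _ _

lemma integral_mulVec_dotProduct_self_sq_le (A : Matrix κ' κ ℝ) :
    ∫ h, ((A *ᵥ h) ⬝ᵥ (A *ᵥ h)) ^ 2 ∂(gaussVec κ) ≤ 3 * frobeniusSq A ^ 2 := by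
  have hint (i j : κ') :=
    integrable_dotProduct_sq_mul_dotProduct_sq (A.row i) (A.row j)
  calc ∫ h, ((A *ᵥ h) ⬝ᵥ (A *ᵥ h)) ^ 2 ∂(gaussVec κ)
      = ∑ i, ∑ j, ∫ h, (A.row i ⬝ᵥ h) ^ 2 * (A.row j ⬝ᵥ h) ^ 2 ∂(gaussVec κ) := by
        simp only [mulVec_dotProduct_self_eq_sum, sq (∑ _, _), Finset.sum_mul_sum]
        rw [integral_finsetSum _ fun i _ => integrable_finsetSum _ fun j _ => hint i j]
        exact Finset.sum_congr rfl fun i _ => integral_finsetSum _ fun j _ => hint i j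
    _ ≤ ∑ i, ∑ j, 3 * ((A.row i ⬝ᵥ A.row i) * (A.row j ⬝ᵥ A.row j)) := by
        gcongr
        exact integral_dotProduct_sq_mul_dotProduct_sq_le _ _
    _ = 3 * frobeniusSq A ^ 2 := by
        rw [sq, ← sum_row_dotProduct_self, Finset.sum_mul_sum]
        simp only [Finset.mul_sum]

lemma measurable_mulVec_dotProduct (A : Matrix κ' κ ℝ) :
    Measurable (fun p : (κ → ℝ) × (κ' → ℝ) => (A *ᵥ p.1) ⬝ᵥ p.2) := by
  unfold dotProduct Matrix.mulVec dotProduct; fun_prop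

lemma integrable_mulVec_dotProduct_pow_four (A : Matrix κ' κ ℝ) :
    Integrable (fun p : (κ → ℝ) × (κ' → ℝ) => ((A *ᵥ p.1) ⬝ᵥ p.2) ^ 4)
      ((gaussVec κ).prod (gaussVec κ')) := by
  rw [integrable_prod_iff ((measurable_mulVec_dotProduct A).pow_const 4).aestronglyMeasurable]
  refine ⟨Filter.Eventually.of_forall fun h => integrable_dotProduct_pow (A *ᵥ h) 4, ?_⟩
  have hnorm (h : κ → ℝ) (g : κ' → ℝ) : ‖((A *ᵥ h) ⬝ᵥ g) ^ 4‖ = ((A *ᵥ h) ⬝ᵥ g) ^ 4 :=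
    Real.norm_of_nonneg (by positivity)
  simp only [hnorm, integral_dotProduct_pow_four]
  exact (integrable_mulVec_dotProduct_self_sq A).const_mul _

lemma memLp_mulVec_dotProduct_sq (A : Matrix κ' κ ℝ) :
    MemLp (fun p : (κ → ℝ) × (κ' → ℝ) => ((A *ᵥ p.1) ⬝ᵥ p.2) ^ 2) 2
      ((gaussVec κ).prod (gaussVec κ')) := by
  rw [memLp_two_iff_integrable_sq
    ((measurable_mulVec_dotProduct A).pow_const 2).aestronglyMeasurable]
  simpa only [← pow_mul] using integrable_mulVec_dotProduct_pow_four A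

lemma integral_mulVec_dotProduct_sq (A : Matrix κ' κ ℝ) :
    ∫ p : (κ → ℝ) × (κ' → ℝ), ((A *ᵥ p.1) ⬝ᵥ p.2) ^ 2 ∂((gaussVec κ).prod (gaussVec κ')) =
      frobeniusSq A := by
  rw [integral_prod _ ((memLp_mulVec_dotProduct_sq A).integrable (by norm_num))]
  simp only [integral_dotProduct_sq]
  exact integral_mulVec_dotProduct_self A

lemma integral_mulVec_dotProduct_pow_four_le (A : Matrix κ' κ ℝ) :
    ∫ p : (κ → ℝ) × (κ' → ℝ), ((A *ᵥ p.1) ⬝ᵥ p.2) ^ 4 ∂((gaussVec κ).prod (gaussVec κ')) ≤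
      9 * frobeniusSq A ^ 2 := by
  rw [integral_prod _ (integrable_mulVec_dotProduct_pow_four A)]
  simp only [integral_dotProduct_pow_four]
  rw [integral_const_mul]
  linarith [integral_mulVec_dotProduct_self_sq_le A]

lemma integral_mulVec_dotProduct_sq_sub (A : Matrix κ' κ ℝ) :
    ∫ p : (κ → ℝ) × (κ' → ℝ), (((A *ᵥ p.1) ⬝ᵥ p.2) ^ 2 - frobeniusSq A)
      ∂((gaussVec κ).prod (gaussVec κ')) = 0 := by
  rw [integral_sub ((memLp_mulVec_dotProduct_sq A).integrable (by norm_num))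
    (integrable_const _), integral_mulVec_dotProduct_sq, integral_const, probReal_univ, one_smul,
    sub_self]

lemma integral_sq_mulVec_dotProduct_sq_sub_le (A : Matrix κ' κ ℝ) :
    ∫ p : (κ → ℝ) × (κ' → ℝ), (((A *ᵥ p.1) ⬝ᵥ p.2) ^ 2 - frobeniusSq A) ^ 2
      ∂((gaussVec κ).prod (gaussVec κ')) ≤ 9 * frobeniusSq A ^ 2 := by
  have hexpand (p : (κ → ℝ) × (κ' → ℝ)) : (((A *ᵥ p.1) ⬝ᵥ p.2) ^ 2 - frobeniusSq A) ^ 2 =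
      ((A *ᵥ p.1) ⬝ᵥ p.2) ^ 4 - 2 * frobeniusSq A * ((A *ᵥ p.1) ⬝ᵥ p.2) ^ 2 +
        frobeniusSq A ^ 2 := by
    ring
  have hint₄ := integrable_mulVec_dotProduct_pow_four A
  have hint₂ := ((memLp_mulVec_dotProduct_sq A).integrable (by norm_num)).const_mul
    (2 * frobeniusSq A)
  have hint : Integrable (fun p : (κ → ℝ) × (κ' → ℝ) => ((A *ᵥ p.1) ⬝ᵥ p.2) ^ 4 -
      2 * frobeniusSq A * ((A *ᵥ p.1) ⬝ᵥ p.2) ^ 2) ((gaussVec κ).prod (gaussVec κ')) :=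
    hint₄.sub hint₂
  simp only [hexpand]
  rw [integral_add hint (integrable_const _), integral_sub hint₄ hint₂,
    integral_const_mul, integral_mulVec_dotProduct_sq, integral_const, probReal_univ, one_smul]
  nlinarith [integral_mulVec_dotProduct_pow_four_le A]

lemma pi_prod_gaussVec_real_abs_average_sub_frobeniusSq_gt_le (A : Matrix κ' κ ℝ) {R : ℕ}
    (hR : 0 < R) :
    (Measure.pi fun _ : Fin R => (gaussVec κ).prod (gaussVec κ')).real
      {H | 3 / 4 * frobeniusSq A <
        |(∑ r, ((A *ᵥ (H r).1) ⬝ᵥ (H r).2) ^ 2) / R - frobeniusSq A|} ≤ 16 / R := by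
  have hR' : (R : ℝ) ≠ 0 := by exact_mod_cast hR.ne'
  rcases (frobeniusSq_nonneg A).eq_or_lt with h0 | hF
  · rw [eq_zero_of_frobeniusSq_eq_zero h0.symm]
    simp only [frobeniusSq, Matrix.zero_apply, Matrix.zero_mulVec, zero_dotProduct, ne_eq,
      OfNat.ofNat_ne_zero, not_false_eq_true, zero_pow, Finset.sum_const_zero, zero_div, sub_zero,
      mul_zero, abs_zero, lt_irrefl, Set.ofPred_false, measureReal_empty]
    positivity
  have hcheb := measureReal_abs_sum_mul_eval_ge_le (κ := Fin R)
    ((memLp_mulVec_dotProduct_sq A).sub (memLp_const _)) (integral_mulVec_dotProduct_sq_sub A)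
    (fun _ => 1 / (R : ℝ)) (integral_sq_mulVec_dotProduct_sq_sub_le A)
    (t := 3 / 4 * frobeniusSq A) (by positivity)
  refine (measureReal_mono fun H hH => ?_).trans (hcheb.trans (le_of_eq ?_))
  · have haverage : ∑ r, 1 / (R : ℝ) * (((A *ᵥ (H r).1) ⬝ᵥ (H r).2) ^ 2 - frobeniusSq A) =
        (∑ r, ((A *ᵥ (H r).1) ⬝ᵥ (H r).2) ^ 2) / R - frobeniusSq A := by
      rw [← Finset.mul_sum, Finset.sum_sub_distrib, Finset.sum_const, Finset.card_univ,
        nsmul_eq_mul, Fintype.card_fin]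
      field_simp
    simp only [Set.mem_ofPred_eq] at hH ⊢
    exact hH.le.trans_eq (congrArg _ haverage.symm)
  · rw [Finset.sum_const, Finset.card_univ, Fintype.card_fin, nsmul_eq_mul]
    field_simp
    norm_num

end NormEstimate

section Schatten
variable {d : ℕ}

lemma sum_sq_singularValues_toEuclideanLin (A : Matrix (Fin d) (Fin d) ℝ) :
    ∑ i : Fin d, (Matrix.toEuclideanLin A).singularValues i ^ 2 = frobeniusSq A := by
  have hrank := finrank_euclideanSpace_fin (𝕜 := ℝ) (n := d)
  have htrace := (Matrix.toEuclideanLin A).isSymmetric_adjoint_comp_self.trace_eq_sum_eigenvalues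
    hrank
  simp only [RCLike.ofReal_real_eq_id, id_eq] at htrace
  have hbasis : (Matrix.toEuclideanLin : Matrix (Fin d) (Fin d) ℝ ≃ₗ[ℝ] _) =
      Matrix.toLin (PiLp.basisFun 2 ℝ (Fin d)) (PiLp.basisFun 2 ℝ (Fin d)) :=
    Matrix.toLpLin_eq_toLin 2 2
  simp only [fun i => (Matrix.toEuclideanLin A).sq_singularValues_fin hrank i]
  rw [← htrace, ← Matrix.toEuclideanLin_conjTranspose_eq_adjoint,
    frobeniusSq_eq_trace_transpose_mul, hbasis, ← Matrix.toLin_mul, Matrix.trace_toLin_eq,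
    Matrix.conjTranspose_eq_transpose_of_trivial]

lemma schattenNorm_two (A : Matrix (Fin d) (Fin d) ℝ) : schattenNorm 2 A = √(frobeniusSq A) := by
  rw [schattenNorm, EuclideanSpace.norm_eq, ← sum_sq_singularValues_toEuclideanLin]
  simp only [Real.norm_eq_abs, sq_abs]

lemma norm_toLp_two_le_norm_toLp_top {ι : Type*} [Fintype ι] (σ : ι → ℝ) :
    ‖WithLp.toLp 2 σ‖ ≤ √(Fintype.card ι) * ‖WithLp.toLp ∞ σ‖ := by
  have hle (i : ι) : ‖σ i‖ ≤ ‖WithLp.toLp ∞ σ‖ := by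
    rw [PiLp.norm_toLp]
    exact norm_le_pi_norm σ i
  rw [EuclideanSpace.norm_eq]
  refine Real.sqrt_le_iff.2 ⟨by positivity, ?_⟩
  rw [mul_pow, Real.sq_sqrt (Nat.cast_nonneg _)]
  calc ∑ i, ‖σ i‖ ^ 2 ≤ ∑ _i : ι, ‖WithLp.toLp ∞ σ‖ ^ 2 := by
        gcongr with i
        exact hle i
    _ = Fintype.card ι * ‖WithLp.toLp ∞ σ‖ ^ 2 := by
        rw [Finset.sum_const, Finset.card_univ, nsmul_eq_mul]

lemma norm_toLp_two_le_norm_toLp_ofReal {ι : Type*} [Fintype ι] {q : ℝ} (hq : 2 ≤ q) (σ : ι → ℝ) :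
    ‖WithLp.toLp 2 σ‖ ≤
      (Fintype.card ι : ℝ) ^ (1 / 2 - q⁻¹) * ‖WithLp.toLp (ENNReal.ofReal q) σ‖ := by
  have hq₀ : q ≠ 0 := by linarith
  have hqr : (ENNReal.ofReal q).toReal = q := ENNReal.toReal_ofReal (by linarith)
  have hpow (i : ι) : (σ i ^ 2) ^ (q / 2) = ‖σ i‖ ^ q := by
    rw [← sq_abs, ← Real.norm_eq_abs, ← Real.rpow_natCast,
      ← Real.rpow_mul (norm_nonneg _)]
    congr 1
    push_cast
    ring
  have hpowerMean : (∑ i, σ i ^ 2) ^ (q / 2) ≤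
      (Fintype.card ι : ℝ) ^ (q / 2 - 1) * ∑ i, ‖σ i‖ ^ q := by
    have hle := Real.rpow_sum_le_const_mul_sum_rpow Finset.univ (fun i => σ i ^ 2)
      (by linarith : 1 ≤ q / 2)
    simp only [abs_sq] at hle
    simpa only [hpow, Finset.card_univ] using hle
  have hsum : 0 ≤ ∑ i, σ i ^ 2 := Finset.sum_nonneg fun i _ => sq_nonneg _
  have hroot := Real.rpow_le_rpow (by positivity) hpowerMean (by positivity : 0 ≤ 1 / q)
  rw [← Real.rpow_mul hsum, Real.mul_rpow (by positivity)
    (Finset.sum_nonneg fun i _ => by positivity), ← Real.rpow_mul (Nat.cast_nonneg _),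
    show q / 2 * (1 / q) = 1 / 2 by field_simp,
    show (q / 2 - 1) * (1 / q) = 1 / 2 - q⁻¹ by field_simp] at hroot
  rw [EuclideanSpace.norm_eq, Real.sqrt_eq_rpow, PiLp.norm_eq_sum (by rw [hqr]; linarith), hqr]
  simpa only [Real.norm_eq_abs, sq_abs] using hroot

lemma schattenNorm_two_le {p : ℝ≥0∞} (hp : 2 ≤ p) (A : Matrix (Fin d) (Fin d) ℝ) :
    schattenNorm 2 A ≤ (d : ℝ) ^ (1 / 2 - (p⁻¹).toReal) * schattenNorm p A := by
  rcases eq_or_ne p ∞ with rfl | hp_top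
  · rw [ENNReal.inv_top, ENNReal.toReal_zero, sub_zero, ← Real.sqrt_eq_rpow]
    have hle := norm_toLp_two_le_norm_toLp_top
      fun i : Fin d => (Matrix.toEuclideanLin A).singularValues i
    rwa [Fintype.card_fin] at hle
  · have hp' : 2 ≤ p.toReal := by
      simpa only [ENNReal.toReal_ofNat] using ENNReal.toReal_mono hp_top hp
    have hle := norm_toLp_two_le_norm_toLp_ofReal hp'
      fun i : Fin d => (Matrix.toEuclideanLin A).singularValues i
    rwa [Fintype.card_fin, ENNReal.ofReal_toReal hp_top, ← ENNReal.toReal_inv] at hle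

end Schatten

section TraceBounds
variable {ι : Type*} [Fintype ι]

lemma trace_sq_le_card_mul_frobeniusSq (M : Matrix ι ι ℝ) :
    M.trace ^ 2 ≤ Fintype.card ι * frobeniusSq M :=
  calc M.trace ^ 2 ≤ Fintype.card ι * ∑ a, M a a ^ 2 :=
        sq_sum_le_card_mul_sum_sq (s := Finset.univ) (f := fun a => M a a)
    _ ≤ Fintype.card ι * frobeniusSq M := by
        unfold frobeniusSq
        gcongr with a
        exact Finset.single_le_sum (f := fun b => M a b ^ 2) (fun b _ => sq_nonneg _)
          (Finset.mem_univ a)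

lemma card_mul_trace_div_card_sq_le (M : Matrix ι ι ℝ) :
    Fintype.card ι * (M.trace / Fintype.card ι) ^ 2 ≤ frobeniusSq M := by
  rcases (Nat.cast_nonneg (α := ℝ) (Fintype.card ι)).eq_or_lt with hk | hk
  · rw [← hk, zero_mul]
    exact frobeniusSq_nonneg M
  · rw [div_pow, mul_div_assoc', div_le_iff₀ (by positivity)]
    nlinarith [trace_sq_le_card_mul_frobeniusSq M]

lemma abs_trace_div_card_le [Nonempty ι] {M : Matrix ι ι ℝ} {b : ℝ} (hb : 0 ≤ b)
    (hM : frobeniusSq M ≤ Fintype.card ι * b ^ 2) : |M.trace / Fintype.card ι| ≤ b :=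
  abs_le_of_sq_le_sq (le_of_mul_le_mul_left ((card_mul_trace_div_card_sq_le M).trans hM)
    (by exact_mod_cast Fintype.card_pos)) hb

lemma frobeniusSq_add_smul_one_le [DecidableEq ι] (M : Matrix ι ι ℝ) (c : ℝ) :
    frobeniusSq (M + c • 1) ≤ 2 * frobeniusSq M + 2 * (Fintype.card ι * c ^ 2) := by
  have hentry (a b : ι) : (M + c • (1 : Matrix ι ι ℝ)) a b ^ 2 ≤
      2 * M a b ^ 2 + 2 * (if a = b then c ^ 2 else 0) := by
    rw [Matrix.add_apply, Matrix.smul_apply, Matrix.one_apply, smul_eq_mul]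
    split_ifs
    · nlinarith [sq_nonneg (M a b - c)]
    · nlinarith [sq_nonneg (M a b)]
  calc frobeniusSq (M + c • 1)
      ≤ ∑ a, ∑ b, (2 * M a b ^ 2 + 2 * (if a = b then c ^ 2 else 0)) :=
        Finset.sum_le_sum fun a _ => Finset.sum_le_sum fun b _ => hentry a b
    _ = 2 * frobeniusSq M + 2 * (Fintype.card ι * c ^ 2) := by
        simp only [Finset.sum_add_distrib, ← Finset.mul_sum, Finset.sum_ite_eq, Finset.mem_univ,
          if_true, frobeniusSq, Finset.sum_const, Finset.card_univ, nsmul_eq_mul]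

end TraceBounds

section ShiftedSketch
variable {ι κ : Type*} [Fintype ι] [DecidableEq ι] [Fintype κ]

/-- The sketch `Gᵀ A G` with a multiple of the identity added so that the mean of its diagonal
entries is `s`. Unlike `centredSketch` it is computed from the sketch alone, without knowledge of
the trace of `A`. -/
noncomputable def shiftedSketch (s : ℝ) (A : Matrix κ κ ℝ) (G : κ → ι → ℝ) : Matrix ι ι ℝ :=
  sketch A G + (s - (sketch A G).trace / Fintype.card ι) • 1

lemma shiftedSketch_isSymm {A : Matrix κ κ ℝ} (hA : A.IsSymm) (s : ℝ) (G : κ → ι → ℝ) :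
    (shiftedSketch s A G).IsSymm :=
  (sketch_isSymm hA G).add (Matrix.isSymm_one.smul _)

variable [Nonempty ι]

lemma shiftedSketch_trace (s : ℝ) (A : Matrix κ κ ℝ) (G : κ → ι → ℝ) :
    (shiftedSketch s A G).trace = Fintype.card ι * s := by
  rw [shiftedSketch, Matrix.trace_add, Matrix.trace_smul, Matrix.trace_one, smul_eq_mul]
  field_simp
  ring

lemma shiftedSketch_eq_centredSketch_add (s : ℝ) (A : Matrix κ κ ℝ) (G : κ → ι → ℝ) :
    shiftedSketch s A G = centredSketch A G +
      (s - (centredSketch A G).trace / Fintype.card ι) • 1 := by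
  have hk : (Fintype.card ι : ℝ) ≠ 0 := by exact_mod_cast Fintype.card_ne_zero
  rw [shiftedSketch, centredSketch, Matrix.trace_sub, Matrix.trace_smul, Matrix.trace_one,
    smul_eq_mul, sub_div, mul_div_assoc, div_self hk, mul_one, sub_add, ← sub_smul,
    sub_eq_add_neg (sketch A G), ← neg_smul]
  congr 2
  ring

lemma dotProduct_shiftedSketch_mulVec (s : ℝ) (A : Matrix κ κ ℝ) (G : κ → ι → ℝ) (x : ι → ℝ) :
    x ⬝ᵥ (shiftedSketch s A G *ᵥ x) = x ⬝ᵥ (centredSketch A G *ᵥ x) +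
      (s - (centredSketch A G).trace / Fintype.card ι) * (x ⬝ᵥ x) := by
  rw [shiftedSketch_eq_centredSketch_add, Matrix.add_mulVec, dotProduct_add, Matrix.smul_mulVec,
    Matrix.one_mulVec, dotProduct_smul, smul_eq_mul]

lemma frobeniusSq_shiftedSketch_le (s : ℝ) (A : Matrix κ κ ℝ) (G : κ → ι → ℝ) :
    frobeniusSq (shiftedSketch s A G) ≤
      6 * frobeniusSq (centredSketch A G) + 4 * Fintype.card ι * s ^ 2 := by
  rw [shiftedSketch_eq_centredSketch_add]
  refine (frobeniusSq_add_smul_one_le _ _).trans ?_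
  nlinarith [card_mul_trace_div_card_sq_le (centredSketch A G),
    mul_nonneg (Nat.cast_nonneg (α := ℝ) (Fintype.card ι))
      (sq_nonneg (s + (centredSketch A G).trace / Fintype.card ι))]

end ShiftedSketch

section MinEigenvector
variable {ι : Type*} [Fintype ι] [DecidableEq ι] {O : Matrix ι ι ℝ}

lemma mul_dotProduct_self_le_quadratic_conj_diagonal (hO : Oᵀ * O = 1) {lam : ι → ℝ} {m : ℝ}
    (hm : ∀ i, m ≤ lam i) (y : ι → ℝ) :
    m * (y ⬝ᵥ y) ≤ y ⬝ᵥ ((Oᵀ * Matrix.diagonal lam * O) *ᵥ y) := by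
  have hnorm : y ⬝ᵥ y = (O *ᵥ y) ⬝ᵥ (O *ᵥ y) := by
    rw [Matrix.dotProduct_mulVec, ← Matrix.mulVec_transpose, Matrix.mulVec_mulVec, hO,
      Matrix.one_mulVec]
  rw [hnorm, ← Matrix.mulVec_mulVec, ← Matrix.mulVec_mulVec, Matrix.dotProduct_mulVec y,
    Matrix.vecMul_transpose]
  simp only [dotProduct, Matrix.mulVec_diagonal, Finset.mul_sum]
  refine Finset.sum_le_sum fun j _ => ?_
  nlinarith [mul_le_mul_of_nonneg_right (hm j) (mul_self_nonneg ((O *ᵥ y) j))]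

lemma conj_diagonal_mulVec_transpose_single (hO : Oᵀ * O = 1) (lam : ι → ℝ) (i : ι) :
    (Oᵀ * Matrix.diagonal lam * O) *ᵥ (Oᵀ *ᵥ Pi.single i 1) = lam i • (Oᵀ *ᵥ Pi.single i 1) := by
  rw [Matrix.mulVec_mulVec, Matrix.mul_assoc, mul_eq_one_comm.1 hO, Matrix.mul_one,
    ← Matrix.mulVec_mulVec, Matrix.diagonal_mulVec_single, mul_one, ← Matrix.mulVec_smul,
    ← Pi.single_smul, smul_eq_mul, mul_one]

lemma transpose_mulVec_single_dotProduct_self (hO : Oᵀ * O = 1) (i : ι) :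
    (Oᵀ *ᵥ Pi.single i 1) ⬝ᵥ (Oᵀ *ᵥ Pi.single i 1) = 1 := by
  rw [Matrix.dotProduct_mulVec, ← Matrix.mulVec_transpose, Matrix.transpose_transpose,
    Matrix.mulVec_mulVec, mul_eq_one_comm.1 hO, Matrix.one_mulVec, single_dotProduct,
    Pi.single_eq_same, mul_one]

omit [DecidableEq ι] in
lemma exists_min_eigenvector {N : Matrix ι ι ℝ} (hN : N.IsSymm) {b : ℝ} {x : ι → ℝ}
    (hx : 0 < x ⬝ᵥ x) (hxN : x ⬝ᵥ (N *ᵥ x) ≤ -b * (x ⬝ᵥ x)) :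
    ∃ (l : ℝ) (u : ι → ℝ), b ≤ l ∧ N *ᵥ u = -l • u ∧ u ⬝ᵥ u = 1 ∧
      ∀ y : ι → ℝ, -l * (y ⬝ᵥ y) ≤ y ⬝ᵥ (N *ᵥ y) := by
  classical
  have : Nonempty ι := by
    by_contra h
    rw [not_nonempty_iff] at h
    simp only [dotProduct, Finset.univ_eq_empty, Finset.sum_empty, lt_irrefl] at hx
  obtain ⟨O, hO, hdec⟩ := exists_eq_conj_diagonal_eigenvalues (Matrix.isHermitian_iff_isSymm.2 hN)
  set lam := (Matrix.isHermitian_iff_isSymm.2 hN).eigenvalues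
  obtain ⟨i, hi⟩ := Finite.exists_min lam
  have hrayleigh := mul_dotProduct_self_le_quadratic_conj_diagonal hO hi
  have heigen := conj_diagonal_mulVec_transpose_single hO lam i
  rw [← hdec] at hrayleigh heigen
  refine ⟨-lam i, Oᵀ *ᵥ Pi.single i 1, ?_, ?_, transpose_mulVec_single_dotProduct_self hO i, ?_⟩
  · linarith [le_of_mul_le_mul_right ((hrayleigh x).trans hxN) hx]
  · rwa [neg_neg]
  · simpa only [neg_neg] using hrayleigh

end MinEigenvector

section Measurability
variable {X ι κ : Type*} [MeasurableSpace X]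

lemma measurable_of_mulVec [Fintype ι] {G : X → κ → ι → ℝ} {x : X → ι → ℝ} (hG : Measurable G)
    (hx : Measurable x) : Measurable fun ω => Matrix.of (G ω) *ᵥ x ω := by
  refine measurable_pi_lambda _ fun i => ?_
  simp only [Matrix.mulVec, Matrix.of_apply]
  fun_prop

lemma measurable_fin_snoc {n : ℕ} {f : X → Fin n → ℝ} {g : X → ℝ} (hf : Measurable f)
    (hg : Measurable g) :
    Measurable fun ω => (Fin.snoc (α := fun _ => ℝ) (f ω) (g ω) : Fin (n + 1) → ℝ) := by
  refine measurable_pi_lambda _ fun i => ?_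
  induction i using Fin.lastCases with
  | last => simpa only [Fin.snoc_last] using hg
  | cast j =>
    simp only [Fin.snoc_castSucc]
    exact (measurable_pi_apply j).comp hf

end Measurability

section QueryComputable
variable {d : ℕ} {Ω α β : Type*}

/-- The answers to the first `k` queries of the strategy `q` on input `A`, with coins `ω`; the
counterpart of `VMVAlgorithm.answers` for a strategy that is not yet part of an algorithm. -/
def queryAnswers (q : (k : ℕ) → Ω → (Fin k → ℝ) → (Fin d → ℝ) × (Fin d → ℝ))
    (A : Matrix (Fin d) (Fin d) ℝ) (ω : Ω) : (k : ℕ) → (Fin k → ℝ)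
  | 0 => Fin.elim0
  | k + 1 => Fin.snoc (α := fun _ => ℝ) (queryAnswers q A ω k)
      ((q k ω (queryAnswers q A ω k)).1 ⬝ᵥ (A *ᵥ (q k ω (queryAnswers q A ω k)).2))

lemma queryAnswers_congr {n : ℕ}
    {q q' : (k : ℕ) → Ω → (Fin k → ℝ) → (Fin d → ℝ) × (Fin d → ℝ)}
    (h : ∀ k < n, q' k = q k) (A : Matrix (Fin d) (Fin d) ℝ) (ω : Ω) :
    queryAnswers q' A ω n = queryAnswers q A ω n := by
  induction n with
  | zero => rfl
  | succ n ih =>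
    rw [queryAnswers, queryAnswers, ih fun k hk => h k (Nat.lt_succ_of_lt hk), h n n.lt_succ_self]

variable [MeasurableSpace Ω] [MeasurableSpace α] [MeasurableSpace β]

lemma measurable_queryAnswers {q : (k : ℕ) → Ω → (Fin k → ℝ) → (Fin d → ℝ) × (Fin d → ℝ)}
    (hq : ∀ k, Measurable fun x : Ω × (Fin k → ℝ) => q k x.1 x.2) (A : Matrix (Fin d) (Fin d) ℝ)
    (k : ℕ) : Measurable fun ω => queryAnswers q A ω k := by
  induction k with
  | zero => exact measurable_const
  | succ k ih =>
    have hquery : Measurable fun ω => q k ω (queryAnswers q A ω k) :=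
      (hq k).comp (measurable_id.prodMk ih)
    have hform : Measurable fun p : (Fin d → ℝ) × (Fin d → ℝ) => p.1 ⬝ᵥ (A *ᵥ p.2) := by
      unfold Matrix.mulVec; fun_prop
    exact measurable_fin_snoc ih (hform.comp hquery)

/-- The function `f` of the input matrix and the coins can be computed by an adaptive randomized
algorithm that makes `n` vector-matrix-vector queries. Values of any measurable type are allowed, so
that an algorithm can be assembled from blocks of queries that carry a state. -/
def QueryComputable (n : ℕ) (f : Matrix (Fin d) (Fin d) ℝ → Ω → α) : Prop :=
  ∃ (q : (k : ℕ) → Ω → (Fin k → ℝ) → (Fin d → ℝ) × (Fin d → ℝ)) (dec : Ω → (Fin n → ℝ) → α),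
    (∀ k, Measurable fun x : Ω × (Fin k → ℝ) => q k x.1 x.2) ∧
    (Measurable fun x : Ω × (Fin n → ℝ) => dec x.1 x.2) ∧
    ∀ A ω, f A ω = dec ω (queryAnswers q A ω n)

namespace QueryComputable
variable {n : ℕ} {f : Matrix (Fin d) (Fin d) ℝ → Ω → α}

lemma of_measurable {g : Ω → α} (hg : Measurable g) :
    QueryComputable (d := d) 0 fun _ ω => g ω :=
  ⟨fun _ _ _ => 0, fun ω _ => g ω, fun _ => measurable_const, hg.comp measurable_fst,
    fun _ _ => rfl⟩

lemma map (hf : QueryComputable n f) {h : Ω × α → β} (hh : Measurable h) :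
    QueryComputable n fun A ω => h (ω, f A ω) := by
  obtain ⟨q, dec, hq, hdec, hfdec⟩ := hf
  exact ⟨q, fun ω a => h (ω, dec ω a), hq, hh.comp (measurable_fst.prodMk hdec),
    fun A ω => by simp only [hfdec]⟩

lemma congr {m : ℕ} {g : Matrix (Fin d) (Fin d) ℝ → Ω → α} (hf : QueryComputable n f)
    (hnm : n = m) (hfg : ∀ A ω, f A ω = g A ω) : QueryComputable m g := by
  subst hnm
  rwa [← funext₂ hfg]

lemma query (hf : QueryComputable n f) {v w : Ω × α → (Fin d → ℝ)} (hv : Measurable v)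
    (hw : Measurable w) :
    QueryComputable (n + 1) fun A ω => (f A ω, v (ω, f A ω) ⬝ᵥ (A *ᵥ w (ω, f A ω))) := by
  obtain ⟨q, dec, hq, hdec, hfdec⟩ := hf
  let q' : (k : ℕ) → Ω → (Fin k → ℝ) → (Fin d → ℝ) × (Fin d → ℝ) := fun k ω a =>
    if h : k = n then
      (v (ω, dec ω fun i => a (i.cast h.symm)), w (ω, dec ω fun i => a (i.cast h.symm)))
    else q k ω a
  have hne (k : ℕ) (hk : k ≠ n) : q' k = q k := by
    funext ω a; exact dif_neg hk
  have hlast (ω : Ω) (a : Fin n → ℝ) : q' n ω a = (v (ω, dec ω a), w (ω, dec ω a)) := dif_pos rfl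
  refine ⟨q', fun ω a => (dec ω (Fin.init a), a (Fin.last n)), fun k => ?_, ?_, fun A ω => ?_⟩
  · by_cases hk : k = n
    · subst hk
      simp only [hlast]
      exact (hv.comp (measurable_fst.prodMk hdec)).prodMk (hw.comp (measurable_fst.prodMk hdec))
    · rw [hne k hk]
      exact hq k
  · refine Measurable.prodMk (hdec.comp (measurable_fst.prodMk ?_)) ?_
    · exact measurable_pi_lambda _ fun i => (measurable_pi_apply _).comp measurable_snd
    · exact (measurable_pi_apply _).comp measurable_snd
  · dsimp only
    rw [queryAnswers, Fin.init_snoc, Fin.snoc_last,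
      queryAnswers_congr fun k hk => hne k hk.ne, hlast, hfdec]

lemma queries (hf : QueryComputable n f) (m : ℕ) {v w : Fin m → Ω × α → (Fin d → ℝ)}
    (hv : ∀ i, Measurable (v i)) (hw : ∀ i, Measurable (w i)) :
    QueryComputable (n + m) fun A ω =>
      (f A ω, fun i => v i (ω, f A ω) ⬝ᵥ (A *ᵥ w i (ω, f A ω))) := by
  induction m with
  | zero =>
    exact (hf.map (h := fun p => (p.2, (Fin.elim0 : Fin 0 → ℝ)))
      (measurable_snd.prodMk measurable_const)).congr rfl fun A ω =>
        Prod.ext rfl (Subsingleton.elim _ _)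
  | succ m ih =>
    have hfst : Measurable fun p : Ω × (α × (Fin m → ℝ)) => (p.1, p.2.1) := by fun_prop
    have hlast := (ih (fun i => hv i.castSucc) fun i => hw i.castSucc).query
      ((hv (Fin.last m)).comp hfst) ((hw (Fin.last m)).comp hfst)
    have hsnoc : Measurable fun p : Ω × ((α × (Fin m → ℝ)) × ℝ) =>
        (p.2.1.1, (Fin.snoc (α := fun _ => ℝ) p.2.1.2 p.2.2 : Fin (m + 1) → ℝ)) :=
      Measurable.prodMk (by fun_prop) (measurable_fin_snoc (by fun_prop) (by fun_prop))
    refine (hlast.map hsnoc).congr rfl fun A ω => Prod.ext rfl (funext fun i => ?_)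
    induction i using Fin.lastCases with
    | last => simp only [Fin.snoc_last, Function.comp_apply]
    | cast j => simp only [Fin.snoc_castSucc]

lemma measurable (hf : QueryComputable n f) (A : Matrix (Fin d) (Fin d) ℝ) : Measurable (f A) := by
  obtain ⟨q, dec, hq, hdec, hfdec⟩ := hf
  rw [show f A = fun ω => dec ω (queryAnswers q A ω n) from funext (hfdec A)]
  exact hdec.comp (measurable_id.prodMk (measurable_queryAnswers hq A n))

lemma exists_algorithm {Ω : Type} [MeasurableSpace Ω] (μ : Measure Ω) [IsProbabilityMeasure μ]
    {f : Matrix (Fin d) (Fin d) ℝ → Ω → Bool} (hf : QueryComputable n f) :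
    ∃ T : VMVAlgorithm d, T.numQueries = n ∧ ∀ A (b : Bool),
      T.μ.real {ω | T.run A ω = b} = μ.real {ω | f A ω = b} := by
  obtain ⟨q, dec, hq, hdec, hfdec⟩ := hf
  let T : VMVAlgorithm d :=
    { Ω := Ω, μ := μ, numQueries := n, query := q, measurable_query := hq, output := dec
      measurable_output := hdec }
  have hanswers (A : Matrix (Fin d) (Fin d) ℝ) (ω : Ω) (k : ℕ) :
      T.answers A ω k = queryAnswers q A ω k := by
    induction k with
    | zero => rfl
    | succ k ih => rw [VMVAlgorithm.answers, queryAnswers, ih]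
  refine ⟨T, rfl, fun A b => ?_⟩
  simp only [VMVAlgorithm.run, hanswers, hfdec]
  rfl

end QueryComputable

end QueryComputable

section SketchQueries
variable {d k : ℕ}

lemma dotProduct_sketch_add_smul_one_mulVec {ι κ : Type*} [Fintype ι] [DecidableEq ι] [Fintype κ]
    (A : Matrix κ κ ℝ) (G : κ → ι → ℝ) (c : ℝ) (x y : ι → ℝ) :
    x ⬝ᵥ ((sketch A G + c • 1) *ᵥ y) =
      (Matrix.of G *ᵥ x) ⬝ᵥ (A *ᵥ (Matrix.of G *ᵥ y)) + c * (x ⬝ᵥ y) := by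
  rw [Matrix.add_mulVec, dotProduct_add, dotProduct_sketch_mulVec, Matrix.smul_mulVec,
    Matrix.one_mulVec, dotProduct_smul, smul_eq_mul]

lemma trace_sketch_eq_sum {ι κ : Type*} [Fintype ι] [Fintype κ]
    (A : Matrix κ κ ℝ) (G : κ → ι → ℝ) :
    (sketch A G).trace = ∑ a, (fun i => G i a) ⬝ᵥ (A *ᵥ fun i => G i a) := by
  classical
  refine Finset.sum_congr rfl fun a _ => ?_
  have hquad := dotProduct_sketch_mulVec A G (Pi.single a 1) (Pi.single a 1)
  simp only [Matrix.mulVec_single_one, single_one_dotProduct] at hquad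
  exact hquad

lemma sketch_add_smul_one_mulVec {ι κ : Type*} [Fintype ι] [DecidableEq ι] [Fintype κ]
    (A : Matrix κ κ ℝ) (G : κ → ι → ℝ) (c : ℝ) (x : ι → ℝ) :
    (sketch A G + c • 1) *ᵥ x =
      (fun j => (fun i => G i j) ⬝ᵥ (A *ᵥ (Matrix.of G *ᵥ x))) + c • x := by
  ext j
  have hrow := dotProduct_sketch_add_smul_one_mulVec A G c (Pi.single j 1) x
  simp only [Matrix.mulVec_single_one, single_one_dotProduct] at hrow
  exact hrow

variable {Ω α : Type*} [MeasurableSpace Ω] [MeasurableSpace α] {n : ℕ}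
  {G : Ω → Fin d → Fin k → ℝ} {c : α → ℝ} {p : Matrix (Fin d) (Fin d) ℝ → Ω → α}
  {x : Matrix (Fin d) (Fin d) ℝ → Ω → Fin k → ℝ}

lemma QueryComputable.gradStep_sketch (hG : Measurable G) (hc : Measurable c) {η : α → ℝ}
    (hη : Measurable η) {s : Ω → Fin k → Bool} (hs : Measurable s)
    (hpx : QueryComputable n fun A ω => (p A ω, x A ω)) :
    QueryComputable (n + 1) fun A ω => (p A ω,
      gradStep (sketch A (G ω) + c (p A ω) • 1) (η (p A ω)) (x A ω) (signVec (s ω))) := by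
  have : Measurable fun ω => signVec (s ω) := (measurable_of_countable signVec).comp hs
  have hquery := hpx.query (v := fun q => Matrix.of (G q.1) *ᵥ signVec (s q.1))
    (w := fun q => Matrix.of (G q.1) *ᵥ q.2.2)
    (measurable_of_mulVec (by fun_prop) (by fun_prop))
    (measurable_of_mulVec (by fun_prop) (by fun_prop))
  have hstep : Measurable fun q : Ω × ((α × (Fin k → ℝ)) × ℝ) =>
      (q.2.1.1, q.2.1.2 - (η q.2.1.1 * (q.2.2 + c q.2.1.1 * (signVec (s q.1) ⬝ᵥ q.2.1.2))) •
        signVec (s q.1)) := by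
    fun_prop
  refine (hquery.map hstep).congr rfl fun A ω => ?_
  rw [gradStep, dotProduct_sketch_add_smul_one_mulVec]

lemma QueryComputable.gradIter_sketch (hG : Measurable G) (hc : Measurable c) {η : α → ℝ}
    (hη : Measurable η) {m : ℕ} {s : Ω → Fin m → Fin k → Bool} (hs : Measurable s)
    (hpx : QueryComputable n fun A ω => (p A ω, x A ω)) :
    QueryComputable (n + m) fun A ω => (p A ω,
      gradIter (sketch A (G ω) + c (p A ω) • 1) (η (p A ω)) m (s ω) (x A ω)) := by
  induction m generalizing n x with
  | zero => exact hpx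
  | succ m ih =>
    have hhead : Measurable fun ω => s ω 0 := by fun_prop
    have htail : Measurable fun ω => Fin.tail (s ω) :=
      measurable_pi_lambda _ fun i => (measurable_pi_apply i.succ).comp hs
    exact (ih htail (hpx.gradStep_sketch hG hc hη hhead)).congr (by omega) fun _ _ => rfl

lemma QueryComputable.sub_smul_sketch_mulVec (hG : Measurable G) (hc : Measurable c) {η : α → ℝ}
    (hη : Measurable η) (hpx : QueryComputable n fun A ω => (p A ω, x A ω)) :
    QueryComputable (n + k) fun A ω => (p A ω,
      x A ω - η (p A ω) • ((sketch A (G ω) + c (p A ω) • 1) *ᵥ x A ω)) := by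
  have hqueries := hpx.queries k (v := fun j q => fun i => G q.1 i j)
    (w := fun _ q => Matrix.of (G q.1) *ᵥ q.2.2) (fun j => by fun_prop)
    (fun _ => measurable_of_mulVec (by fun_prop) (by fun_prop))
  have hstep : Measurable fun q : Ω × ((α × (Fin k → ℝ)) × (Fin k → ℝ)) =>
      (q.2.1.1, q.2.1.2 - η q.2.1.1 • (q.2.2 + c q.2.1.1 • q.2.1.2)) := by
    fun_prop
  refine (hqueries.map hstep).congr rfl fun A ω => ?_
  rw [sketch_add_smul_one_mulVec]

lemma QueryComputable.quadratic_sketch (hG : Measurable G) (hc : Measurable c)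
    (hpx : QueryComputable n fun A ω => (p A ω, x A ω)) :
    QueryComputable (n + 1) fun A ω =>
      x A ω ⬝ᵥ ((sketch A (G ω) + c (p A ω) • 1) *ᵥ x A ω) := by
  have hquery := hpx.query (v := fun q => Matrix.of (G q.1) *ᵥ q.2.2)
    (w := fun q => Matrix.of (G q.1) *ᵥ q.2.2)
    (measurable_of_mulVec (by fun_prop) (by fun_prop))
    (measurable_of_mulVec (by fun_prop) (by fun_prop))
  have hform : Measurable fun q : Ω × ((α × (Fin k → ℝ)) × ℝ) =>
      q.2.2 + c q.2.1.1 * (q.2.1.2 ⬝ᵥ q.2.1.2) := by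
    fun_prop
  refine (hquery.map hform).congr rfl fun A ω => ?_
  rw [dotProduct_sketch_add_smul_one_mulVec]

end SketchQueries

section Tester
variable {d k R T : ℕ}

/-- The random coins of the tester: the Gaussian sketch, the Gaussian pairs for the estimation of
the Frobenius norm, the starting point and the random signs of the stochastic gradient descent. -/
abbrev TesterCoins (d k R T : ℕ) : Type :=
  ((Fin d → Fin k → ℝ) × (Fin R → (Fin d → ℝ) × (Fin d → ℝ))) ×
    ((Fin k → ℝ) × (Fin T → Fin k → Bool))

/-- The estimate `√(R⁻¹ ∑ᵣ (gᵣᵀ A hᵣ)²)` of the Frobenius norm of `A`, multiplied by `b`; it is the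
amount by which the tester shifts the sketch. -/
noncomputable def normShift (b : ℝ) (A : Matrix (Fin d) (Fin d) ℝ)
    (H : Fin R → (Fin d → ℝ) × (Fin d → ℝ)) : ℝ :=
  b * √((∑ r, ((A *ᵥ (H r).1) ⬝ᵥ (H r).2) ^ 2) / R)

/-- The output of the tester: whether the quadratic form of the shifted sketch is nonnegative at the
point reached by descent with step sizes `c / s` and `a / s`, where `s` is the shift. -/
noncomputable def testerOutput (b c a : ℝ) (A : Matrix (Fin d) (Fin d) ℝ)
    (ω : TesterCoins d k R T) : Bool :=
  let s := normShift b A ω.1.2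
  let N := shiftedSketch s A ω.1.1
  let y := descentPoint N (c / s) (a / s) ω.2.1 ω.2.2
  decide (0 ≤ y ⬝ᵥ (N *ᵥ y))

lemma queryComputable_normShift (b : ℝ) : QueryComputable R
    fun A (ω : TesterCoins d k R T) => normShift b A ω.1.2 := by
  have hqueries := (QueryComputable.of_measurable (d := d) (g := fun _ : TesterCoins d k R T => ())
    measurable_const).queries R
      (v := fun r q => (q.1.1.2 r).2) (w := fun r q => (q.1.1.2 r).1)
      (fun r => by fun_prop) (fun r => by fun_prop)
  have hnorm : Measurable fun q : TesterCoins d k R T × (Unit × (Fin R → ℝ)) =>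
      b * √((∑ r, q.2.2 r ^ 2) / R) := by
    fun_prop
  refine (hqueries.map hnorm).congr (zero_add R) fun A ω => ?_
  simp only [normShift, dotProduct_comm (A *ᵥ _)]

lemma queryComputable_normShift_sub_trace (b : ℝ) : QueryComputable (R + k)
    fun A (ω : TesterCoins d k R T) =>
      ((normShift b A ω.1.2, normShift b A ω.1.2 - (sketch A ω.1.1).trace / k), ω.2.1) := by
  have hqueries := (queryComputable_normShift (d := d) (k := k) (R := R) (T := T) b).queries k
    (v := fun j q => fun i => q.1.1.1 i j) (w := fun j q => fun i => q.1.1.1 i j)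
    (fun j => by fun_prop) (fun j => by fun_prop)
  have hstate : Measurable fun q : TesterCoins d k R T × (ℝ × (Fin k → ℝ)) =>
      ((q.2.1, q.2.1 - (∑ j, q.2.2 j) / k), q.1.2.1) := by
    fun_prop
  refine (hqueries.map hstate).congr rfl fun A ω => ?_
  rw [trace_sketch_eq_sum]

lemma queryComputable_testerOutput (b c a : ℝ) : QueryComputable (R + k + T + k + 1)
    (testerOutput (d := d) (k := k) (R := R) (T := T) b c a) := by
  have hG : Measurable fun ω : TesterCoins d k R T => ω.1.1 := by fun_prop
  have hs : Measurable fun ω : TesterCoins d k R T => ω.2.2 := by fun_prop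
  have hdescent := ((queryComputable_normShift_sub_trace b).gradIter_sketch hG measurable_snd
    (measurable_fst.const_div c) hs).sub_smul_sketch_mulVec hG measurable_snd
    (measurable_fst.const_div a)
  have hsign : Measurable fun q : TesterCoins d k R T × ℝ => decide (0 ≤ q.2) := by
    refine measurable_to_bool ?_
    convert measurableSet_le (measurable_const (a := (0 : ℝ))) measurable_snd using 1
    ext q
    simp
  refine ((hdescent.quadratic_sketch hG measurable_snd).map hsign).congr rfl fun A ω => ?_
  simp only [testerOutput, shiftedSketch, descentPoint, Fintype.card_fin]

end Tester

section DescentAnalysis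
variable {ι : Type*} [Fintype ι]

/-- The conditions on the starting point `x` of the descent that a Gaussian vector satisfies with
high probability; `u` is the bottom unit eigenvector of `N`. -/
structure IsGoodStart (N : Matrix ι ι ℝ) (u x : ι → ℝ) : Prop where
  lt_dotProduct_sq : (1 / 300 : ℝ) ^ 2 < (u ⬝ᵥ x) ^ 2
  dotProduct_self_le : x ⬝ᵥ x ≤ 300 * Fintype.card ι
  mulVec_dotProduct_self_le : (N *ᵥ x) ⬝ᵥ (N *ᵥ x) ≤ 300 * frobeniusSq N

lemma gaussVec_real_mul_frobeniusSq_le_mulVec_dotProduct_self_le {κ : Type*} [Fintype κ]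
    {N : Matrix κ ι ℝ} (hN : 0 < frobeniusSq N) {c : ℝ} (hc : 0 < c) :
    (gaussVec ι).real {x | c * frobeniusSq N ≤ (N *ᵥ x) ⬝ᵥ (N *ᵥ x)} ≤ 1 / c := by
  refine (measureReal_ge_le_integral_div (integrable_mulVec_dotProduct_self N)
    (fun _ => dotProduct_self_nonneg _) (mul_pos hc hN)).trans (le_of_eq ?_)
  rw [integral_mulVec_dotProduct_self]
  field_simp

lemma gaussVec_real_not_isGoodStart_le [Nonempty ι] {N : Matrix ι ι ℝ} (hN : 0 < frobeniusSq N)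
    {u : ι → ℝ} (hu : u ⬝ᵥ u = 1) :
    (gaussVec ι).real {x | ¬ IsGoodStart N u x} ≤ 1 / 100 := by
  classical
  have hone : frobeniusSq (1 : Matrix ι ι ℝ) = Fintype.card ι := by
    rw [frobeniusSq_eq_trace_transpose_mul, Matrix.transpose_one, mul_one, Matrix.trace_one]
  have hdot := gaussVec_real_dotProduct_sq_le hu (s := 1 / 300) (by norm_num)
  have hnorm := gaussVec_real_mul_frobeniusSq_le_mulVec_dotProduct_self_le
    (N := (1 : Matrix ι ι ℝ)) (c := 300) (by rw [hone]; exact_mod_cast Fintype.card_pos)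
    (by norm_num)
  have himage := gaussVec_real_mul_frobeniusSq_le_mulVec_dotProduct_self_le hN
    (c := 300) (by norm_num)
  simp only [hone, Matrix.one_mulVec] at hnorm
  have hsub : {x | ¬ IsGoodStart N u x} ⊆ {x | (u ⬝ᵥ x) ^ 2 ≤ (1 / 300 : ℝ) ^ 2} ∪
      ({x | 300 * (Fintype.card ι : ℝ) ≤ x ⬝ᵥ x} ∪
        {x | 300 * frobeniusSq N ≤ (N *ᵥ x) ⬝ᵥ (N *ᵥ x)}) := by
    intro x hx
    by_contra hgood
    simp only [Set.mem_union, Set.mem_ofPred_eq, not_or, not_le] at hgood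
    exact hx ⟨hgood.1, hgood.2.1.le, hgood.2.2.le⟩
  refine (measureReal_mono hsub).trans ((measureReal_union_le _ _).trans
    ((add_le_add hdot ((measureReal_union_le _ _).trans (add_le_add hnorm himage))).trans ?_))
  norm_num

lemma exp_half_le_one_add {y : ℝ} (h0 : 0 ≤ y) (h1 : y ≤ 1) : Real.exp (y / 2) ≤ 1 + y := by
  refine (Real.exp_bound_div_one_sub_of_interval (by linarith) (by linarith)).trans ?_
  rw [div_le_iff₀ (by linarith)]
  nlinarith

/-- The relations between the parameters of the stochastic gradient descent on a `k × k` matrix `N`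
of trace `k s` with `‖N‖_F² ≤ K k s²`: the step size is `c / (k s)`, there are `T` steps, and they
multiply the component along the bottom eigenvector by at least `exp L`. -/
structure DescentParams (K : ℝ) (k : ℕ) (L c : ℝ) (T : ℕ) : Prop where
  one_le_K : 1 ≤ K
  one_le_k : 1 ≤ k
  L_eq : L = 20 + Real.log K + 2 * Real.log k
  c_eq : c = 1 / (2 * 10 ^ 11 * K * L)
  le_T : k * L / c ≤ T
  T_le : T ≤ k * L / c + 1

namespace DescentParams
variable {K : ℝ} {k : ℕ} {L c : ℝ} {T : ℕ} (h : DescentParams K k L c T)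
include h

lemma K_pos : 0 < K := one_pos.trans_le h.one_le_K

lemma one_le_cast_k : (1 : ℝ) ≤ k := by exact_mod_cast h.one_le_k

lemma k_pos : (0 : ℝ) < k := one_pos.trans_le h.one_le_cast_k

lemma twenty_le_L : 20 ≤ L := by
  rw [h.L_eq]
  linarith [Real.log_nonneg h.one_le_K, Real.log_nonneg h.one_le_cast_k]

lemma c_pos : 0 < c := by
  have := h.twenty_le_L
  have := h.K_pos
  rw [h.c_eq]
  positivity

lemma K_mul_L_mul_c : K * L * c = 1 / (2 * 10 ^ 11) := by
  have := h.twenty_le_L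
  have := h.K_pos
  rw [h.c_eq]
  field_simp

lemma c_le : c ≤ 1 / 10 ^ 12 := by
  have hKL : 20 * c ≤ K * L * c := by
    refine mul_le_mul_of_nonneg_right ?_ h.c_pos.le
    nlinarith [h.twenty_le_L, h.one_le_K]
  linarith [h.K_mul_L_mul_c]

lemma K_mul_sq_c_mul_T_div_k_le : K * c ^ 2 * T / k ≤ 1 / 10 ^ 11 := by
  have hK := h.K_pos
  have hc := h.c_pos
  have hT : K * c ^ 2 * T ≤ K * c ^ 2 * (k * L / c + 1) :=
    mul_le_mul_of_nonneg_left h.T_le (by positivity)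
  have hexpand : K * c ^ 2 * (k * L / c + 1) = K * L * c * k + K * c * c := by
    field_simp
  have hKc : K * c ≤ 1 / (2 * 10 ^ 11) := by
    rw [← h.K_mul_L_mul_c]
    nlinarith [mul_pos hK hc, h.twenty_le_L]
  have hKcc : K * c * c ≤ 1 / (2 * 10 ^ 11) * 1 :=
    mul_le_mul hKc (by linarith [h.c_le]) hc.le (by norm_num)
  rw [hexpand, h.K_mul_L_mul_c] at hT
  rw [div_le_iff₀ h.k_pos]
  linarith [h.one_le_cast_k]

lemma le_exp_two_mul_L : 10 ^ 12 * K ^ 2 * (k : ℝ) ^ 4 ≤ Real.exp (2 * L) := by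
  have hexp : Real.exp (2 * L) = Real.exp 1 ^ 40 * K ^ 2 * (k : ℝ) ^ 4 := by
    rw [show 2 * L = (40 : ℕ) * 1 + (2 : ℕ) * Real.log K + (4 : ℕ) * Real.log k by
      rw [h.L_eq]; push_cast; ring, Real.exp_add, Real.exp_add, Real.exp_nat_mul,
      Real.exp_nat_mul, Real.exp_nat_mul, Real.exp_log h.K_pos, Real.exp_log h.k_pos]
  have hpow : (10 : ℝ) ^ 12 ≤ Real.exp 1 ^ 40 :=
    (by norm_num : (10 : ℝ) ^ 12 ≤ 2 ^ 40).trans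
      (pow_le_pow_left₀ (by norm_num) (by linarith [Real.add_one_le_exp (1 : ℝ)]) 40)
  rw [hexp]
  gcongr

section Errors
variable {s : ℝ} (hs : 0 < s) {F : ℝ} (hF0 : 0 ≤ F) (hF : F ≤ K * k * s ^ 2)
include hs hF

lemma sq_stepSize_mul_le : (c / k / s) ^ 2 * F ≤ K * c ^ 2 / k := by
  have hk := h.k_pos
  calc (c / k / s) ^ 2 * F ≤ (c / k / s) ^ 2 * (K * k * s ^ 2) := by gcongr
    _ = K * c ^ 2 / k := by field_simp

lemma T_mul_sq_stepSize_mul_le : T * ((c / k / s) ^ 2 * F) ≤ 1 / 10 ^ 11 :=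
  calc T * ((c / k / s) ^ 2 * F) ≤ T * (K * c ^ 2 / k) :=
        mul_le_mul_of_nonneg_left (h.sq_stepSize_mul_le hs hF) (Nat.cast_nonneg T)
    _ = K * c ^ 2 * T / k := by ring
    _ ≤ 1 / 10 ^ 11 := h.K_mul_sq_c_mul_T_div_k_le

include hF0

lemma one_add_pow_le_three : (1 + 3 * (c / k / s) ^ 2 * F) ^ T ≤ 3 := by
  have hexp : (1 + 3 * (c / k / s) ^ 2 * F) ^ T ≤ Real.exp (T * (3 * (c / k / s) ^ 2 * F)) := by
    rw [Real.exp_nat_mul]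
    refine pow_le_pow_left₀ (by positivity) ?_ T
    linarith [Real.add_one_le_exp (3 * (c / k / s) ^ 2 * F)]
  have hle : T * (3 * (c / k / s) ^ 2 * F) ≤ 1 := by
    linarith [h.T_mul_sq_stepSize_mul_le hs hF]
  linarith [Real.exp_le_exp.2 hle, Real.exp_one_lt_d9]

lemma secondMoment_error_le {E y : ℝ} (hE0 : 0 ≤ E) (hE : E ≤ 300 * F)
    (hy : (1 / 300 : ℝ) ^ 2 < y ^ 2) :
    4 * (2 * (c / k / s) ^ 2 * T * (1 + 3 * (c / k / s) ^ 2 * F) ^ T * E) / y ^ 2 ≤ 1 / 125 := by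
  have hpow := h.one_add_pow_le_three hs hF0 hF
  rw [div_le_iff₀ (lt_of_le_of_lt (by positivity) hy)]
  calc 4 * (2 * (c / k / s) ^ 2 * T * (1 + 3 * (c / k / s) ^ 2 * F) ^ T * E)
      ≤ 4 * (2 * (c / k / s) ^ 2 * T * 3 * (300 * F)) := by gcongr
    _ = 7200 * (T * ((c / k / s) ^ 2 * F)) := by ring
    _ ≤ 1 / 125 * y ^ 2 := by linarith [h.T_mul_sq_stepSize_mul_le hs hF]

omit hF0 in
lemma chebyshev_error_le : T * (2 * F / (k * s / (2 * c)) ^ 2) ≤ 1 / 1000 := by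
  have hk := h.k_pos
  have hc := h.c_pos
  calc T * (2 * F / (k * s / (2 * c)) ^ 2) = 8 * (T * ((c / k / s) ^ 2 * F)) := by
        field_simp
        ring
    _ ≤ 1 / 1000 := by linarith [h.T_mul_sq_stepSize_mul_le hs hF]

end Errors

section Growth
variable {s : ℝ} (hs : 0 < s) {l : ℝ} (hl : 2 * s ≤ l)
include hs hl

lemma exp_two_mul_L_le : Real.exp (2 * L) ≤ ((1 + c / k / s * l) ^ T) ^ 2 := by
  have hk := h.k_pos
  have hc := h.c_pos
  have hstep : Real.exp (c / k) ≤ 1 + c / k / s * l := by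
    have hck : 2 * c / k ≤ 1 := by
      rw [div_le_one hk]
      linarith [h.c_le, h.one_le_cast_k]
    calc Real.exp (c / k) = Real.exp (2 * c / k / 2) := by ring_nf
      _ ≤ 1 + 2 * c / k := exp_half_le_one_add (by positivity) hck
      _ = 1 + c / k / s * (2 * s) := by field_simp
      _ ≤ 1 + c / k / s * l := by gcongr
  calc Real.exp (2 * L) ≤ Real.exp ((T * 2 : ℕ) * (c / k)) := by
        have hT := (div_le_iff₀ hc).1 h.le_T
        refine Real.exp_le_exp.2 (le_of_mul_le_mul_right ?_ hk)
        push_cast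
        field_simp
        linarith
    _ ≤ ((1 + c / k / s * l) ^ T) ^ 2 := by
        rw [Real.exp_nat_mul, ← pow_mul]
        gcongr

lemma quadratic_bound_lt_growth {y : ℝ} (hy : (1 / 300 : ℝ) ^ 2 < y ^ 2) :
    K * k * s * (300 * k) <
      1 / (K * k) / s * (l ^ 2 * (((1 + c / k / s * l) ^ T * y) ^ 2 / 4)) := by
  have hK := h.K_pos
  have hk := h.k_pos
  have hgrowth : 10 ^ 12 * K ^ 2 * (k : ℝ) ^ 4 * (1 / 300) ^ 2 ≤
      ((1 + c / k / s * l) ^ T * y) ^ 2 := by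
    rw [mul_pow]
    exact mul_le_mul (h.le_exp_two_mul_L.trans (h.exp_two_mul_L_le hs hl)) hy.le
      (by positivity) (by positivity)
  have hpos : 0 < K * s * (k : ℝ) ^ 2 := by positivity
  calc K * k * s * (300 * k) = 300 * (K * s * (k : ℝ) ^ 2) := by ring
    _ < 10 ^ 12 / 300 ^ 2 * (K * s * (k : ℝ) ^ 2 * k) := by
        nlinarith [mul_le_mul_of_nonneg_left h.one_le_cast_k hpos.le]
    _ = 1 / (K * k) / s *
          ((2 * s) ^ 2 * (10 ^ 12 * K ^ 2 * (k : ℝ) ^ 4 * (1 / 300) ^ 2 / 4)) := by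
        field_simp
        norm_num
    _ ≤ 1 / (K * k) / s * (l ^ 2 * (((1 + c / k / s * l) ^ T * y) ^ 2 / 4)) := by gcongr

end Growth
end DescentParams

/-- A symmetric matrix with average eigenvalue `s > 0`, Frobenius norm `O(√k s)` and an eigenvalue
at most `-2 s`: what the tester sees, with high probability, on an input far from the PSD cone. -/
structure HasLargeNegativeDirection (K s : ℝ) {k : ℕ} (N : Matrix (Fin k) (Fin k) ℝ) : Prop where
  pos : 0 < s
  isSymm : N.IsSymm
  trace_eq : N.trace = k * s
  frobeniusSq_le : frobeniusSq N ≤ K * k * s ^ 2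
  exists_quadratic_le : ∃ x : Fin k → ℝ, 0 < x ⬝ᵥ x ∧ x ⬝ᵥ (N *ᵥ x) ≤ -(2 * s) * (x ⬝ᵥ x)

namespace HasLargeNegativeDirection
variable {K s : ℝ} {k : ℕ} {N : Matrix (Fin k) (Fin k) ℝ} (hN : HasLargeNegativeDirection K s N)
include hN

lemma sqrt_frobeniusSq_le (hK : 1 ≤ K) (hk : 1 ≤ k) : √(frobeniusSq N) ≤ K * k * s := by
  have hs := hN.pos
  have hk' : (1 : ℝ) ≤ k := by exact_mod_cast hk
  have hKk : 1 ≤ K * k := one_le_mul_of_one_le_of_one_le hK hk'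
  rw [Real.sqrt_le_left (by positivity)]
  calc frobeniusSq N ≤ K * k * s ^ 2 * 1 := by simpa only [mul_one] using hN.frobeniusSq_le
    _ ≤ K * k * s ^ 2 * (K * k) := by gcongr
    _ = (K * k * s) ^ 2 := by ring

lemma frobeniusSq_pos (hk : 1 ≤ k) : 0 < frobeniusSq N := by
  have hs := hN.pos
  have : (1 : ℝ) ≤ k := by exact_mod_cast hk
  refine (frobeniusSq_nonneg N).lt_of_ne fun h0 => ?_
  have htrace := hN.trace_eq
  rw [eq_zero_of_frobeniusSq_eq_zero h0.symm, Matrix.trace_zero] at htrace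
  exact absurd htrace (by positivity)

variable {L c : ℝ} {T : ℕ} (h : DescentParams K k L c T)
include h

lemma uniformLaw_real_descentPoint_nonneg_le {l : ℝ} {u : Fin k → ℝ}
    (hl2 : 2 * s ≤ l) (hu : N *ᵥ u = -l • u) (hu1 : u ⬝ᵥ u = 1)
    (hl : ∀ y : Fin k → ℝ, -l * (y ⬝ᵥ y) ≤ y ⬝ᵥ (N *ᵥ y)) {x : Fin k → ℝ}
    (hx : IsGoodStart N u x) :
    (uniformLaw (Fin T → Fin k → Bool)).real
      {σ | 0 ≤ descentPoint N (c / k / s) (1 / (K * k) / s) x σ ⬝ᵥ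
        (N *ᵥ descentPoint N (c / k / s) (1 / (K * k) / s) x σ)} ≤ 1 / 100 := by
  have hs := hN.pos
  have hK := h.K_pos
  have hk := h.k_pos
  have hc := h.c_pos
  have hF := hN.frobeniusSq_le
  have hsqrt := hN.sqrt_frobeniusSq_le h.one_le_K h.one_le_k
  have hxu := hx.lt_dotProduct_sq
  have hxx : x ⬝ᵥ x ≤ 300 * k := by simpa only [Fintype.card_fin] using hx.dotProduct_self_le
  have hstep : c / k / s * (N.trace + k * s / (2 * c)) ≤ 1 := by
    have hvalue : c / k / s * (k * s + k * s / (2 * c)) = c + 1 / 2 := by field_simp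
    rw [hN.trace_eq, hvalue]
    linarith [h.c_le]
  have hα : 1 / (K * k) / s * √(frobeniusSq N) ≤ 1 := by
    rw [div_div, one_div, inv_mul_le_one₀ (by positivity)]
    exact hsqrt
  have hquadratic : x ⬝ᵥ (N *ᵥ x) ≤ K * k * s * (300 * k) :=
    (le_abs_self _).trans ((abs_quadratic_le N x).trans
      (mul_le_mul hsqrt hxx (dotProduct_self_nonneg x) (by positivity)))
  have hux : u ⬝ᵥ x ≠ 0 := fun h0 => absurd hxu (by rw [h0]; norm_num)
  have hdescent := uniformLaw_quadratic_descentPoint_nonneg_le hN.isSymm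
    (by positivity) (by linarith) hl hu hu1 T (Δ := k * s / (2 * c)) (by positivity) hstep
    (by positivity) hα hux (hquadratic.trans_lt (h.quadratic_bound_lt_growth hs hl2 hxu))
  have hmoment := h.secondMoment_error_le hs (frobeniusSq_nonneg N) hF
    (dotProduct_self_nonneg (N *ᵥ x)) hx.mulVec_dotProduct_self_le hxu
  linarith [h.chebyshev_error_le hs hF]

lemma prod_real_descentPoint_nonneg_le
    (hmeas : MeasurableSet {ω : (Fin k → ℝ) × (Fin T → Fin k → Bool) |
      0 ≤ descentPoint N (c / k / s) (1 / (K * k) / s) ω.1 ω.2 ⬝ᵥ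
        (N *ᵥ descentPoint N (c / k / s) (1 / (K * k) / s) ω.1 ω.2)}) :
    ((gaussVec (Fin k)).prod (uniformLaw (Fin T → Fin k → Bool))).real
      {ω | 0 ≤ descentPoint N (c / k / s) (1 / (K * k) / s) ω.1 ω.2 ⬝ᵥ
        (N *ᵥ descentPoint N (c / k / s) (1 / (K * k) / s) ω.1 ω.2)} ≤ 1 / 50 := by
  have : Nonempty (Fin k) := Fin.pos_iff_nonempty.1 h.one_le_k
  obtain ⟨y, hy, hyN⟩ := hN.exists_quadratic_le
  obtain ⟨l, u, hl2, hu, hu1, hl⟩ := exists_min_eigenvector hN.isSymm hy hyN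
  refine (measureReal_prod_le hmeas (b := 1 / 100) (by norm_num)
    (gaussVec_real_not_isGoodStart_le (hN.frobeniusSq_pos h.one_le_k) hu1)
    fun x hx => ?_).trans (by norm_num)
  exact hN.uniformLaw_real_descentPoint_nonneg_le h hl2 hu hu1 hl (not_not.1 hx)

end HasLargeNegativeDirection
end DescentAnalysis

section SketchAnalysis

section ProductMeasure
variable {α β : Type*} [MeasurableSpace α] [MeasurableSpace β] (μ : Measure α) (ν : Measure β)

lemma prod_real_fst_mem [SFinite μ] [IsProbabilityMeasure ν] (S : Set α) :
    (μ.prod ν).real {z | z.1 ∈ S} = μ.real S := by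
  have hprod : {z : α × β | z.1 ∈ S} = S ×ˢ Set.univ := Set.prod_univ.symm
  rw [hprod, measureReal_prod_prod, probReal_univ, mul_one]

lemma prod_real_snd_mem [IsProbabilityMeasure μ] [SFinite ν] (S : Set β) :
    (μ.prod ν).real {z | z.2 ∈ S} = ν.real S := by
  have hprod : {z : α × β | z.2 ∈ S} = Set.univ ×ˢ S := Set.univ_prod.symm
  rw [hprod, measureReal_prod_prod, probReal_univ, one_mul]

end ProductMeasure

/-- The dimension `k` of the sketch is large enough for the distance `ε`. -/
structure SketchParams (ε : ℝ) (k : ℕ) : Prop where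
  pos : 0 < ε
  le_one : ε ≤ 1
  one_le_k : 1 ≤ k
  log_le : 4 * 10 ^ 7 * Real.log (2 * k + 1) ≤ ε ^ 2 * k

namespace SketchParams
variable {ε : ℝ} {k : ℕ} (h : SketchParams ε k)
include h

lemma one_le_cast_k : (1 : ℝ) ≤ k := by exact_mod_cast h.one_le_k

lemma k_pos : (0 : ℝ) < k := one_pos.trans_le h.one_le_cast_k

lemma one_le_log : 1 ≤ Real.log (2 * k + 1) := by
  have := h.one_le_cast_k
  rw [Real.le_log_iff_exp_le (by positivity)]
  linarith [Real.exp_one_lt_d9]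

lemma le_sq_mul : 4 * 10 ^ 7 ≤ ε ^ 2 * k := by
  linarith [h.one_le_log, h.log_le]

lemma le_mul : 4 * 10 ^ 7 ≤ ε * k := by
  refine h.le_sq_mul.trans (mul_le_mul_of_nonneg_right ?_ h.k_pos.le)
  exact pow_le_of_le_one h.pos.le h.le_one two_ne_zero

lemma le_k : 4 * 10 ^ 7 ≤ (k : ℝ) :=
  h.le_mul.trans (mul_le_of_le_one_left h.k_pos.le h.le_one)

lemma mul_sqrt_le : 1152 * √k ≤ ε * k / 4 := by
  have hsqrt : 4608 ≤ ε * √k := by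
    refine le_of_sq_le_sq ?_ (mul_nonneg h.pos.le (Real.sqrt_nonneg _))
    rw [mul_pow, Real.sq_sqrt h.k_pos.le]
    linarith [h.le_sq_mul]
  nlinarith [Real.mul_self_sqrt h.k_pos.le, Real.sqrt_pos.2 h.k_pos]

lemma mul_sqrt_log_le : 96 * √(k * Real.log (2 * k + 1)) ≤ ε * k / 64 := by
  have hk := h.k_pos
  have hε := h.pos
  have hsqrt : √(k * Real.log (2 * k + 1)) ≤ ε * k / 6144 := by
    refine Real.sqrt_le_iff.2 ⟨by positivity, ?_⟩
    rw [div_pow, le_div_iff₀ (by norm_num)]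
    nlinarith [mul_le_mul_of_nonneg_left h.log_le hk.le, mul_pos hk (mul_pos (pow_pos hε 2) hk)]
  linarith

lemma lower_tail_add_trace_le {F : ℝ} (hF : 0 ≤ F) :
    4 * (6 * √(k * Real.log (2 * k + 1)) * F) + 3 * (18 * k * F) / √k + 18 * √k * F ≤
      ε * k / 32 * F / 2 := by
  have hk := h.k_pos
  have hsqrt : √k ≤ √(k * Real.log (2 * k + 1)) :=
    Real.sqrt_le_sqrt (le_mul_of_one_le_right hk.le h.one_le_log)
  have hdiv : 3 * (18 * k * F) / √k = 54 * √k * F := by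
    rw [div_eq_iff (Real.sqrt_pos.2 hk).ne']
    linear_combination -54 * F * Real.mul_self_sqrt hk.le
  rw [hdiv]
  nlinarith [mul_le_mul_of_nonneg_right h.mul_sqrt_log_le hF,
    mul_le_mul_of_nonneg_right hsqrt hF]

lemma exp_lower_tail_le : (2 * k + 1 : ℝ) ^ k *
    Real.exp (-((6 * √(k * Real.log (2 * k + 1))) ^ 2 / 6)) ≤ 1 / 100 := by
  have hk := h.le_k
  have hlog := h.one_le_log
  have hpow : (2 * k + 1 : ℝ) ^ k = Real.exp (k * Real.log (2 * k + 1)) := by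
    rw [Real.exp_nat_mul, Real.exp_log (by positivity)]
  have hsq : (6 * √(k * Real.log (2 * k + 1))) ^ 2 / 6 = 6 * (k * Real.log (2 * k + 1)) := by
    rw [mul_pow, Real.sq_sqrt (by positivity)]
    ring
  rw [hpow, hsq, ← Real.exp_add]
  have hexponent : k * Real.log (2 * k + 1) + -(6 * (k * Real.log (2 * k + 1))) ≤ -100 := by
    nlinarith
  refine (Real.exp_le_exp.2 hexponent).trans ?_
  rw [Real.exp_neg, ← one_div]
  exact one_div_le_one_div_of_le (by norm_num) (by linarith [Real.add_one_le_exp (100 : ℝ)])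

end SketchParams

variable {d k R : ℕ}

/-- The law of the coins that determine the shifted sketch: the Gaussian matrix `G` of the sketch
`Gᵀ A G` and the `R` pairs of Gaussian vectors from which the Frobenius norm is estimated. -/
noncomputable abbrev sketchLaw (d k R : ℕ) :
    Measure ((Fin d → Fin k → ℝ) × (Fin R → (Fin d → ℝ) × (Fin d → ℝ))) :=
  (gaussRows (Fin d) (Fin k)).prod (Measure.pi fun _ => (gaussVec (Fin d)).prod (gaussVec (Fin d)))

/-- The coins `z` give a centred sketch of the typical Frobenius norm and an estimate of
`‖A‖_F²` within a constant factor. -/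
structure IsTypical (A : Matrix (Fin d) (Fin d) ℝ)
    (z : (Fin d → Fin k → ℝ) × (Fin R → (Fin d → ℝ) × (Fin d → ℝ))) : Prop where
  frobeniusSq_le : frobeniusSq (centredSketch A z.1) ≤ (18 * k * √(frobeniusSq A)) ^ 2
  abs_average_sub_le :
    |(∑ r, ((A *ᵥ (z.2 r).1) ⬝ᵥ (z.2 r).2) ^ 2) / R - frobeniusSq A| ≤ 3 / 4 * frobeniusSq A

lemma gaussRows_real_lt_frobeniusSq_centredSketch_le {A : Matrix (Fin d) (Fin d) ℝ}
    (hA : A.IsSymm) (hk : 1 ≤ k) :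
    (gaussRows (Fin d) (Fin k)).real
      {G | (18 * k * √(frobeniusSq A)) ^ 2 < frobeniusSq (centredSketch A G)} ≤ 1 / 100 := by
  rcases (frobeniusSq_nonneg A).eq_or_lt with h0 | h0
  · have hempty : {G : Fin d → Fin k → ℝ |
        (18 * k * √(frobeniusSq A)) ^ 2 < frobeniusSq (centredSketch A G)} = ∅ := by
      ext G
      simp [eq_zero_of_frobeniusSq_eq_zero h0.symm, centredSketch, sketch, frobeniusSq]
    rw [hempty, measureReal_empty]
    norm_num
  · have hk' : (0 : ℝ) < k := by exact_mod_cast hk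
    refine (measureReal_mono fun G hG => le_of_lt (Set.mem_ofPred_eq ▸ hG)).trans
      ((gaussRows_real_frobeniusSq_centredSketch_ge_le (Matrix.isHermitian_iff_isSymm.2 hA)
        (by have := Real.sqrt_pos.2 h0; positivity)).trans ?_)
    rw [Fintype.card_fin, mul_pow, Real.sq_sqrt h0.le, div_le_iff₀ (by positivity)]
    nlinarith [mul_pos (pow_pos hk' 2) h0]

lemma sketchLaw_real_not_isTypical_le {A : Matrix (Fin d) (Fin d) ℝ} (hA : A.IsSymm)
    (hk : 1 ≤ k) (hR : 1600 ≤ R) :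
    (sketchLaw d k R).real {z | ¬ IsTypical A z} ≤ 1 / 50 := by
  have hsketch := (prod_real_fst_mem _
    (Measure.pi fun _ : Fin R => (gaussVec (Fin d)).prod (gaussVec (Fin d))) _).trans_le
    (gaussRows_real_lt_frobeniusSq_centredSketch_le hA hk)
  have haverage := (prod_real_snd_mem (gaussRows (Fin d) (Fin k)) _ _).trans_le
    (pi_prod_gaussVec_real_abs_average_sub_frobeniusSq_gt_le A (R := R) (by omega))
  have hR' : (16 : ℝ) / R ≤ 1 / 100 := by
    have : (1600 : ℝ) ≤ R := by exact_mod_cast hR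
    rw [div_le_iff₀ (by linarith)]
    linarith
  refine (measureReal_mono fun z hz => ?_).trans ((measureReal_union_le _ _).trans
    ((add_le_add hsketch haverage).trans (by linarith)))
  by_contra htypical
  simp only [Set.mem_union, Set.mem_ofPred_eq, not_or, not_lt] at htypical
  exact hz ⟨htypical.1, htypical.2⟩

namespace IsTypical
variable {A : Matrix (Fin d) (Fin d) ℝ}
  {z : (Fin d → Fin k → ℝ) × (Fin R → (Fin d → ℝ) × (Fin d → ℝ))} (hz : IsTypical A z)
include hz

lemma le_normShift {b : ℝ} (hb : 0 ≤ b) : b * √(frobeniusSq A) / 2 ≤ normShift b A z.2 := by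
  have hsqrt : √(frobeniusSq A) / 2 ≤ √((∑ r, ((A *ᵥ (z.2 r).1) ⬝ᵥ (z.2 r).2) ^ 2) / R) := by
    refine Real.le_sqrt_of_sq_le ?_
    rw [div_pow, Real.sq_sqrt (frobeniusSq_nonneg A)]
    linarith [(abs_le.1 hz.abs_average_sub_le).1]
  rw [mul_div_assoc]
  exact mul_le_mul_of_nonneg_left hsqrt hb

lemma normShift_le {b : ℝ} (hb : 0 ≤ b) :
    normShift b A z.2 ≤ 4 / 3 * (b * √(frobeniusSq A)) := by
  have hF := frobeniusSq_nonneg A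
  have hsqrt : √((∑ r, ((A *ᵥ (z.2 r).1) ⬝ᵥ (z.2 r).2) ^ 2) / R) ≤ 4 / 3 * √(frobeniusSq A) := by
    refine Real.sqrt_le_iff.2 ⟨by positivity, ?_⟩
    rw [mul_pow, Real.sq_sqrt hF]
    linarith [(abs_le.1 hz.abs_average_sub_le).2]
  calc normShift b A z.2 ≤ b * (4 / 3 * √(frobeniusSq A)) := mul_le_mul_of_nonneg_left hsqrt hb
    _ = 4 / 3 * (b * √(frobeniusSq A)) := by ring

lemma abs_trace_centredSketch_div_le (hk : 1 ≤ k) :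
    |(centredSketch A z.1).trace / k| ≤ 18 * √k * √(frobeniusSq A) := by
  have : Nonempty (Fin k) := Fin.pos_iff_nonempty.1 hk
  have hnorm : frobeniusSq (centredSketch A z.1) ≤
      Fintype.card (Fin k) * (18 * √k * √(frobeniusSq A)) ^ 2 := by
    refine hz.frobeniusSq_le.trans (le_of_eq ?_)
    rw [Fintype.card_fin]
    linear_combination -(18 ^ 2 * k * √(frobeniusSq A) ^ 2) *
      Real.sq_sqrt (Nat.cast_nonneg (α := ℝ) k)
  simpa only [Fintype.card_fin] using abs_trace_div_card_le (by positivity) hnorm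

variable {ε : ℝ} (h : SketchParams ε k)
include h

lemma shiftedSketch_normShift_nonneg
    (hlow : ∀ x, -((4 * (6 * √(k * Real.log (2 * k + 1)) * √(frobeniusSq A)) +
      3 * (18 * k * √(frobeniusSq A)) / √k) * (x ⬝ᵥ x)) ≤ x ⬝ᵥ (centredSketch A z.1 *ᵥ x))
    (x : Fin k → ℝ) :
    0 ≤ x ⬝ᵥ (shiftedSketch (normShift (ε * k / 32) A z.2) A z.1 *ᵥ x) := by
  have : Nonempty (Fin k) := Fin.pos_iff_nonempty.1 h.one_le_k
  have hε := h.pos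
  have hshift := hz.le_normShift (b := ε * k / 32) (by positivity)
  have htrace := (abs_le.1 (hz.abs_trace_centredSketch_div_le h.one_le_k)).2
  have hmargin := h.lower_tail_add_trace_le (Real.sqrt_nonneg (frobeniusSq A))
  rw [dotProduct_shiftedSketch_mulVec, Fintype.card_fin]
  have hcoeff : 4 * (6 * √(k * Real.log (2 * k + 1)) * √(frobeniusSq A)) +
      3 * (18 * k * √(frobeniusSq A)) / √k ≤
        normShift (ε * k / 32) A z.2 - (centredSketch A z.1).trace / k := by
    linarith
  linarith [hlow x, mul_le_mul_of_nonneg_right hcoeff (dotProduct_self_nonneg x)]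

lemma frobeniusSq_shiftedSketch_normShift_le :
    frobeniusSq (shiftedSketch (normShift (ε * k / 32) A z.2) A z.1) ≤
      10 ^ 7 * k * normShift (ε * k / 32) A z.2 ^ 2 := by
  have : Nonempty (Fin k) := Fin.pos_iff_nonempty.1 h.one_le_k
  have hk := h.k_pos
  have hε := h.pos
  have hshift := hz.le_normShift (b := ε * k / 32) (by positivity)
  have hcentred : frobeniusSq (centredSketch A z.1) ≤
      18 ^ 2 * 64 ^ 2 * (k * normShift (ε * k / 32) A z.2 ^ 2) :=
    calc frobeniusSq (centredSketch A z.1) ≤ (18 * k * √(frobeniusSq A)) ^ 2 * 1 := by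
          simpa only [mul_one] using hz.frobeniusSq_le
      _ ≤ (18 * k * √(frobeniusSq A)) ^ 2 * (ε ^ 2 * k) := by
          gcongr
          linarith [h.le_sq_mul]
      _ = 18 ^ 2 * 64 ^ 2 * (k * (ε * k / 32 * √(frobeniusSq A) / 2) ^ 2) := by ring
      _ ≤ 18 ^ 2 * 64 ^ 2 * (k * normShift (ε * k / 32) A z.2 ^ 2) := by gcongr
  have hbound := frobeniusSq_shiftedSketch_le (normShift (ε * k / 32) A z.2) A z.1
  rw [Fintype.card_fin] at hbound
  linarith [mul_nonneg hk.le (sq_nonneg (normShift (ε * k / 32) A z.2))]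

lemma quadratic_shiftedSketch_normShift_le {x : Fin k → ℝ}
    (hx : x ⬝ᵥ (centredSketch A z.1 *ᵥ x) ≤ -(ε * k / 4 * √(frobeniusSq A) * (x ⬝ᵥ x))) :
    x ⬝ᵥ (shiftedSketch (normShift (ε * k / 32) A z.2) A z.1 *ᵥ x) ≤
      -(2 * normShift (ε * k / 32) A z.2) * (x ⬝ᵥ x) := by
  have : Nonempty (Fin k) := Fin.pos_iff_nonempty.1 h.one_le_k
  have hε := h.pos
  have hF := Real.sqrt_nonneg (frobeniusSq A)
  have hshift := hz.normShift_le (b := ε * k / 32) (by positivity)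
  have htrace := (abs_le.1 (hz.abs_trace_centredSketch_div_le h.one_le_k)).1
  have hsqrt := mul_le_mul_of_nonneg_right h.mul_sqrt_le hF
  rw [dotProduct_shiftedSketch_mulVec, Fintype.card_fin]
  have hcoeff : -(ε * k / 4 * √(frobeniusSq A)) +
      (normShift (ε * k / 32) A z.2 - (centredSketch A z.1).trace / k) ≤
        -(2 * normShift (ε * k / 32) A z.2) := by
    have : 0 ≤ ε * k * √(frobeniusSq A) := by positivity
    linarith
  linarith [mul_le_mul_of_nonneg_right hcoeff (dotProduct_self_nonneg x)]

lemma hasLargeNegativeDirection (hA : A.IsSymm) (hA0 : A ≠ 0) {x : Fin k → ℝ} (hx0 : 0 < x ⬝ᵥ x)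
    (hx : x ⬝ᵥ (centredSketch A z.1 *ᵥ x) ≤ -(ε * k / 4 * √(frobeniusSq A) * (x ⬝ᵥ x))) :
    HasLargeNegativeDirection (10 ^ 7) (normShift (ε * k / 32) A z.2)
      (shiftedSketch (normShift (ε * k / 32) A z.2) A z.1) := by
  have : Nonempty (Fin k) := Fin.pos_iff_nonempty.1 h.one_le_k
  have hk := h.k_pos
  have hε := h.pos
  have hF : 0 < √(frobeniusSq A) := Real.sqrt_pos.2
    ((frobeniusSq_nonneg A).lt_of_ne fun h0 => hA0 (eq_zero_of_frobeniusSq_eq_zero h0.symm))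
  exact
    { pos := lt_of_lt_of_le (by positivity) (hz.le_normShift (by positivity))
      isSymm := shiftedSketch_isSymm hA _ _
      trace_eq := by rw [shiftedSketch_trace, Fintype.card_fin]
      frobeniusSq_le := hz.frobeniusSq_shiftedSketch_normShift_le h
      exists_quadratic_le := ⟨x, hx0, hz.quadratic_shiftedSketch_normShift_le h hx⟩ }

end IsTypical

variable {ε : ℝ} (h : SketchParams ε k) (hR : 1600 ≤ R) {A : Matrix (Fin d) (Fin d) ℝ}
include h hR

lemma sketchLaw_real_not_shiftedSketch_nonneg_le (hA : A.PosSemidef) :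
    (sketchLaw d k R).real {z | ¬ ∀ x : Fin k → ℝ,
      0 ≤ x ⬝ᵥ (shiftedSketch (normShift (ε * k / 32) A z.2) A z.1 *ᵥ x)} ≤ 3 / 100 := by
  have htail := gaussRows_real_not_quadratic_centredSketch_ge_le (ι := Fin k)
    ((Fintype.card_fin k).symm ▸ h.one_le_k) hA
    (t := 6 * √(k * Real.log (2 * k + 1))) (R := 18 * k * √(frobeniusSq A))
    (by positivity) (by positivity)
  simp only [Fintype.card_fin] at htail
  have hlow := (prod_real_fst_mem _ (Measure.pi fun _ : Fin R =>
    (gaussVec (Fin d)).prod (gaussVec (Fin d))) _).trans_le (htail.trans h.exp_lower_tail_le)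
  refine (measureReal_mono fun z hz => ?_).trans ((measureReal_union_le _ _).trans
    ((add_le_add (sketchLaw_real_not_isTypical_le
      (Matrix.isHermitian_iff_isSymm.1 hA.isHermitian) h.one_le_k hR) hlow).trans
      (by norm_num)))
  by_contra hgood
  simp only [Set.mem_union, Set.mem_ofPred_eq, not_or, not_not, not_and] at hgood
  exact hz (hgood.1.shiftedSketch_normShift_nonneg h (hgood.2 hgood.1.frobeniusSq_le))

lemma sketchLaw_real_not_hasLargeNegativeDirection_le (hA : A.IsSymm)
    (hfar : IsFarFromPSD ε 2 A) :
    (sketchLaw d k R).real {z | ¬ HasLargeNegativeDirection (10 ^ 7)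
      (normShift (ε * k / 32) A z.2) (shiftedSketch (normShift (ε * k / 32) A z.2) A z.1)} ≤
        3 / 100 := by
  obtain ⟨hA0, l, hl, hlε⟩ := hfar
  rw [schattenNorm_two] at hlε
  have htail := gaussRows_real_not_exists_negative_direction_le (ι := Fin k)
    (Matrix.isHermitian_iff_isSymm.2 hA) hA0 h.pos h.le_one hl hlε
    (by rw [Fintype.card_fin]; linarith [h.le_mul])
  simp only [Fintype.card_fin] at htail
  have hk : 8 / (k : ℝ) + 3 / 400 ≤ 1 / 100 := by
    have : 8 / (k : ℝ) ≤ 1 / 400 := by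
      rw [div_le_iff₀ h.k_pos]
      linarith [h.le_k]
    linarith
  have hdirection := (prod_real_fst_mem _ (Measure.pi fun _ : Fin R =>
    (gaussVec (Fin d)).prod (gaussVec (Fin d))) _).trans_le (htail.trans hk)
  refine (measureReal_mono fun z hz => ?_).trans ((measureReal_union_le _ _).trans
    ((add_le_add (sketchLaw_real_not_isTypical_le hA h.one_le_k hR) hdirection).trans
      (by norm_num)))
  by_contra hgood
  simp only [Set.mem_union, Set.mem_ofPred_eq, not_or, not_not] at hgood
  obtain ⟨htypical, x, hx0, hx⟩ := hgood
  exact hz (htypical.hasLargeNegativeDirection h hA hA0 hx0 hx)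

end SketchAnalysis

section TesterAnalysis
variable {d k R T : ℕ}

/-- The law of the coins of the tester. -/
noncomputable abbrev testerLaw (d k R T : ℕ) : Measure (TesterCoins d k R T) :=
  (sketchLaw d k R).prod ((gaussVec (Fin k)).prod (uniformLaw (Fin T → Fin k → Bool)))

variable {ε L c : ℝ} (h : SketchParams ε k) (hR : 1600 ≤ R) {A : Matrix (Fin d) (Fin d) ℝ}
include h hR

lemma testerLaw_real_testerOutput_eq_false_le (a : ℝ) (hA : A.PosSemidef) :
    (testerLaw d k R T).real {ω | testerOutput (ε * k / 32) c a A ω = false} ≤ 1 / 3 := by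
  have hfst := (prod_real_fst_mem _ ((gaussVec (Fin k)).prod
    (uniformLaw (Fin T → Fin k → Bool))) _).trans_le
    (sketchLaw_real_not_shiftedSketch_nonneg_le h hR hA)
  refine (measureReal_mono fun ω hω hnonneg => ?_).trans (hfst.trans (by norm_num))
  exact absurd (hnonneg _) (of_decide_eq_false hω)

lemma testerLaw_real_testerOutput_eq_true_le (hD : DescentParams (10 ^ 7) k L c T)
    (hA : A.IsSymm) (hfar : IsFarFromPSD ε 2 A) :
    (testerLaw d k R T).real
      {ω | testerOutput (ε * k / 32) (c / k) (1 / (10 ^ 7 * k)) A ω = true} ≤ 1 / 3 := by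
  have hmeas : MeasurableSet {ω : TesterCoins d k R T |
      testerOutput (ε * k / 32) (c / k) (1 / (10 ^ 7 * k)) A ω = true} :=
    (queryComputable_testerOutput _ _ _).measurable A (measurableSet_singleton true)
  refine (measureReal_prod_le hmeas (b := 1 / 50) (by norm_num)
    (sketchLaw_real_not_hasLargeNegativeDirection_le h hR hA hfar) fun z hz => ?_).trans
    (by norm_num)
  have hsection := measurable_prodMk_left (x := z) hmeas
  simp only [testerOutput, Set.preimage_ofPred_eq, Set.mem_ofPred_eq, decide_eq_true_eq]
    at hsection ⊢
  exact (not_not.1 hz).prod_real_descentPoint_nonneg_le hD hsection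

lemma exists_isTester (hD : DescentParams (10 ^ 7) k L c T) (d : ℕ) :
    ∃ V : VMVAlgorithm d, V.IsTester ε 2 ∧ V.numQueries = R + k + T + k + 1 := by
  have hcomputable := queryComputable_testerOutput (d := d) (k := k) (R := R) (T := T)
    (ε * k / 32) (c / k) (1 / (10 ^ 7 * k))
  obtain ⟨V, hn, hV⟩ := hcomputable.exists_algorithm (testerLaw d k R T)
  have hprob (A : Matrix (Fin d) (Fin d) ℝ) :
      V.μ.real {ω | V.run A ω = true} + V.μ.real {ω | V.run A ω = false} = 1 := by
    have hmeas : MeasurableSet {ω : TesterCoins d k R T |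
        testerOutput (ε * k / 32) (c / k) (1 / (10 ^ 7 * k)) A ω = true} :=
      hcomputable.measurable A (measurableSet_singleton true)
    have hcompl := probReal_add_probReal_compl (μ := testerLaw d k R T) hmeas
    simp only [Set.compl_ofPred, Bool.not_eq_true] at hcompl
    rwa [hV, hV]
  refine ⟨V, fun A hA => ⟨fun hpsd => ?_, fun hfar => ?_⟩, hn⟩
  · have hfalse := testerLaw_real_testerOutput_eq_false_le (T := T) (c := c / k) h hR
      (1 / (10 ^ 7 * k)) hpsd
    rw [← hV] at hfalse
    linarith [hprob A]
  · have htrue := testerLaw_real_testerOutput_eq_true_le h hR hD hA hfar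
    rw [← hV] at htrue
    linarith [hprob A]

end TesterAnalysis

section QueryComplexity

lemma log_le_of_le_two_pow {x : ℝ} (hx : 0 < x) {n : ℕ} (h : x ≤ 2 ^ n) : Real.log x ≤ n := by
  rw [Real.log_le_iff_le_exp hx, ← mul_one (n : ℝ), Real.exp_nat_mul]
  exact h.trans (pow_le_pow_left₀ (by norm_num) (by linarith [Real.add_one_le_exp (1 : ℝ)]) n)

lemma log_mul_mul_one_add_log_le {f a : ℝ} (hf : 1 ≤ f) (ha : 0 < a) {n : ℕ} (hn : 2 ≤ n)
    (h : a ≤ 2 ^ n) : Real.log (a * f * (1 + Real.log f)) ≤ n * (1 + Real.log f) := by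
  have hlog := Real.log_nonneg hf
  have hn' : (2 : ℝ) ≤ n := by exact_mod_cast hn
  rw [Real.log_mul (by positivity) (by positivity), Real.log_mul (by positivity) (by positivity)]
  nlinarith [log_le_of_le_two_pow ha h,
    Real.log_le_sub_one_of_pos (x := 1 + Real.log f) (by linarith)]

lemma log_two_mul_add_one_le {f : ℝ} (hf : 1 ≤ f) {k : ℕ}
    (hk : (k : ℝ) ≤ 2 * 10 ^ 10 * (f * (1 + Real.log f))) :
    Real.log (2 * k + 1) ≤ 36 * (1 + Real.log f) := by
  have hfl : 1 ≤ f * (1 + Real.log f) :=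
    one_le_mul_of_one_le_of_one_le hf (by linarith [Real.log_nonneg hf])
  refine (Real.log_le_log (by positivity) ?_).trans
    (log_mul_mul_one_add_log_le hf (a := 5 * 10 ^ 10) (n := 36) (by norm_num) (by norm_num)
      (by norm_num))
  linarith

lemma exists_sketchParams {ε : ℝ} (hε : 0 < ε) (hε1 : ε ≤ 1) :
    ∃ k : ℕ, SketchParams ε k ∧
      (k : ℝ) ≤ 2 * 10 ^ 10 * (1 / ε ^ 2 * (1 + Real.log (1 / ε ^ 2))) := by
  have hf : 1 ≤ 1 / ε ^ 2 := one_le_one_div (by positivity) (pow_le_one₀ hε.le hε1)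
  have hfl : 1 ≤ 1 / ε ^ 2 * (1 + Real.log (1 / ε ^ 2)) :=
    one_le_mul_of_one_le_of_one_le hf (by linarith [Real.log_nonneg hf])
  set k : ℕ := ⌈10 ^ 10 * (1 / ε ^ 2 * (1 + Real.log (1 / ε ^ 2)))⌉₊
  have hle : 10 ^ 10 * (1 / ε ^ 2 * (1 + Real.log (1 / ε ^ 2))) ≤ k := Nat.le_ceil _
  have hk : (k : ℝ) ≤ 2 * 10 ^ 10 * (1 / ε ^ 2 * (1 + Real.log (1 / ε ^ 2))) := by
    have : (k : ℝ) < 10 ^ 10 * (1 / ε ^ 2 * (1 + Real.log (1 / ε ^ 2))) + 1 :=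
      Nat.ceil_lt_add_one (by positivity)
    linarith
  refine ⟨k, ⟨hε, hε1, by exact_mod_cast (by linarith : (1 : ℝ) ≤ k), ?_⟩, hk⟩
  calc 4 * 10 ^ 7 * Real.log (2 * k + 1)
      ≤ 4 * 10 ^ 7 * (36 * (1 + Real.log (1 / ε ^ 2))) := by
        gcongr
        exact log_two_mul_add_one_le hf hk
    _ ≤ 10 ^ 10 * (1 + Real.log (1 / ε ^ 2)) := by linarith [Real.log_nonneg hf]
    _ = ε ^ 2 * (10 ^ 10 * (1 / ε ^ 2 * (1 + Real.log (1 / ε ^ 2)))) := by field_simp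
    _ ≤ ε ^ 2 * k := by gcongr

lemma exists_descentParams {k : ℕ} (hk : 1 ≤ k) :
    ∃ (L c : ℝ) (T : ℕ), DescentParams (10 ^ 7) k L c T ∧
      L ≤ 44 + 2 * Real.log (2 * k + 1) ∧ T ≤ 2 * 10 ^ 18 * (k * L ^ 2) + 1 := by
  have hk' : (1 : ℝ) ≤ k := by exact_mod_cast hk
  have hlog7 : Real.log (10 ^ 7) ≤ 24 := by
    exact_mod_cast log_le_of_le_two_pow (x := 10 ^ 7) (n := 24) (by norm_num) (by norm_num)
  have hlog : Real.log k ≤ Real.log (2 * k + 1) :=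
    Real.log_le_log (by linarith) (by linarith)
  set L : ℝ := 20 + Real.log (10 ^ 7) + 2 * Real.log k with hL
  have hL0 : 0 < L := by
    linarith [Real.log_nonneg hk', Real.log_nonneg (by norm_num : (1 : ℝ) ≤ 10 ^ 7)]
  have hratio : k * L / (1 / (2 * 10 ^ 11 * 10 ^ 7 * L)) = 2 * 10 ^ 18 * (k * L ^ 2) := by
    field_simp
  have hT := (Nat.ceil_lt_add_one (a := k * L / (1 / (2 * 10 ^ 11 * 10 ^ 7 * L)))
    (by positivity)).le
  exact ⟨L, _, _, ⟨by norm_num, hk, hL, rfl, Nat.le_ceil _, hT⟩, by linarith,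
    hratio ▸ hT⟩

lemma exists_isTester_two_le_softBound {ε : ℝ} (hε : 0 < ε) (hε1 : ε ≤ 1) (d : ℕ) :
    ∃ V : VMVAlgorithm d, V.IsTester ε 2 ∧
      (V.numQueries : ℝ) ≤ softBound (10 ^ 34) 3 (1 / ε ^ 2) := by
  have hf : 1 ≤ 1 / ε ^ 2 := one_le_one_div (by positivity) (pow_le_one₀ hε.le hε1)
  obtain ⟨k, hS, hk⟩ := exists_sketchParams hε hε1
  obtain ⟨L, c, T, hD, hL, hT⟩ := exists_descentParams hS.one_le_k
  obtain ⟨V, hV, hn⟩ := exists_isTester hS (le_refl 1600) hD d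
  refine ⟨V, hV, ?_⟩
  have hlogk := log_two_mul_add_one_le hf hk
  have hL0 := hD.twenty_le_L
  rw [hn, softBound]
  push_cast
  generalize 1 / ε ^ 2 = f at *
  have hl : 1 ≤ 1 + Real.log f := by linarith [Real.log_nonneg hf]
  generalize 1 + Real.log f = l at *
  have hkL : k * L ^ 2 ≤ 2 * 10 ^ 10 * 116 ^ 2 * (f * l ^ 3) :=
    calc k * L ^ 2 ≤ 2 * 10 ^ 10 * (f * l) * (116 * l) ^ 2 := by
          gcongr
          linarith
      _ = 2 * 10 ^ 10 * 116 ^ 2 * (f * l ^ 3) := by ring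
  have hfl : f * l ≤ f * l ^ 3 := by
    gcongr
    exact le_self_pow₀ hl (by norm_num)
  have hone : 1 ≤ f * l := one_le_mul_of_one_le_of_one_le hf hl
  linarith

lemma VMVAlgorithm.IsTester.of_two {d : ℕ} {ε : ℝ} {p : ℝ≥0∞} (hp : 2 ≤ p) (hε : 0 ≤ ε)
    (hd : 1 ≤ d) {V : VMVAlgorithm d}
    (hV : V.IsTester (ε / (d : ℝ) ^ (1 / 2 - (p⁻¹).toReal)) 2) : V.IsTester ε p := by
  refine fun A hA => ⟨(hV A hA).1, fun ⟨hA0, l, hl, hlε⟩ => (hV A hA).2 ⟨hA0, l, hl, ?_⟩⟩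
  have hscale :
      ε / (d : ℝ) ^ (1 / 2 - (p⁻¹).toReal) * schattenNorm 2 A ≤ ε * schattenNorm p A := by
    rw [div_mul_eq_mul_div, div_le_iff₀ (Real.rpow_pos_of_pos (by exact_mod_cast hd) _)]
    linarith [mul_le_mul_of_nonneg_left (schattenNorm_two_le hp A) hε]
  linarith

lemma toReal_inv_le_half {p : ℝ≥0∞} (hp : 2 ≤ p) : (p⁻¹).toReal ≤ 1 / 2 := by
  simpa using ENNReal.toReal_mono (by simp) (ENNReal.inv_le_inv.2 hp)

lemma one_div_div_rpow_sq (d : ℕ) (ε q : ℝ) :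
    1 / (ε / (d : ℝ) ^ (1 / 2 - q)) ^ 2 = 1 / ε ^ 2 * (d : ℝ) ^ (1 - 2 * q) := by
  have hsq : ((d : ℝ) ^ (1 / 2 - q)) ^ 2 = (d : ℝ) ^ (1 - 2 * q) := by
    rw [← Real.rpow_mul_natCast (Nat.cast_nonneg d)]
    congr 1
    push_cast
    ring
  rw [div_pow, hsq, one_div_div, div_eq_inv_mul, one_div]

end QueryComplexity

theorem mainTheorem5 :
    (∃ (C : ℝ) (K : ℕ), ∀ (d : ℕ) (ε : ℝ), 1 ≤ d → 0 < ε → ε < 1 →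
      ∃ T : VMVAlgorithm d, T.IsTester ε 2 ∧
        (T.numQueries : ℝ) ≤ softBound C K (1 / ε ^ 2)) ∧
    (∃ (C : ℝ) (K : ℕ), ∀ (p : ℝ≥0∞) (d : ℕ) (ε : ℝ), 2 ≤ p → 1 ≤ d → 0 < ε → ε < 1 →
      ∃ T : VMVAlgorithm d, T.IsTester ε p ∧
        (T.numQueries : ℝ) ≤ softBound C K (1 / ε ^ 2 * (d : ℝ) ^ (1 - 2 * (p⁻¹).toReal))) := by
  refine ⟨⟨10 ^ 34, 3, fun d ε _ hε hε1 => exists_isTester_two_le_softBound hε hε1.le d⟩,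
    10 ^ 34, 3, fun p d ε hp hd hε hε1 => ?_⟩
  have hscale : 1 ≤ (d : ℝ) ^ (1 / 2 - (p⁻¹).toReal) :=
    Real.one_le_rpow (by exact_mod_cast hd) (by linarith [toReal_inv_le_half hp])
  obtain ⟨V, hV, hn⟩ := exists_isTester_two_le_softBound
    (ε := ε / (d : ℝ) ^ (1 / 2 - (p⁻¹).toReal)) (by positivity)
    (div_le_one_of_le₀ (hε1.le.trans hscale) (by positivity)) d
  refine ⟨V, hV.of_two hp hε.le hd, ?_⟩
  rwa [one_div_div_rpow_sq] at hn
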